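/- Let $R=\bigoplus_{n\in\mathbb Z}R_n$ be a $\mathbb{Z}$-graded commutative ring concentrated in even degrees. All modules are graded $R$-modules, complexes of $R$-modules have an $R$-linear differential of degree $-1$, and $\otimes=\otimes_R$. A cell $R$-module is a complex $M$ that is the union of an increasing sequence of subcomplexes $0=M_0\subset M_1\subset\cdots$ such that $M_{n+1}$ is the mapping cone of a map $F_n\to M_n$, where $F_n$ is a direct sum of free modules on one homogeneous generator, with zero differential. For a graded module $A$ put $(\Sigma A)_i=A_{i-1}$, and let $T\Sigma A=\bigoplus_{n\ge 0}(\Sigma A)^{\otimes n}$ be the tensor coalgebra with the deconcatenation comultiplication $\Delta(a_1,\dots,a_n)=\sum_{i=0}^n(a_1,\dots,a_i)\otimes(a_{i+1},\dots,a_n)$. A coderivation of degree $k$ of $T\Sigma A$ is an $R$-linear map $f$ of degree $k$ with $\Delta f=(f\otimes 1+1\otimes f)\Delta$, with the Koszul sign rule. An $A_\infty$-algebra $(A,m)$ over $R$ (not required to be unital) is a cell $R$-module $A$ with a coderivation $m$ of $T\Sigma A$ of degree $-1$ such that $m^2=0$, $m(T^0\Sigma A)=0$ and the component $m_1:\Sigma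 A\to\Sigma A$ of $m$ is the differential of $A$. An $A_\infty$-morphism $A\to C$ is a map of differential graded coalgebras $f:T\Sigma A\to T\Sigma C$ that is the identity on $T^0=R$; it is a weak equivalence if its component $f_1:\Sigma A\to\Sigma C$ is a quasi-isomorphism. Two $A_\infty$-algebras over $R$ are weakly equivalent if they are joined by a finite chain of weak equivalences of $A_\infty$-algebras, in either direction. The Hochschild complex $C^*(A,A)$ is the graded $R$-module of coderivations of $T\Sigma A$, with differential $\partial f=[f,m]=f\circ m-(-1)^{|f|}m\circ f$; its cohomology is the Hochschild cohomology $H^*(A,A)$. **Proposition.** If $A$ and $C$ are weakly equivalent $A_\infty$-algebras over $R$, then $C^*(A,A)$ and $C^*(C,C)$ are quasi-isomorphic as complexes of $R$-modules, that is, they are joined by a finite zigzag of quasi-isomorphisms of complexes of $R$-modules. In particular, $H^*(A,A)\cong H^*(C,C)$ as graded $R$-modules. -/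

import Mathlib

open scoped TensorProduct DirectSum

universe u v

noncomputable section

/-! ### Evenly graded commutative rings and differential graded modules -/

/-- A grading of a ring by the integers is even if there is nothing in odd degrees. -/
class IsEvenlyGraded {R : Type u} [CommRing R] (𝒜 : ℤ → AddSubgroup R) : Prop where
  eq_bot_of_odd : ∀ n : ℤ, Odd n → 𝒜 n = ⊥

/-- A complex of graded `R`-modules (homological grading, differential of degree `-1`) over the
graded ring `R = ⨁ 𝒜 n`. No sign occurs in the linearity of `d` because `R` will be even. -/
structure DGModule {R : Type u} [CommRing R] (𝒜 : ℤ → AddSubgroup R) where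
  carrier : Type v
  [addCommGroup : AddCommGroup carrier]
  [module : Module R carrier]
  gr : ℤ → AddSubgroup carrier
  isInternal : DirectSum.IsInternal gr
  smul_mem : ∀ {i j : ℤ} {r : R} {x : carrier}, r ∈ 𝒜 i → x ∈ gr j → r • x ∈ gr (i + j)
  d : carrier →ₗ[R] carrier
  d_mem : ∀ {n : ℤ} {x : carrier}, x ∈ gr n → d x ∈ gr (n - 1)
  d_d : ∀ x : carrier, d (d x) = 0

attribute [instance] DGModule.addCommGroup DGModule.module

namespace DGModule

variable {R : Type u} [CommRing R] {𝒜 : ℤ → AddSubgroup R}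

/-- A map of complexes: `R`-linear, of degree `0`, commuting with the differentials. -/
structure Hom (M N : DGModule.{u, v} 𝒜) where
  toFun : M.carrier →ₗ[R] N.carrier
  map_gr : ∀ {n : ℤ} {x : M.carrier}, x ∈ M.gr n → toFun x ∈ N.gr n
  map_d : ∀ x : M.carrier, toFun (M.d x) = N.d (toFun x)

/-- The submodule of cycles. -/
abbrev cycles (M : DGModule.{u, v} 𝒜) : Submodule R M.carrier := LinearMap.ker M.d

/-- The boundaries, as a submodule of the cycles. -/
abbrev boundaries (M : DGModule.{u, v} 𝒜) : Submodule R M.cycles :=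
  (LinearMap.range M.d).comap M.cycles.subtype

/-- The total homology, cycles modulo boundaries. -/
abbrev Homology (M : DGModule.{u, v} 𝒜) : Type v := M.cycles ⧸ M.boundaries

/-- The homology in degree `n`: the classes of the cycles of degree `n`. -/
def homologyGr (M : DGModule.{u, v} 𝒜) (n : ℤ) : AddSubgroup M.Homology :=
  ((M.gr n).comap M.cycles.subtype.toAddMonoidHom).map M.boundaries.mkQ.toAddMonoidHom

/-- The map induced on cycles. -/
def Hom.onCycles {M N : DGModule.{u, v} 𝒜} (f : Hom M N) : M.cycles →ₗ[R] N.cycles :=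
  f.toFun.restrict fun x hx => by
    rw [LinearMap.mem_ker] at hx ⊢
    rw [← f.map_d, hx, map_zero]

/-- The map induced on homology. -/
def Hom.onHomology {M N : DGModule.{u, v} 𝒜} (f : Hom M N) : M.Homology →ₗ[R] N.Homology :=
  Submodule.mapQ M.boundaries N.boundaries f.onCycles (by
    rintro ⟨x, hx⟩ ⟨y, hy⟩
    exact ⟨f.toFun y, by rw [← f.map_d, hy]; rfl⟩)

/-- A quasi-isomorphism is a map of complexes that induces an isomorphism on homology. -/
def Hom.IsQuasiIso {M N : DGModule.{u, v} 𝒜} (f : Hom M N) : Prop :=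
  Function.Bijective f.onHomology

/-- Two complexes are quasi-isomorphic if a finite zigzag of quasi-isomorphisms joins them. -/
def QuasiIsomorphic (M N : DGModule.{u, v} 𝒜) : Prop :=
  Relation.EqvGen (fun X Y : DGModule.{u, v} 𝒜 => ∃ f : Hom X Y, f.IsQuasiIso) M N

theorem isInternal_shift (M : DGModule.{u, v} 𝒜) :
    DirectSum.IsInternal fun n : ℤ => M.gr (n - 1) := by
  let e : (⨁ n, M.gr n) ≃+ ⨁ n : ℤ, M.gr (n - 1) :=
    DirectSum.equivCongrLeft (β := fun n => M.gr n) (Equiv.subRight (1 : ℤ)).symm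
  have key : ∀ x, DirectSum.coeAddMonoidHom M.gr (e.symm x)
      = DirectSum.coeAddMonoidHom (fun n : ℤ => M.gr (n - 1)) x := by
    intro x
    induction x using DirectSum.induction_on with
    | zero => simp
    | add x y h h' => rw [map_add, map_add, h, h', map_add]
    | of n x =>
      have h : e.symm (DirectSum.of (fun n : ℤ => M.gr (n - 1)) n x)
          = DirectSum.of (fun n => M.gr n) (n - 1) x := by
        rw [AddEquiv.symm_apply_eq]
        exact (DirectSum.equivCongrLeft_of (β := fun n => M.gr n)
          (Equiv.subRight (1 : ℤ)).symm n x).symm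
      rw [h]
      exact (DirectSum.coeAddMonoidHom_of M.gr (n - 1) x).trans
        (DirectSum.coeAddMonoidHom_of (fun n : ℤ => M.gr (n - 1)) n x).symm
  have h : (DirectSum.coeAddMonoidHom (fun n : ℤ => M.gr (n - 1)) : _ → M.carrier)
      = DirectSum.coeAddMonoidHom M.gr ∘ e.symm := funext fun x => (key x).symm
  unfold DirectSum.IsInternal
  rw [h]
  exact M.isInternal.comp e.symm.bijective

/-- The suspension: `(ΣM)ₙ = Mₙ₋₁`, with the same underlying module and differential. -/
abbrev susp (M : DGModule.{u, v} 𝒜) : DGModule.{u, v} 𝒜 where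
  carrier := M.carrier
  gr n := M.gr (n - 1)
  isInternal := isInternal_shift M
  smul_mem {i j r x} hr hx := by
    have := M.smul_mem hr hx
    rwa [← add_sub_assoc] at this
  d := M.d
  d_mem hx := M.d_mem hx
  d_d := M.d_d

/-- A cell `R`-module: it has a homogeneous `R`-basis together with a rank function such that the
differential of a basis element is a combination of basis elements of smaller rank. The spans `Mₙ`
of the basis elements of rank `< n` form the expanding sequence of submodules, with `M₀ = 0`, with
union everything, and with `Mₙ₊₁` the mapping cone of `d : Fₙ → Mₙ`, where `Fₙ` is the direct sum
of the sphere modules on the (desuspended) basis elements of rank `n`. -/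
def IsCell (M : DGModule.{u, v} 𝒜) : Prop :=
  ∃ (ι : Type v) (b : Module.Basis ι R M.carrier) (deg : ι → ℤ) (rk : ι → ℕ),
    (∀ i, b i ∈ M.gr (deg i)) ∧
    ∀ i, M.d (b i) ∈ Submodule.span R (b '' {j | rk j < rk i})

/-! ### Signs -/

/-- The sign operator `x ↦ (-1)^(k * |x|) x` as an additive map. -/
def sgnAux (M : DGModule.{u, v} 𝒜) (k : ℤ) : M.carrier →+ M.carrier :=
  (DirectSum.toAddMonoid fun n : ℤ => ((k * n).negOnePow : ℤ) • (M.gr n).subtype).comp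
    (AddEquiv.ofBijective (DirectSum.coeAddMonoidHom M.gr) M.isInternal).symm.toAddMonoidHom

theorem sgnAux_of_mem (M : DGModule.{u, v} 𝒜) (k : ℤ) {n : ℤ} {x : M.carrier} (hx : x ∈ M.gr n) :
    M.sgnAux k x = ((k * n).negOnePow : ℤ) • x := by
  have h : (AddEquiv.ofBijective (DirectSum.coeAddMonoidHom M.gr) M.isInternal).symm x
      = DirectSum.of (fun n => M.gr n) n ⟨x, hx⟩ := by
    rw [AddEquiv.symm_apply_eq]
    exact (DirectSum.coeAddMonoidHom_of M.gr n ⟨x, hx⟩).symm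
  simp only [sgnAux, AddMonoidHom.comp_apply]
  erw [h, DirectSum.toAddMonoid_of]
  rfl

theorem induction_gr (M : DGModule.{u, v} 𝒜) {p : M.carrier → Prop} (h0 : p 0)
    (hh : ∀ n x, x ∈ M.gr n → p x) (ha : ∀ x y, p x → p y → p (x + y)) (x : M.carrier) : p x := by
  classical
  let _ := M.isInternal.chooseDecomposition
  induction x using DirectSum.Decomposition.inductionOn M.gr with
  | zero => exact h0
  | homogeneous m => exact hh _ _ m.2
  | add m m' h h' => exact ha _ _ h h'

theorem even_or_eq_zero [IsEvenlyGraded 𝒜] {i : ℤ} {r : R} (hr : r ∈ 𝒜 i) : Even i ∨ r = 0 := by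
  rcases Int.even_or_odd i with h | h
  · exact Or.inl h
  · rw [IsEvenlyGraded.eq_bot_of_odd (𝒜 := 𝒜) i h] at hr
    exact Or.inr hr

variable [GradedRing 𝒜] [IsEvenlyGraded 𝒜]

/-- The sign operator `x ↦ (-1)^(k * |x|) x`. It is `R`-linear because `R` is even. -/
def sgn (M : DGModule.{u, v} 𝒜) (k : ℤ) : M.carrier →ₗ[R] M.carrier :=
  { M.sgnAux k with
    map_smul' := by
      intro r x
      change M.sgnAux k (r • x) = r • M.sgnAux k x
      induction r using DirectSum.Decomposition.inductionOn 𝒜 with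
      | zero => simp
      | add r r' h h' => rw [add_smul, map_add, h, h', add_smul]
      | @homogeneous i r =>
        induction x using M.induction_gr with
        | h0 => simp
        | ha x y h h' => rw [smul_add, map_add, h, h', map_add, smul_add]
        | hh n x hx =>
          rw [M.sgnAux_of_mem k (M.smul_mem r.2 hx), M.sgnAux_of_mem k hx]
          rcases even_or_eq_zero r.2 with h | h
          · rw [mul_add, Int.negOnePow_add, Int.negOnePow_even _ (h.mul_left k), one_mul,
              smul_comm]
          · simp [h] }

theorem sgn_congr (M : DGModule.{u, v} 𝒜) {k l : ℤ} (h : Even l) : M.sgn (l + k) = M.sgn k := by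
  ext x
  induction x using M.induction_gr with
  | h0 => simp
  | ha x y h h' => rw [map_add, h, h', map_add]
  | hh n x hx =>
    change M.sgnAux _ x = M.sgnAux _ x
    rw [M.sgnAux_of_mem _ hx, M.sgnAux_of_mem _ hx, add_mul, Int.negOnePow_add,
      Int.negOnePow_even _ (h.mul_right n), one_mul]

theorem sgn_of_mem (M : DGModule.{u, v} 𝒜) (k : ℤ) {n : ℤ} {x : M.carrier} (hx : x ∈ M.gr n) :
    M.sgn k x = ((k * n).negOnePow : ℤ) • x :=
  M.sgnAux_of_mem k hx

end DGModule

/-! ### The tensor coalgebra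

For a graded module `M` the underlying module of the tensor coalgebra is `TensorAlgebra R M`; the
word `(a₁, …, aₙ)` is the product `ι a₁ * ⋯ * ι aₙ`. -/

namespace TensorCoalg

section Deconcatenation

variable (R : Type u) [CommRing R] (V : Type v) [AddCommGroup V] [Module R V]

/-- Auxiliary operator used to define the deconcatenation recursively:
`(w, z) ↦ (a w, 1 ⊗ a w + (a ⊗ 1) z)`. -/
def deconcStep : V →ₗ[R] Module.End R
    (TensorAlgebra R V × (TensorAlgebra R V ⊗[R] TensorAlgebra R V)) where
  toFun a :=
    (LinearMap.mulLeft R (TensorAlgebra.ι R a) ∘ₗ LinearMap.fst R _ _).prod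
      (TensorProduct.mk R _ _ 1 ∘ₗ LinearMap.mulLeft R (TensorAlgebra.ι R a) ∘ₗ LinearMap.fst R _ _
        + LinearMap.rTensor _ (LinearMap.mulLeft R (TensorAlgebra.ι R a)) ∘ₗ LinearMap.snd R _ _)
  map_add' a b := by
    have h : LinearMap.mulLeft R (TensorAlgebra.ι R (a + b))
        = LinearMap.mulLeft R (TensorAlgebra.ι R a) + LinearMap.mulLeft R (TensorAlgebra.ι R b) := by
      ext; simp [add_mul]
    rw [h, LinearMap.rTensor_add]
    refine LinearMap.ext fun x => Prod.ext ?_ ?_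
    · simp
    · simp [TensorProduct.tmul_add]; abel
  map_smul' r a := by
    have h : LinearMap.mulLeft R (TensorAlgebra.ι R (r • a))
        = r • LinearMap.mulLeft R (TensorAlgebra.ι R a) := by
      ext; simp
    rw [h, LinearMap.rTensor_smul]
    refine LinearMap.ext fun x => Prod.ext ?_ ?_
    · simp
    · simp

/-- The comultiplication of the tensor coalgebra,
`Δ (a₁, …, aₙ) = ∑ᵢ (a₁, …, aᵢ) ⊗ (aᵢ₊₁, …, aₙ)` with `0 ≤ i ≤ n`; see `deconc_prod`. -/
def deconc : TensorAlgebra R V →ₗ[R] TensorAlgebra R V ⊗[R] TensorAlgebra R V :=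
  LinearMap.snd R _ _ ∘ₗ LinearMap.applyₗ (1, 1 ⊗ₜ[R] 1) ∘ₗ
    (TensorAlgebra.lift R (deconcStep R V)).toLinearMap

variable {R V}

theorem deconcStep_fst (x : TensorAlgebra R V) :
    ∀ p, (TensorAlgebra.lift R (deconcStep R V) x p).1 = x * p.1 := by
  induction x using TensorAlgebra.induction with
  | algebraMap r => intro p; simp [Algebra.smul_def]
  | ι a => intro p; simp [deconcStep]
  | mul x y hx hy => intro p; rw [map_mul, Module.End.mul_apply, hx, hy, mul_assoc]
  | add x y hx hy => intro p; rw [map_add, LinearMap.add_apply, Prod.fst_add, hx, hy, add_mul]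

theorem deconc_one : deconc R V 1 = 1 ⊗ₜ 1 := by
  simp [deconc]

theorem deconc_ι_mul (a : V) (w : TensorAlgebra R V) :
    deconc R V (TensorAlgebra.ι R a * w) = 1 ⊗ₜ (TensorAlgebra.ι R a * w)
      + LinearMap.rTensor _ (LinearMap.mulLeft R (TensorAlgebra.ι R a)) (deconc R V w) := by
  have h := deconcStep_fst w (1, 1 ⊗ₜ[R] 1)
  rw [mul_one] at h
  have h' : ∀ p, (deconcStep R V a p).2 = 1 ⊗ₜ[R] (TensorAlgebra.ι R a * p.1)
      + LinearMap.rTensor _ (LinearMap.mulLeft R (TensorAlgebra.ι R a)) p.2 := fun p => rfl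
  simp only [deconc, LinearMap.comp_apply, AlgHom.toLinearMap_apply, map_mul,
    TensorAlgebra.lift_ι_apply, LinearMap.applyₗ_apply_apply, Module.End.mul_apply,
    LinearMap.snd_apply, h', h]

theorem deconc_prod (l : List V) :
    deconc R V (l.map (TensorAlgebra.ι R)).prod = ∑ i ∈ Finset.range (l.length + 1),
      ((l.take i).map (TensorAlgebra.ι R)).prod ⊗ₜ[R]
        ((l.drop i).map (TensorAlgebra.ι R)).prod := by
  induction l with
  | nil => simp [deconc_one]
  | cons a l ih =>
    rw [List.map_cons, List.prod_cons, deconc_ι_mul, ih, List.length_cons,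
      Finset.sum_range_succ' _ (l.length + 1), map_sum, add_comm]
    simp

end Deconcatenation

variable {R : Type u} [CommRing R] {𝒜 : ℤ → AddSubgroup R}

/-- `IsWord M n w`: the element `w` is a scalar multiple of a word of homogeneous elements of `M`,
of total degree `n`. -/
inductive IsWord (M : DGModule.{u, v} 𝒜) : ℤ → TensorAlgebra R M.carrier → Prop
  | scalar {n : ℤ} {r : R} (hr : r ∈ 𝒜 n) : IsWord M n (algebraMap R _ r)
  | cons {n p : ℤ} {a : M.carrier} {w : TensorAlgebra R M.carrier} (ha : a ∈ M.gr n)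
      (hw : IsWord M p w) : IsWord M (n + p) (TensorAlgebra.ι R a * w)

/-- The elements of degree `n` of the tensor coalgebra. -/
def gr (M : DGModule.{u, v} 𝒜) (n : ℤ) : AddSubgroup (TensorAlgebra R M.carrier) :=
  AddSubgroup.closure {w | IsWord M n w}

theorem IsWord.mul {M : DGModule.{u, v} 𝒜} [SetLike.GradedMonoid 𝒜] {n p : ℤ}
    {x y : TensorAlgebra R M.carrier} (hx : IsWord M n x) (hy : IsWord M p y) :
    IsWord M (n + p) (x * y) := by
  induction hx with
  | @scalar n r hr =>
    induction hy with
    | @scalar p s hs =>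
      rw [← map_mul]
      exact .scalar (SetLike.mul_mem_graded hr hs)
    | @cons p q a w ha hw ih =>
      rw [← mul_assoc, Algebra.commutes, mul_assoc, add_left_comm]
      exact .cons ha ih
  | @cons n q a w ha hw ih =>
    rw [mul_assoc, add_assoc]
    exact .cons ha ih

theorem smul_mem_gr (M : DGModule.{u, v} 𝒜) [SetLike.GradedMonoid 𝒜] {i n : ℤ} {r : R}
    {x : TensorAlgebra R M.carrier} (hr : r ∈ 𝒜 i) (hx : x ∈ gr M n) : r • x ∈ gr M (i + n) := by
  induction hx using AddSubgroup.closure_induction with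
  | mem x hx =>
    rw [Algebra.smul_def]
    exact AddSubgroup.subset_closure ((IsWord.scalar hr).mul hx)
  | zero => rw [smul_zero]; exact zero_mem _
  | add x y _ _ hx hy => rw [smul_add]; exact add_mem hx hy
  | neg x _ hx => rw [smul_neg]; exact neg_mem hx

/-- The graded commutator `[f, g] = f g - (-1)^(k * l) g f` for `f` of degree `k` and `g` of
degree `l`. -/
def comm {M : DGModule.{u, v} 𝒜} (k l : ℤ)
    (f g : TensorAlgebra R M.carrier →ₗ[R] TensorAlgebra R M.carrier) :
    TensorAlgebra R M.carrier →ₗ[R] TensorAlgebra R M.carrier :=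
  f ∘ₗ g - ((k * l).negOnePow : ℤ) • (g ∘ₗ f)

theorem comm_comm_self {M : DGModule.{u, v} 𝒜} (k : ℤ)
    {f m : TensorAlgebra R M.carrier →ₗ[R] TensorAlgebra R M.carrier} (hm : m ∘ₗ m = 0) :
    comm (k - 1) (-1) (comm k (-1) f m) m = 0 := by
  have h : ((k - 1) * -1).negOnePow = -((k * -1).negOnePow) := by
    rw [sub_mul, Int.negOnePow_sub]; simp
  simp only [comm, h, LinearMap.sub_comp, LinearMap.comp_sub, LinearMap.smul_comp,
    LinearMap.comp_smul, LinearMap.comp_assoc, hm, LinearMap.comp_zero]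
  rw [← LinearMap.comp_assoc f m m, hm]
  simp

variable [GradedRing 𝒜]

/-- The words of homogeneous elements span the tensor coalgebra. -/
theorem mem_closure_words (M : DGModule.{u, v} 𝒜) (x : TensorAlgebra R M.carrier) :
    x ∈ AddSubgroup.closure {w | ∃ n, IsWord M n w} := by
  induction x using TensorAlgebra.induction with
  | algebraMap r =>
    induction r using DirectSum.Decomposition.inductionOn 𝒜 with
    | zero => rw [map_zero]; exact zero_mem _
    | homogeneous r => exact AddSubgroup.subset_closure ⟨_, .scalar r.2⟩
    | add r s hr hs => rw [map_add]; exact add_mem hr hs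
  | ι a =>
    induction a using M.induction_gr with
    | h0 => rw [map_zero]; exact zero_mem _
    | ha x y hx hy => rw [map_add]; exact add_mem hx hy
    | hh n x hx =>
      have h : IsWord M 0 (1 : TensorAlgebra R M.carrier) := by
        rw [← map_one (algebraMap R _)]
        exact .scalar SetLike.GradedOne.one_mem
      rw [← mul_one (TensorAlgebra.ι R x)]
      exact AddSubgroup.subset_closure ⟨_, .cons hx h⟩
  | mul x y hx hy =>
    induction hx using AddSubgroup.closure_induction with
    | zero => rw [zero_mul]; exact zero_mem _
    | add x x' _ _ hx hx' => rw [add_mul]; exact add_mem hx hx'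
    | neg x _ hx => rw [neg_mul]; exact neg_mem hx
    | mem x hx =>
      induction hy using AddSubgroup.closure_induction with
      | zero => rw [mul_zero]; exact zero_mem _
      | add x x' _ _ hx hx' => rw [mul_add]; exact add_mem hx hx'
      | neg x _ hx => rw [mul_neg]; exact neg_mem hx
      | mem y hy =>
        obtain ⟨n, hx⟩ := hx
        obtain ⟨p, hy⟩ := hy
        exact AddSubgroup.subset_closure ⟨_, hx.mul hy⟩
  | add x y hx hy => exact add_mem hx hy

theorem ext_words (M : DGModule.{u, v} 𝒜) {P : Type*} [AddCommGroup P] [Module R P]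
    {f g : TensorAlgebra R M.carrier →ₗ[R] P} (h : ∀ n w, IsWord M n w → f w = g w) : f = g := by
  ext1 x
  induction mem_closure_words M x using AddSubgroup.closure_induction with
  | mem x hx => obtain ⟨n, hx⟩ := hx; exact h n x hx
  | zero => rw [map_zero, map_zero]
  | add x y _ _ hx hy => rw [map_add, hx, hy, map_add]
  | neg x _ hx => rw [map_neg, hx, map_neg]

variable [IsEvenlyGraded 𝒜]

/-- The sign operator `x ↦ (-1)^(k * |x|) x` on the tensor coalgebra. -/
def sgn (M : DGModule.{u, v} 𝒜) (k : ℤ) :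
    TensorAlgebra R M.carrier →ₗ[R] TensorAlgebra R M.carrier :=
  (TensorAlgebra.lift R (TensorAlgebra.ι R ∘ₗ M.sgn k)).toLinearMap

theorem sgn_word {M : DGModule.{u, v} 𝒜} (k : ℤ) {n : ℤ} {w : TensorAlgebra R M.carrier}
    (hw : IsWord M n w) : sgn M k w = ((k * n).negOnePow : ℤ) • w := by
  induction hw with
  | @scalar n r hr =>
    rcases DGModule.even_or_eq_zero hr with h | h
    · simp [sgn, Int.negOnePow_even _ (h.mul_left k)]
    · simp [h]
  | @cons n p a w ha hw ih =>
    have ih' : TensorAlgebra.lift R (TensorAlgebra.ι R ∘ₗ M.sgn k) w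
      = ((k * p).negOnePow : ℤ) • w := ih
    simp only [sgn, AlgHom.toLinearMap_apply, map_mul, TensorAlgebra.lift_ι_apply, ih',
      LinearMap.comp_apply, M.sgn_of_mem k ha, map_zsmul, smul_mul_assoc, mul_smul_comm, smul_smul,
      mul_add, Int.negOnePow_add, Units.val_mul]
    rw [mul_comm]

theorem sgn_of_mem {M : DGModule.{u, v} 𝒜} (k : ℤ) {n : ℤ} {w : TensorAlgebra R M.carrier}
    (hw : w ∈ gr M n) : sgn M k w = ((k * n).negOnePow : ℤ) • w := by
  induction hw using AddSubgroup.closure_induction with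
  | mem x hx => exact sgn_word k hx
  | zero => simp
  | add x y _ _ hx hy => rw [map_add, hx, hy, smul_add]
  | neg x _ hx => rw [map_neg, hx, smul_neg]

/-- `Coder_k`: the `R`-linear maps `f` of degree `k` of the tensor coalgebra of `M` to itself with
`Δ f = (f ⊗ 1 + 1 ⊗ f) Δ`. The Koszul sign in `(1 ⊗ f) (x ⊗ y) = (-1)^(k * |x|) x ⊗ f y` is
carried by `sgn M k`. -/
def coder (M : DGModule.{u, v} 𝒜) (k : ℤ) :
    AddSubgroup (TensorAlgebra R M.carrier →ₗ[R] TensorAlgebra R M.carrier) where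
  carrier := {f | (∀ n, ∀ x ∈ gr M n, f x ∈ gr M (n + k)) ∧
    deconc R M.carrier ∘ₗ f
      = (TensorProduct.map f LinearMap.id + TensorProduct.map (sgn M k) f) ∘ₗ deconc R M.carrier}
  zero_mem' := ⟨fun n x _ => zero_mem _, by simp⟩
  add_mem' := by
    rintro f g ⟨hf, hf'⟩ ⟨hg, hg'⟩
    refine ⟨fun n x hx => add_mem (hf n x hx) (hg n x hx), ?_⟩
    rw [LinearMap.comp_add, hf', hg', TensorProduct.map_add_left, TensorProduct.map_add_right]
    simp only [LinearMap.add_comp]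
    abel
  neg_mem' := by
    rintro f ⟨hf, hf'⟩
    refine ⟨fun n x hx => neg_mem (hf n x hx), ?_⟩
    rw [LinearMap.comp_neg, hf', ← neg_one_smul R f, TensorProduct.map_smul_left,
      TensorProduct.map_smul_right, ← smul_add, LinearMap.smul_comp]
    module

theorem sgn_congr (M : DGModule.{u, v} 𝒜) {k l : ℤ} (h : Even l) : sgn M (l + k) = sgn M k := by
  rw [sgn, M.sgn_congr h]; rfl

instance coder_gradedSMul (M : DGModule.{u, v} 𝒜) : SetLike.GradedSMul 𝒜 (coder M) where
  smul_mem := by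
    rintro i k r f hr ⟨hf, hf'⟩
    refine ⟨fun n x hx => ?_, ?_⟩
    · have := smul_mem_gr M hr (hf n x hx)
      rwa [add_left_comm] at this
    · rcases DGModule.even_or_eq_zero hr with h | h
      · rw [vadd_eq_add, sgn_congr M h, LinearMap.comp_smul, hf', TensorProduct.map_smul_left,
          TensorProduct.map_smul_right, ← smul_add, LinearMap.smul_comp]
      · simp [h]

theorem sgn_comp {M : DGModule.{u, v} 𝒜} {l : ℤ}
    {f : TensorAlgebra R M.carrier →ₗ[R] TensorAlgebra R M.carrier} (hf : f ∈ coder M l) (k : ℤ) :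
    sgn M k ∘ₗ f = ((k * l).negOnePow : ℤ) • (f ∘ₗ sgn M k) := by
  refine ext_words M fun n w hw => ?_
  have hw' : w ∈ gr M n := AddSubgroup.subset_closure hw
  rw [LinearMap.comp_apply, sgn_of_mem k (hf.1 n w hw'), LinearMap.smul_apply,
    LinearMap.comp_apply, sgn_word k hw, map_zsmul, smul_smul, mul_add, Int.negOnePow_add,
    Units.val_mul, mul_comm]

theorem sgn_comp_sgn (M : DGModule.{u, v} 𝒜) (k l : ℤ) : sgn M k ∘ₗ sgn M l = sgn M (k + l) := by
  refine ext_words M fun n w hw => ?_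
  rw [LinearMap.comp_apply, sgn_word l hw, map_zsmul, sgn_word k hw, sgn_word _ hw, smul_smul,
    add_mul, Int.negOnePow_add, Units.val_mul, mul_comm]

theorem comm_mem {M : DGModule.{u, v} 𝒜} {k l : ℤ}
    {f g : TensorAlgebra R M.carrier →ₗ[R] TensorAlgebra R M.carrier} (hf : f ∈ coder M k)
    (hg : g ∈ coder M l) : comm k l f g ∈ coder M (k + l) := by
  refine ⟨fun n x hx => ?_, ?_⟩
  · refine sub_mem ?_ (zsmul_mem ?_ _)
    · have := hf.1 _ _ (hg.1 n x hx)
      rwa [add_assoc, add_comm l] at this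
    · have := hg.1 _ _ (hf.1 n x hx)
      rwa [add_assoc] at this
  · have e1 : ∀ x, sgn M k (g x) = ((k * l).negOnePow : ℤ) • g (sgn M k x) := fun x =>
      LinearMap.congr_fun (sgn_comp hg k) x
    have e2 : ∀ x, sgn M l (f x) = ((k * l).negOnePow : ℤ) • f (sgn M l x) := fun x => by
      rw [mul_comm k l]; exact LinearMap.congr_fun (sgn_comp hf l) x
    have e3 : ∀ x, sgn M k (sgn M l x) = sgn M (k + l) x := fun x =>
      LinearMap.congr_fun (sgn_comp_sgn M k l) x
    have e4 : ∀ x, sgn M l (sgn M k x) = sgn M (k + l) x := fun x => by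
      rw [add_comm k l]; exact LinearMap.congr_fun (sgn_comp_sgn M l k) x
    have hs : ((k * l).negOnePow : ℤ) * ((k * l).negOnePow : ℤ) = 1 := by
      rw [← Units.val_mul, Int.units_mul_self, Units.val_one]
    have key : (TensorProduct.map f LinearMap.id + TensorProduct.map (sgn M k) f) ∘ₗ
          (TensorProduct.map g LinearMap.id + TensorProduct.map (sgn M l) g)
        - ((k * l).negOnePow : ℤ) •
          ((TensorProduct.map g LinearMap.id + TensorProduct.map (sgn M l) g) ∘ₗ
            (TensorProduct.map f LinearMap.id + TensorProduct.map (sgn M k) f))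
        = TensorProduct.map (comm k l f g) LinearMap.id
          + TensorProduct.map (sgn M (k + l)) (comm k l f g) := by
      refine TensorProduct.ext' fun x y => ?_
      simp only [comm]
      generalize ((k * l).negOnePow : ℤ) = s at e1 e2 hs ⊢
      simp only [LinearMap.sub_apply, LinearMap.comp_apply, LinearMap.add_apply,
        LinearMap.smul_apply, TensorProduct.map_tmul, LinearMap.id_apply, e1, e2, e3, e4, map_add,
        smul_add, TensorProduct.tmul_sub, TensorProduct.sub_tmul, TensorProduct.tmul_smul,
        ← TensorProduct.smul_tmul', smul_smul, hs, one_smul]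
      module
    have hf' := hf.2
    have hg' := hg.2
    rw [← key, LinearMap.sub_comp, LinearMap.smul_comp, comm, LinearMap.comp_sub,
      LinearMap.comp_smul, ← LinearMap.comp_assoc, hf', ← LinearMap.comp_assoc _ g, hg',
      LinearMap.comp_assoc, hg', LinearMap.comp_assoc f, hf', LinearMap.comp_assoc,
      LinearMap.comp_assoc]

end TensorCoalg

/-! ### Direct sums of graded pieces -/

theorem isInternal_range_of (C : ℤ → Type*) [∀ k, AddCommGroup (C k)] :
    DirectSum.IsInternal fun k => (DirectSum.of C k).range := by
  have h : ∀ x : ⨁ k, C k, DirectSum.coeAddMonoidHom (fun k => (DirectSum.of C k).range)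
      (DirectSum.map (fun k => (DirectSum.of C k).rangeRestrict) x) = x := by
    intro x
    induction x using DirectSum.induction_on with
    | zero => simp
    | add x y hx hy => rw [map_add, map_add, hx, hy]
    | of k x =>
      rw [DirectSum.map_of]
      exact DirectSum.coeAddMonoidHom_of (fun k => (DirectSum.of C k).range) k _
  have hsurj : Function.Surjective
      (DirectSum.map (fun k => (DirectSum.of C k).rangeRestrict)) := by
    intro y
    induction y using DirectSum.induction_on with
    | zero => exact ⟨0, map_zero _⟩
    | add x y hx hy =>
      obtain ⟨x, rfl⟩ := hx
      obtain ⟨y, rfl⟩ := hy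
      exact ⟨x + y, map_add _ _ _⟩
    | of k x =>
      obtain ⟨_, x, rfl⟩ := x
      exact ⟨DirectSum.of C k x, DirectSum.map_of _ _ _⟩
  refine ⟨fun y y' hy => ?_, fun x => ⟨_, h x⟩⟩
  obtain ⟨x, rfl⟩ := hsurj y
  obtain ⟨x', rfl⟩ := hsurj y'
  rw [show x = x' from (h x).symm.trans (hy.trans (h x'))]

theorem gradedSum_of_congr {E : Type v} [AddCommGroup E] (C : ℤ → AddSubgroup E) {a b : ℤ}
    (h : a = b) {f : C a} {g : C b} (hfg : f.1 = g.1) :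
    DirectSum.of (fun k => C k) a f = DirectSum.of (fun k => C k) b g := by
  subst h
  rw [Subtype.ext hfg]

section GradedSum

variable {R : Type u} [CommRing R] (𝒜 : ℤ → AddSubgroup R) [GradedRing 𝒜]
  {E : Type v} [AddCommGroup E] [Module R E] (C : ℤ → AddSubgroup E) [SetLike.GradedSMul 𝒜 C]

theorem gradedSum_of_smul {i j : ℤ} {r : R} (hr : r ∈ 𝒜 i) (f : C j) :
    letI := GradedModule.isModule 𝒜 C
    r • DirectSum.of (fun k => C k) j f
      = DirectSum.of (fun k => C k) (i + j) ⟨r • f.1, SetLike.GradedSMul.smul_mem hr f.2⟩ := by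
  change DirectSum.decompose 𝒜 r • DirectSum.of (fun k => C k) j f = _
  rw [DirectSum.decompose_of_mem 𝒜 hr, DirectSum.Gmodule.of_smul_of]
  rfl

/-- An additive endomorphism of `⨁ C k` that is linear on homogeneous elements is `R`-linear. -/
theorem gradedSum_map_smul (D : (⨁ k, C k) →+ ⨁ k, C k)
    (h : letI := GradedModule.isModule 𝒜 C
      ∀ (i j : ℤ) (r : R) (f : C j), r ∈ 𝒜 i → D (r • DirectSum.of (fun k => C k) j f)
        = r • D (DirectSum.of (fun k => C k) j f)) (r : R) (x : ⨁ k, C k) :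
    letI := GradedModule.isModule 𝒜 C
    D (r • x) = r • D x := by
  let _ := GradedModule.isModule 𝒜 C
  change D (r • x) = r • D x
  induction r using DirectSum.Decomposition.inductionOn 𝒜 with
  | zero => rw [zero_smul, zero_smul, map_zero]
  | add r r' hr hr' => rw [add_smul, map_add, hr, hr', add_smul]
  | @homogeneous i r =>
    induction x using DirectSum.induction_on with
    | zero => rw [smul_zero, map_zero, smul_zero]
    | add x y hx hy => rw [smul_add, map_add, hx, hy, map_add, smul_add]
    | of k f => exact h i k r f r.2

end GradedSum

/-! ### `A∞`-algebras, their morphisms and weak equivalences -/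

variable {R : Type u} [CommRing R] (𝒜 : ℤ → AddSubgroup R) [GradedRing 𝒜] [IsEvenlyGraded 𝒜]

/-- An `A∞`-algebra (no unit required): a cell `R`-module `A` with a coderivation `m` of degree
`-1` of the tensor coalgebra `T ΣA` such that `m² = 0`, `m` vanishes on `T⁰ ΣA = R`, and the first
component of `m` is the differential of `A`. -/
structure AInfAlgebra extends DGModule.{u, v} 𝒜 where
  isCell : toDGModule.IsCell
  m : TensorAlgebra R toDGModule.susp.carrier →ₗ[R] TensorAlgebra R toDGModule.susp.carrier
  m_mem : m ∈ TensorCoalg.coder toDGModule.susp (-1)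
  m_m : m ∘ₗ m = 0
  m_one : m 1 = 0
  m_comp_one : ∀ a, TensorAlgebra.ιInv (m (TensorAlgebra.ι R a)) = toDGModule.susp.d a

namespace AInfAlgebra

variable {𝒜}

/-- An `A∞`-morphism `A → C`: a map `T ΣA → T ΣC` of differential graded coalgebras that is the
identity on `T⁰ = R`. -/
structure Hom (A C : AInfAlgebra.{u, v} 𝒜) where
  toFun : TensorAlgebra R A.susp.carrier →ₗ[R] TensorAlgebra R C.susp.carrier
  map_gr : ∀ n, ∀ x ∈ TensorCoalg.gr A.susp n, toFun x ∈ TensorCoalg.gr C.susp n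
  map_deconc : TensorCoalg.deconc R C.susp.carrier ∘ₗ toFun
    = TensorProduct.map toFun toFun ∘ₗ TensorCoalg.deconc R A.susp.carrier
  map_counit : ∀ x, TensorAlgebra.algebraMapInv (toFun x) = TensorAlgebra.algebraMapInv x
  map_m : toFun ∘ₗ A.m = C.m ∘ₗ toFun
  map_one : toFun 1 = 1

/-- The first component `f₁ : ΣA → ΣC` of an `A∞`-morphism. -/
def Hom.component_one {A C : AInfAlgebra.{u, v} 𝒜} (f : Hom A C) :
    A.susp.carrier →ₗ[R] C.susp.carrier :=
  TensorAlgebra.ιInv ∘ₗ f.toFun ∘ₗ TensorAlgebra.ι R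

/-- An `A∞`-morphism is a weak equivalence if its first component is a quasi-isomorphism of
complexes. -/
def Hom.IsWeakEquivalence {A C : AInfAlgebra.{u, v} 𝒜} (f : Hom A C) : Prop :=
  ∃ g : DGModule.Hom A.susp C.susp, g.toFun = f.component_one ∧ g.IsQuasiIso

/-- Two `A∞`-algebras are weakly equivalent if a finite chain of weak equivalences, pointing in
either direction, joins them. -/
def WeaklyEquivalent (A C : AInfAlgebra.{u, v} 𝒜) : Prop :=
  Relation.EqvGen (fun X Y : AInfAlgebra.{u, v} 𝒜 => ∃ f : Hom X Y, f.IsWeakEquivalence) A C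

/-! ### The Hochschild complex -/

/-- The Hochschild differential `f ↦ [f, m]` on coderivations of degree `k`. -/
def hochschildDegD (A : AInfAlgebra.{u, v} 𝒜) (k : ℤ) :
    TensorCoalg.coder A.susp k →+ TensorCoalg.coder A.susp (k - 1) where
  toFun f := ⟨TensorCoalg.comm k (-1) f A.m, TensorCoalg.comm_mem f.2 A.m_mem⟩
  map_zero' := by ext1; simp [TensorCoalg.comm]
  map_add' f g := by
    ext1
    simp only [TensorCoalg.comm, AddSubgroup.coe_add, LinearMap.add_comp, LinearMap.comp_add,
      smul_add]
    abel

/-- The Hochschild differential on the direct sum of the groups of coderivations of degree `k`. -/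
def hochschildAddD (A : AInfAlgebra.{u, v} 𝒜) :
    (⨁ k, TensorCoalg.coder A.susp k) →+ ⨁ k, TensorCoalg.coder A.susp k :=
  DirectSum.toAddMonoid fun k =>
    (DirectSum.of (fun k => TensorCoalg.coder A.susp k) (k - 1)).comp (A.hochschildDegD k)

theorem hochschildAddD_of (A : AInfAlgebra.{u, v} 𝒜) (k : ℤ) (f : TensorCoalg.coder A.susp k) :
    A.hochschildAddD (DirectSum.of (fun k => TensorCoalg.coder A.susp k) k f)
      = DirectSum.of (fun k => TensorCoalg.coder A.susp k) (k - 1) (A.hochschildDegD k f) :=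
  DirectSum.toAddMonoid_of _ _ _

theorem hochschildDegD_smul (A : AInfAlgebra.{u, v} 𝒜) {i k : ℤ} {r : R} (hr : r ∈ 𝒜 i)
    (f : TensorCoalg.coder A.susp k) :
    DirectSum.of (fun k => TensorCoalg.coder A.susp k) (i + k - 1) (A.hochschildDegD (i + k)
        ⟨r • f.1, SetLike.GradedSMul.smul_mem hr f.2⟩)
      = DirectSum.of (fun k => TensorCoalg.coder A.susp k) (i + (k - 1))
        ⟨r • (A.hochschildDegD k f).1,
          SetLike.GradedSMul.smul_mem hr (A.hochschildDegD k f).2⟩ := by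
  refine gradedSum_of_congr _ (add_sub_assoc i k 1) ?_
  change TensorCoalg.comm (i + k) (-1) (r • f.1) A.m = r • TensorCoalg.comm k (-1) f.1 A.m
  rcases DGModule.even_or_eq_zero hr with h | h
  · simp only [TensorCoalg.comm, add_mul, Int.negOnePow_add, Int.negOnePow_even _ (h.mul_right (-1)),
      one_mul, LinearMap.smul_comp, LinearMap.comp_smul, smul_sub]
    rw [smul_comm r]
  · simp [h, TensorCoalg.comm]

theorem hochschildAddD_smul (A : AInfAlgebra.{u, v} 𝒜) (r : R)
    (x : ⨁ k, TensorCoalg.coder A.susp k) :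
    letI := GradedModule.isModule 𝒜 (TensorCoalg.coder A.susp)
    A.hochschildAddD (r • x) = r • A.hochschildAddD x := by
  refine gradedSum_map_smul 𝒜 (TensorCoalg.coder A.susp) A.hochschildAddD ?_ r x
  intro i j r f hr
  have h1 := gradedSum_of_smul 𝒜 (TensorCoalg.coder A.susp) hr f
  have h2 := gradedSum_of_smul 𝒜 (TensorCoalg.coder A.susp) hr (A.hochschildDegD j f)
  exact (congrArg A.hochschildAddD h1).trans ((A.hochschildAddD_of _ _).trans
    ((A.hochschildDegD_smul hr f).trans (h2.symm.trans
      (congrArg _ (A.hochschildAddD_of j f).symm))))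

theorem hochschildAddD_hochschildAddD (A : AInfAlgebra.{u, v} 𝒜)
    (x : ⨁ k, TensorCoalg.coder A.susp k) : A.hochschildAddD (A.hochschildAddD x) = 0 := by
  induction x using DirectSum.induction_on with
  | zero => rw [map_zero, map_zero]
  | add x y h h' => rw [map_add, map_add, h, h', add_zero]
  | of k f =>
    rw [hochschildAddD_of, hochschildAddD_of]
    have h : A.hochschildDegD (k - 1) (A.hochschildDegD k f) = 0 :=
      Subtype.ext (TensorCoalg.comm_comm_self k A.m_m)
    rw [h, map_zero]

/-- The Hochschild complex `C^*(A, A)`: the graded `R`-module of coderivations of `T ΣA`, whose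
part of (homological) degree `k` is `Coder_k`, with the differential `f ↦ [f, m]`. Cohomological
degree is minus homological degree. -/
def hochschild (A : AInfAlgebra.{u, v} 𝒜) : DGModule.{u, max u v} 𝒜 where
  carrier := ⨁ k, TensorCoalg.coder A.susp k
  module := GradedModule.isModule 𝒜 (TensorCoalg.coder A.susp)
  gr k := (DirectSum.of (fun k => TensorCoalg.coder A.susp k) k).range
  isInternal := isInternal_range_of _
  smul_mem := by
    rintro i j r _ hr ⟨f, rfl⟩
    exact ⟨_, (gradedSum_of_smul 𝒜 (TensorCoalg.coder A.susp) hr f).symm⟩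
  d :=
    letI := GradedModule.isModule 𝒜 (TensorCoalg.coder A.susp)
    { A.hochschildAddD with map_smul' := A.hochschildAddD_smul }
  d_mem := by
    rintro n _ ⟨f, rfl⟩
    exact ⟨A.hochschildDegD n f, (A.hochschildAddD_of n f).symm⟩
  d_d := A.hochschildAddD_hochschildAddD

end AInfAlgebra

end

/-! For a weak equivalence `f : A → C`, consider the complex of coderivations along `f`: the maps `g
: TΣA → TΣC` with `Δ g = (g ⊗ f + f ⊗ g) Δ`, with differential `g ↦ g m - (-1)^k m g`. For an
identity morphism this is the Hochschild complex. Composition with `f` on either side gives chain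
maps from `C^*(A, A)` and from `C^*(C, C)` into this complex. Both are quasi-isomorphisms, so each
weak equivalence in a chain contributes a cospan of quasi-isomorphisms.

A coderivation is determined by its corestriction `TΣA → ΣC`, and every corestriction occurs
(`isCoder_coext`, `ιInv_coext`, `IsCoder.eq_of_ιInv`). Filter the coderivations by the maps that
kill all words of length less than `n`. Such a coderivation sends words of length `n` to single
letters (`IsCoder.word_eq_ι`), so to leading order only the linear parts of `m` and `f` are visible.
On leading terms one has linear maps from `(ΣA)^{⊗n}` to `ΣC`, and the comparison maps become
composition with `f₁` and precomposition with `f₁^{⊗n}`.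

The cell hypothesis enters here. A quasi-isomorphism of cell modules is a chain homotopy equivalence
(`DGModule.Hom.IsQuasiIso.exists_inverse`), and this property, unlike being a quasi-isomorphism,
passes to tensor powers and to spaces of linear maps without further hypotheses
(`exists_tensor_homotopy`, `exists_postcomp_lift`, `exists_precomp_lift`). Hence the cones are
acyclic to leading order.

In each degree the filtration is Hausdorff and complete, because a series of maps vanishing on
longer and longer words is finite on each word. Successive approximation (`exists_eq_of_filtration`)
turns leading-order solutions into exact ones (`IsLeadingAcyclic.exists_lift`), so the cones of the
comparison maps are acyclic. -/

noncomputable section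

namespace TensorCoalg

/-! ### Words, the counit and the projection to words of length one -/

section Words

variable {R : Type*} [CommRing R] {V W U : Type*} [AddCommGroup V] [Module R V]
  [AddCommGroup W] [Module R W] [AddCommGroup U] [Module R U]

/-- The word `(a₁, …, aₙ)` as an element of the tensor algebra. -/
def word (R : Type*) [CommRing R] {V : Type*} [AddCommGroup V] [Module R V] (l : List V) :
    TensorAlgebra R V :=
  (l.map (TensorAlgebra.ι R)).prod

@[simp] theorem word_nil : word R ([] : List V) = 1 := rfl

@[simp] theorem word_cons (a : V) (l : List V) :
    word R (a :: l) = TensorAlgebra.ι R a * word R l := by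
  simp [word]

theorem word_append (l l' : List V) : word R (l ++ l') = word R l * word R l' := by
  simp [word]

theorem span_words : Submodule.span R (Set.range (word R : List V → TensorAlgebra R V)) = ⊤ := by
  refine Submodule.eq_top_iff'.2 fun x => ?_
  induction x using TensorAlgebra.induction with
  | algebraMap r =>
    rw [Algebra.algebraMap_eq_smul_one]
    exact Submodule.smul_mem _ _ (Submodule.subset_span ⟨[], rfl⟩)
  | ι a => exact Submodule.subset_span ⟨[a], by simp⟩
  | mul x y hx hy =>
    have h := Submodule.mul_mem_mul hx hy
    rw [Submodule.span_mul_span] at h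
    refine Submodule.span_mono ?_ h
    rintro _ ⟨_, ⟨l, rfl⟩, _, ⟨l', rfl⟩, rfl⟩
    exact ⟨l ++ l', word_append l l'⟩
  | add x y hx hy => exact add_mem hx hy

theorem linearMap_ext_word {P : Type*} [AddCommGroup P] [Module R P]
    {f g : TensorAlgebra R V →ₗ[R] P} (h : ∀ l, f (word R l) = g (word R l)) : f = g :=
  LinearMap.ext_on_range span_words h

theorem deconc_word (l : List V) : deconc R V (word R l)
    = ∑ i ∈ Finset.range (l.length + 1), word R (l.take i) ⊗ₜ[R] word R (l.drop i) :=
  deconc_prod l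

theorem algebraMapInv_ι_mul (a : V) (x : TensorAlgebra R V) :
    TensorAlgebra.algebraMapInv (TensorAlgebra.ι R a * x) = (0 : R) := by
  rw [map_mul]
  simp [TensorAlgebra.algebraMapInv]

theorem algebraMapInv_word_of_ne_nil {l : List V} (h : l ≠ []) :
    TensorAlgebra.algebraMapInv (word R l) = (0 : R) := by
  cases l with
  | nil => exact absurd rfl h
  | cons a l => rw [word_cons, algebraMapInv_ι_mul]

/-- `ιInv` is the second coordinate of an algebra map to the trivial square-zero extension, where
multiplication obeys this Leibniz rule over the first coordinate, the counit. -/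
theorem ιInv_mul (x y : TensorAlgebra R V) :
    TensorAlgebra.ιInv (x * y) = (TensorAlgebra.algebraMapInv x : R) • TensorAlgebra.ιInv y
      + (TensorAlgebra.algebraMapInv y : R) • TensorAlgebra.ιInv x := by
  let _ : Module Rᵐᵒᵖ V := Module.compHom _ ((RingHom.id R).fromOpposite mul_comm)
  have : IsCentralScalar R V := ⟨fun r m => rfl⟩
  have h : ∀ z : TensorAlgebra R V,
      (TensorAlgebra.toTrivSqZeroExt z).fst = TensorAlgebra.algebraMapInv z := by
    intro z
    have : (TrivSqZeroExt.fstHom R R V).comp TensorAlgebra.toTrivSqZeroExt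
        = TensorAlgebra.algebraMapInv := by
      ext; simp [TensorAlgebra.algebraMapInv]
    exact DFunLike.congr_fun this z
  change (TensorAlgebra.toTrivSqZeroExt (x * y)).snd = _ • (TensorAlgebra.toTrivSqZeroExt y).snd
    + _ • (TensorAlgebra.toTrivSqZeroExt x).snd
  rw [map_mul, TrivSqZeroExt.snd_mul, h, h, op_smul_eq_smul]

theorem ιInv_ι (a : V) : TensorAlgebra.ιInv (TensorAlgebra.ι R a) = a :=
  TensorAlgebra.ι_leftInverse a

theorem ιInv_one : TensorAlgebra.ιInv (1 : TensorAlgebra R V) = 0 := by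
  have h := ιInv_mul (1 : TensorAlgebra R V) 1
  simpa using h

theorem ιInv_ι_mul (a : V) (x : TensorAlgebra R V) :
    TensorAlgebra.ιInv (TensorAlgebra.ι R a * x)
      = (TensorAlgebra.algebraMapInv x : R) • a := by
  rw [ιInv_mul, ιInv_ι]
  simp [TensorAlgebra.algebraMapInv]

end Words

/-! ### Convolution of maps out of the tensor coalgebra -/

section Convolution

variable {R : Type*} [CommRing R] {V : Type*} [AddCommGroup V] [Module R V]
  {B : Type*} [Ring B] [Algebra R B] {B' : Type*} [Ring B'] [Algebra R B']

/-- The convolution of two linear maps from the tensor coalgebra to an algebra. -/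
def conv (u v : TensorAlgebra R V →ₗ[R] B) : TensorAlgebra R V →ₗ[R] B :=
  LinearMap.mul' R B ∘ₗ TensorProduct.map u v ∘ₗ deconc R V

theorem conv_word (u v : TensorAlgebra R V →ₗ[R] B) (l : List V) :
    conv u v (word R l) = ∑ i ∈ Finset.range (l.length + 1),
      u (word R (l.take i)) * v (word R (l.drop i)) := by
  simp [conv, deconc_word]

theorem conv_one (u v : TensorAlgebra R V →ₗ[R] B) : conv u v 1 = u 1 * v 1 := by
  simpa using conv_word u v []

theorem conv_add_left (u u' v : TensorAlgebra R V →ₗ[R] B) :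
    conv (u + u') v = conv u v + conv u' v := by
  simp [conv, TensorProduct.map_add_left, LinearMap.add_comp, LinearMap.comp_add]

/-- Either the left part of the cut is empty, or it contains the first letter. This is the recursion
for induction on words. -/
theorem conv_ι_mul (u v : TensorAlgebra R V →ₗ[R] B) (a : V) (x : TensorAlgebra R V) :
    conv u v (TensorAlgebra.ι R a * x) = u 1 * v (TensorAlgebra.ι R a * x)
      + conv (u ∘ₗ LinearMap.mulLeft R (TensorAlgebra.ι R a)) v x := by
  simp only [conv, LinearMap.comp_apply, deconc_ι_mul, map_add]
  congr 1
  simp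

/-- Coassociativity of deconcatenation in usable form. The induction keeps `u` free, because peeling
off a letter precomposes the left factor with multiplication by that letter. -/
theorem conv_assoc (u v w : TensorAlgebra R V →ₗ[R] B) :
    conv (conv u v) w = conv u (conv v w) := by
  refine linearMap_ext_word fun l => ?_
  induction l generalizing u v with
  | nil => simp [conv_one, mul_assoc]
  | cons a l ih =>
    have h : conv u v ∘ₗ LinearMap.mulLeft R (TensorAlgebra.ι R a)
        = LinearMap.mulLeft R (u 1) ∘ₗ v ∘ₗ LinearMap.mulLeft R (TensorAlgebra.ι R a)
          + conv (u ∘ₗ LinearMap.mulLeft R (TensorAlgebra.ι R a)) v :=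
      LinearMap.ext fun x => conv_ι_mul u v a x
    have h' : ∀ v', conv (LinearMap.mulLeft R (u 1) ∘ₗ v') w
        = LinearMap.mulLeft R (u 1) ∘ₗ conv v' w := fun v' =>
      linearMap_ext_word fun l => by simp [conv_word, mul_assoc]
    rw [word_cons, conv_ι_mul, conv_ι_mul, h, conv_add_left, LinearMap.add_apply, ih, conv_one, h',
      conv_ι_mul v w]
    simp [mul_add, mul_assoc, add_assoc]

theorem algHom_comp_conv (θ : B →ₐ[R] B') (u v : TensorAlgebra R V →ₗ[R] B) :
    θ.toLinearMap ∘ₗ conv u v = conv (θ.toLinearMap ∘ₗ u) (θ.toLinearMap ∘ₗ v) :=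
  linearMap_ext_word fun l => by simp [conv_word]

/-- Makes two-sided tensor expressions into convolutions in the algebra `B ⊗ B'`, so that
`conv_assoc` can be applied to the coderivation identity. -/
theorem map_comp_deconc (u : TensorAlgebra R V →ₗ[R] B) (v : TensorAlgebra R V →ₗ[R] B') :
    TensorProduct.map u v ∘ₗ deconc R V
      = conv ((Algebra.TensorProduct.includeLeft : B →ₐ[R] B ⊗[R] B').toLinearMap ∘ₗ u)
          ((Algebra.TensorProduct.includeRight : B' →ₐ[R] B ⊗[R] B').toLinearMap ∘ₗ v) :=
  linearMap_ext_word fun l => by simp [conv_word, deconc_word]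

end Convolution

/-! ### Coalgebra maps and coderivations with prescribed corestriction -/

section Coderivations

variable {R : Type*} [CommRing R] {V W U : Type*} [AddCommGroup V] [Module R V]
  [AddCommGroup W] [Module R W] [AddCommGroup U] [Module R U]

theorem deconc_ι_mul' (a : V) (x : TensorAlgebra R V) :
    deconc R V (TensorAlgebra.ι R a * x) = 1 ⊗ₜ (TensorAlgebra.ι R a * x)
      + (TensorAlgebra.ι R a ⊗ₜ 1) * deconc R V x := by
  rw [deconc_ι_mul]
  congr 1
  generalize deconc R V x = z
  induction z with
  | zero => simp
  | tmul x y => simp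
  | add x y hx hy => rw [map_add, hx, hy, mul_add]

/-- A cut falls either before the distinguished letter `a`, within `x`, or after it, within `y`. -/
theorem deconc_mul_ι_mul (x : TensorAlgebra R V) (a : V) (y : TensorAlgebra R V) :
    deconc R V (x * (TensorAlgebra.ι R a * y))
      = deconc R V x * (1 ⊗ₜ (TensorAlgebra.ι R a * y))
        + ((x * TensorAlgebra.ι R a) ⊗ₜ 1) * deconc R V y := by
  have h : deconc R V ∘ₗ LinearMap.mulRight R (TensorAlgebra.ι R a * y)
      = LinearMap.mulRight R (1 ⊗ₜ (TensorAlgebra.ι R a * y)) ∘ₗ deconc R V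
        + LinearMap.mulRight R (deconc R V y)
          ∘ₗ (TensorProduct.mk R (TensorAlgebra R V) (TensorAlgebra R V)).flip 1
          ∘ₗ LinearMap.mulRight R (TensorAlgebra.ι R a) := by
    refine linearMap_ext_word fun l => ?_
    simp only [LinearMap.comp_apply, LinearMap.add_apply, LinearMap.mulRight_apply,
      LinearMap.flip_apply, TensorProduct.mk_apply]
    induction l with
    | nil => simp [deconc_one, deconc_ι_mul']
    | cons b l ih =>
      rw [word_cons, mul_assoc, deconc_ι_mul', ih, deconc_ι_mul', mul_add, add_mul, add_assoc]
      simp [← mul_assoc]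
  exact LinearMap.congr_fun h x

/-- The words of positive length split off their first letter. -/
theorem eq_algebraMap_add_conv (x : TensorAlgebra R V) :
    x = algebraMap R _ (TensorAlgebra.algebraMapInv x)
      + conv (TensorAlgebra.ι R ∘ₗ TensorAlgebra.ιInv) LinearMap.id x := by
  have h : LinearMap.id = Algebra.linearMap R (TensorAlgebra R V)
        ∘ₗ (TensorAlgebra.algebraMapInv (M := V)).toLinearMap
      + conv (TensorAlgebra.ι R ∘ₗ TensorAlgebra.ιInv) LinearMap.id := by
    refine linearMap_ext_word fun l => ?_
    cases l with
    | nil => simp [conv_one, ιInv_one]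
    | cons a l =>
      rw [LinearMap.add_apply, word_cons, conv_ι_mul, ← word_cons, conv_word,
        Finset.sum_eq_single 0]
      · simp [ιInv_one, ιInv_ι, algebraMapInv_ι_mul]
      · intro i hi hi'
        have : l.take i ≠ [] := by
          intro h
          rw [List.take_eq_nil_iff] at h
          rcases h with h | h
          · exact hi' h
          · subst h
            simp at hi
            exact hi' hi
        simp [ιInv_ι_mul, algebraMapInv_word_of_ne_nil this]
      · simp
  exact LinearMap.congr_fun h x

/-- Coaugmented coalgebra maps between tensor coalgebras. -/
structure IsCoalgHom (p : TensorAlgebra R V →ₗ[R] TensorAlgebra R W) : Prop where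
  map_deconc : deconc R W ∘ₗ p = TensorProduct.map p p ∘ₗ deconc R V
  map_counit : ∀ x, (TensorAlgebra.algebraMapInv (p x) : R) = TensorAlgebra.algebraMapInv x
  map_one : p 1 = 1

theorem IsCoalgHom.id : IsCoalgHom (LinearMap.id : TensorAlgebra R V →ₗ[R] TensorAlgebra R V) :=
  ⟨by simp, fun _ => rfl, rfl⟩

theorem IsCoalgHom.comp {p : TensorAlgebra R W →ₗ[R] TensorAlgebra R U}
    {q : TensorAlgebra R V →ₗ[R] TensorAlgebra R W} (hp : IsCoalgHom p) (hq : IsCoalgHom q) :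
    IsCoalgHom (p ∘ₗ q) where
  map_deconc := by
    rw [← LinearMap.comp_assoc, hp.map_deconc, LinearMap.comp_assoc, hq.map_deconc,
      ← LinearMap.comp_assoc, ← TensorProduct.map_comp]
  map_counit x := by rw [LinearMap.comp_apply, hp.map_counit, hq.map_counit]
  map_one := by rw [LinearMap.comp_apply, hq.map_one, hp.map_one]

theorem isCoalgHom_map (f : V →ₗ[R] W) :
    IsCoalgHom (TensorAlgebra.lift R (TensorAlgebra.ι R ∘ₗ f)).toLinearMap := by
  have hw : ∀ l : List V, TensorAlgebra.lift R (TensorAlgebra.ι R ∘ₗ f) (word R l)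
      = word R (l.map f) := by
    intro l
    induction l with
    | nil => simp
    | cons a l ih => rw [word_cons, map_mul, ih]; simp
  refine ⟨linearMap_ext_word fun l => ?_, fun x => ?_, by simp⟩
  · simp [deconc_word, hw, List.map_take, List.map_drop]
  · have : TensorAlgebra.algebraMapInv.comp (TensorAlgebra.lift R (TensorAlgebra.ι R ∘ₗ f))
        = TensorAlgebra.algebraMapInv := by
      ext; simp [TensorAlgebra.algebraMapInv]
    exact DFunLike.congr_fun this x

/-- The `(p, q)`-coderivations: `Δ g = (g ⊗ q + p ⊗ g) Δ`. -/
def IsCoder (p q g : TensorAlgebra R V →ₗ[R] TensorAlgebra R W) : Prop :=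
  deconc R W ∘ₗ g = (TensorProduct.map g q + TensorProduct.map p g) ∘ₗ deconc R V

/-- The `(p, q)`-coderivation with a given corestriction. -/
def coext (p q : TensorAlgebra R V →ₗ[R] TensorAlgebra R W) (φ : TensorAlgebra R V →ₗ[R] W) :
    TensorAlgebra R V →ₗ[R] TensorAlgebra R W :=
  conv p (conv (TensorAlgebra.ι R ∘ₗ φ) q)

/-- `coext` sums `p w' · φ w'' · q w'''` over the ways to cut a word into three. Cutting the output
before the letter `φ w''` yields the term with `p` on the left, cutting after it the term with `q`
on the right; `conv_assoc` regroups the factors. -/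
theorem isCoder_coext {p q : TensorAlgebra R V →ₗ[R] TensorAlgebra R W} (hp : IsCoalgHom p)
    (hq : IsCoalgHom q) (φ : TensorAlgebra R V →ₗ[R] W) : IsCoder p q (coext p q φ) := by
  have h : deconc R W ∘ₗ coext p q φ
      = conv (deconc R W ∘ₗ p) (Algebra.TensorProduct.includeRight.toLinearMap
            ∘ₗ conv (TensorAlgebra.ι R ∘ₗ φ) q)
        + conv (Algebra.TensorProduct.includeLeft.toLinearMap ∘ₗ p)
          (conv (Algebra.TensorProduct.includeLeft.toLinearMap ∘ₗ TensorAlgebra.ι R ∘ₗ φ)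
            (deconc R W ∘ₗ q)) := by
    refine linearMap_ext_word fun l => ?_
    simp only [coext, conv_word, Finset.mul_sum, ← Finset.sum_add_distrib, LinearMap.comp_apply,
      LinearMap.add_apply, map_sum, deconc_mul_ι_mul]
    simp
    simp only [← mul_assoc, Algebra.TensorProduct.tmul_mul_tmul, mul_one]
  rw [IsCoder, h, hp.map_deconc, hq.map_deconc, LinearMap.add_comp, map_comp_deconc,
    map_comp_deconc, map_comp_deconc, map_comp_deconc, conv_assoc, add_comm]
  simp only [coext, algHom_comp_conv, conv_assoc]

/-- A product containing the letter from `φ` has length one only if the outer factors have nonzero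
counit. Since `p` and `q` preserve the counit, both outer words must be empty. -/
theorem ιInv_coext {p q : TensorAlgebra R V →ₗ[R] TensorAlgebra R W} (hp : IsCoalgHom p)
    (hq : IsCoalgHom q) (φ : TensorAlgebra R V →ₗ[R] W) :
    TensorAlgebra.ιInv ∘ₗ coext p q φ = φ := by
  refine linearMap_ext_word fun l => ?_
  simp only [LinearMap.comp_apply, coext]
  have h : ∀ l' : List V, conv (TensorAlgebra.ι R ∘ₗ φ) q (word R l')
      = ∑ i ∈ Finset.range (l'.length + 1),
        TensorAlgebra.ι R (φ (word R (l'.take i))) * q (word R (l'.drop i)) := by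
    intro l'
    rw [conv_word]
    rfl
  rw [conv_word, map_sum, Finset.sum_eq_single 0]
  · rw [List.take_zero, word_nil, hp.map_one, one_mul, List.drop_zero, h, map_sum,
      Finset.sum_eq_single l.length]
    · simp [hq.map_one, ιInv_ι]
    · intro i hi hi'
      rw [ιInv_ι_mul, hq.map_counit, algebraMapInv_word_of_ne_nil, zero_smul]
      simp at hi ⊢
      omega
    · simp
  · intro i hi hi'
    have : l.take i ≠ [] := by
      intro h
      rw [List.take_eq_nil_iff] at h
      rcases h with h | h
      · exact hi' h
      · subst h
        simp at hi
        exact hi' hi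
    rw [ιInv_mul, hp.map_counit, algebraMapInv_word_of_ne_nil this, h,
      map_sum TensorAlgebra.algebraMapInv, Finset.sum_eq_zero fun j _ => algebraMapInv_ι_mul _ _]
    simp
  · simp

end Coderivations


end TensorCoalg
end

noncomputable section

namespace TensorCoalg

/-! ### The effect of coalgebra maps and coderivations on word length -/

section Length

variable {R : Type*} [CommRing R] {V W U : Type*} [AddCommGroup V] [Module R V]
  [AddCommGroup W] [Module R W] [AddCommGroup U] [Module R U]
  {B : Type*} [Ring B] [Algebra R B]

theorem conv_comp_coalgHom {p : TensorAlgebra R V →ₗ[R] TensorAlgebra R W} (hp : IsCoalgHom p)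
    (u v : TensorAlgebra R W →ₗ[R] B) : conv u v ∘ₗ p = conv (u ∘ₗ p) (v ∘ₗ p) := by
  simp only [conv, LinearMap.comp_assoc, hp.map_deconc]
  rw [TensorProduct.map_comp, LinearMap.comp_assoc]

theorem conv_comp_coder {p q g : TensorAlgebra R V →ₗ[R] TensorAlgebra R W} (hg : IsCoder p q g)
    (u v : TensorAlgebra R W →ₗ[R] B) :
    conv u v ∘ₗ g = conv (u ∘ₗ g) (v ∘ₗ q) + conv (u ∘ₗ p) (v ∘ₗ g) := by
  unfold IsCoder at hg
  simp only [conv, LinearMap.comp_assoc, hg]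
  rw [TensorProduct.map_comp, TensorProduct.map_comp]
  simp only [LinearMap.comp_assoc, LinearMap.add_comp, LinearMap.comp_add]

theorem conv_counit (u : TensorAlgebra R V →ₗ[R] R) :
    conv u (TensorAlgebra.algebraMapInv (M := V)).toLinearMap = u := by
  refine linearMap_ext_word fun l => ?_
  rw [conv_word, Finset.sum_eq_single l.length]
  · simp
  · intro i hi hi'
    rw [AlgHom.toLinearMap_apply, algebraMapInv_word_of_ne_nil, mul_zero]
    simp at hi ⊢
    omega
  · simp

theorem take_ne_nil {l : List V} {i : ℕ} (hi : i ∈ Finset.range (l.length + 1)) (hi' : i ≠ 0) :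
    l.take i ≠ [] := by
  intro h
  rw [List.take_eq_nil_iff] at h
  rcases h with h | h
  · exact hi' h
  · subst h
    simp at hi
    exact hi' hi

theorem counit_conv (u : TensorAlgebra R V →ₗ[R] R) :
    conv (TensorAlgebra.algebraMapInv (M := V)).toLinearMap u = u := by
  refine linearMap_ext_word fun l => ?_
  rw [conv_word, Finset.sum_eq_single 0]
  · simp
  · intro i hi hi'
    rw [AlgHom.toLinearMap_apply, algebraMapInv_word_of_ne_nil (take_ne_nil hi hi'), zero_mul]
  · simp

/-- The counit `ε` is the unit for convolution, so composing `ε = ε * ε` with `g` gives `ε g = ε g +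
ε g`. -/
theorem IsCoder.counit {p q g : TensorAlgebra R V →ₗ[R] TensorAlgebra R W} (hp : IsCoalgHom p)
    (hq : IsCoalgHom q) (hg : IsCoder p q g) (x : TensorAlgebra R V) :
    (TensorAlgebra.algebraMapInv (g x) : R) = 0 := by
  have h := conv_comp_coder hg (TensorAlgebra.algebraMapInv (M := W)).toLinearMap
    (TensorAlgebra.algebraMapInv (M := W)).toLinearMap
  have e1 : (TensorAlgebra.algebraMapInv (M := W)).toLinearMap ∘ₗ p
    = (TensorAlgebra.algebraMapInv (M := V)).toLinearMap := LinearMap.ext hp.map_counit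
  have e2 : (TensorAlgebra.algebraMapInv (M := W)).toLinearMap ∘ₗ q
    = (TensorAlgebra.algebraMapInv (M := V)).toLinearMap := LinearMap.ext hq.map_counit
  rw [e1, e2, conv_counit, conv_counit, counit_conv] at h
  have := LinearMap.congr_fun h x
  simpa using this

/-- The first letter of the output comes either from `g`, followed by `q` on the rest, or from `p`,
followed by `g`. All the length estimates below are inductions over this recursion. -/
theorem IsCoder.eq_conv {p q g : TensorAlgebra R V →ₗ[R] TensorAlgebra R W} (hp : IsCoalgHom p)
    (hq : IsCoalgHom q) (hg : IsCoder p q g) :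
    g = conv (TensorAlgebra.ι R ∘ₗ TensorAlgebra.ιInv ∘ₗ g) q
      + conv (TensorAlgebra.ι R ∘ₗ TensorAlgebra.ιInv ∘ₗ p) g := by
  have h := conv_comp_coder hg (TensorAlgebra.ι R ∘ₗ TensorAlgebra.ιInv) LinearMap.id
  simp only [LinearMap.comp_assoc, LinearMap.id_comp] at h
  rw [← h]
  ext1 x
  conv_lhs => rw [eq_algebraMap_add_conv (g x), hg.counit hp hq]
  simp

theorem IsCoalgHom.eq_conv {p : TensorAlgebra R V →ₗ[R] TensorAlgebra R W} (hp : IsCoalgHom p)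
    (x : TensorAlgebra R V) :
    p x = algebraMap R _ (TensorAlgebra.algebraMapInv x)
      + conv (TensorAlgebra.ι R ∘ₗ TensorAlgebra.ιInv ∘ₗ p) p x := by
  have h := conv_comp_coalgHom hp (TensorAlgebra.ι R ∘ₗ TensorAlgebra.ιInv) LinearMap.id
  simp only [LinearMap.comp_assoc, LinearMap.id_comp] at h
  rw [← h]
  conv_lhs => rw [eq_algebraMap_add_conv (p x), hp.map_counit]
  simp

theorem IsCoder.word_eq {p q g : TensorAlgebra R V →ₗ[R] TensorAlgebra R W} (hp : IsCoalgHom p)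
    (hq : IsCoalgHom q) (hg : IsCoder p q g) (l : List V) :
    g (word R l) = ∑ i ∈ Finset.range (l.length + 1),
        TensorAlgebra.ι R (TensorAlgebra.ιInv (g (word R (l.take i)))) * q (word R (l.drop i))
      + ∑ i ∈ Finset.range l.length,
        TensorAlgebra.ι R (TensorAlgebra.ιInv (p (word R (l.take (i + 1)))))
          * g (word R (l.drop (i + 1))) := by
  conv_lhs => rw [hg.eq_conv hp hq]
  rw [LinearMap.add_apply, conv_word, conv_word, Finset.sum_range_succ' _ l.length]
  simp [Finset.sum_range_succ' _ l.length, hp.map_one, ιInv_one]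

theorem IsCoalgHom.word_eq {p : TensorAlgebra R V →ₗ[R] TensorAlgebra R W} (hp : IsCoalgHom p)
    (l : List V) :
    p (word R l) = algebraMap R _ (TensorAlgebra.algebraMapInv (word R l))
      + ∑ i ∈ Finset.range l.length,
        TensorAlgebra.ι R (TensorAlgebra.ιInv (p (word R (l.take (i + 1)))))
          * p (word R (l.drop (i + 1))) := by
  conv_lhs => rw [hp.eq_conv]
  rw [conv_word]
  simp [Finset.sum_range_succ' _ l.length, hp.map_one, ιInv_one]

/-- Each term of the recursion contains either the corestriction of `g` or `g` itself on a shorter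
word. -/
theorem IsCoder.word_eq_zero {p q g : TensorAlgebra R V →ₗ[R] TensorAlgebra R W}
    (hp : IsCoalgHom p) (hq : IsCoalgHom q) (hg : IsCoder p q g) {n : ℕ}
    (h : ∀ l : List V, l.length < n → TensorAlgebra.ιInv (g (word R l)) = 0) (l : List V)
    (hl : l.length < n) : g (word R l) = 0 := by
  induction hk : l.length using Nat.strong_induction_on generalizing l with
  | _ k ih =>
    subst hk
    rw [hg.word_eq hp hq, Finset.sum_eq_zero, Finset.sum_eq_zero, add_zero]
    · intro i hi
      rw [Finset.mem_range] at hi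
      rw [ih (l.drop (i + 1)).length (by rw [List.length_drop]; omega) _
        (by rw [List.length_drop]; omega) rfl, mul_zero]
    · intro i hi
      rw [h _ (by rw [List.length_take]; omega), map_zero, zero_mul]

theorem IsCoder.sub {p q g g' : TensorAlgebra R V →ₗ[R] TensorAlgebra R W} (hg : IsCoder p q g)
    (hg' : IsCoder p q g') : IsCoder p q (g - g') := by
  unfold IsCoder at *
  rw [LinearMap.comp_sub, hg, hg', ← LinearMap.sub_comp]
  congr 1
  refine TensorProduct.ext' fun x y => ?_
  simp [TensorProduct.tmul_sub, TensorProduct.sub_tmul]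
  abel

theorem IsCoder.eq_of_ιInv {p q g g' : TensorAlgebra R V →ₗ[R] TensorAlgebra R W}
    (hp : IsCoalgHom p) (hq : IsCoalgHom q) (hg : IsCoder p q g) (hg' : IsCoder p q g')
    (h : TensorAlgebra.ιInv ∘ₗ g = TensorAlgebra.ιInv ∘ₗ g') : g = g' := by
  refine linearMap_ext_word fun l => sub_eq_zero.1 ?_
  refine (hg.sub hg').word_eq_zero hp hq (n := l.length + 1) (fun l' _ => ?_) l (Nat.lt_succ_self _)
  have := LinearMap.congr_fun h (word R l')
  rw [LinearMap.comp_apply, LinearMap.comp_apply] at this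
  rw [LinearMap.sub_apply, map_sub, this, sub_self]

/-- On the shortest words that `g` need not kill, the recursion keeps only the term in which the
first letter consumes the entire word. Hence the leading term of a coderivation is its
corestriction. -/
theorem IsCoder.word_eq_ι {p q g : TensorAlgebra R V →ₗ[R] TensorAlgebra R W}
    (hp : IsCoalgHom p) (hq : IsCoalgHom q) (hg : IsCoder p q g) {n : ℕ}
    (h : ∀ l : List V, l.length < n → g (word R l) = 0) (l : List V)
    (hl : l.length ≤ n) :
    g (word R l) = TensorAlgebra.ι R (TensorAlgebra.ιInv (g (word R l))) := by
  conv_lhs => rw [hg.word_eq hp hq]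
  rw [Finset.sum_eq_single l.length, Finset.sum_eq_zero, add_zero]
  · simp [hq.map_one]
  · intro i hi
    rw [Finset.mem_range] at hi
    rw [h _ (by rw [List.length_drop]; omega), mul_zero]
  · intro i hi hi'
    rw [Finset.mem_range] at hi
    rw [h _ (by rw [List.length_take]; omega), map_zero, map_zero, zero_mul]
  · simp

/-- The span of the words of length at most `n`. -/
def lenLE (R : Type*) [CommRing R] (V : Type*) [AddCommGroup V] [Module R V] (n : ℕ) :
    Submodule R (TensorAlgebra R V) :=
  Submodule.span R {x | ∃ l : List V, l.length ≤ n ∧ word R l = x}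

theorem word_mem_lenLE {n : ℕ} {l : List V} (h : l.length ≤ n) : word R l ∈ lenLE R V n :=
  Submodule.subset_span ⟨l, h, rfl⟩

theorem lenLE_mono {n k : ℕ} (h : n ≤ k) : lenLE R V n ≤ lenLE R V k :=
  Submodule.span_mono fun _ ⟨l, hl, hx⟩ => ⟨l, hl.trans h, hx⟩

theorem map_mem_of_mem_lenLE {P : Type*} [AddCommGroup P] [Module R P]
    {u : TensorAlgebra R V →ₗ[R] P} {S : Submodule R P} {n : ℕ}
    (h : ∀ l : List V, l.length ≤ n → u (word R l) ∈ S) {x : TensorAlgebra R V}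
    (hx : x ∈ lenLE R V n) : u x ∈ S := by
  have : lenLE R V n ≤ S.comap u :=
    Submodule.span_le.2 fun _ ⟨l, hl, hx⟩ => hx ▸ h l hl
  exact this hx

theorem mul_mem_lenLE {n k : ℕ} {x y : TensorAlgebra R V} (hx : x ∈ lenLE R V n)
    (hy : y ∈ lenLE R V k) : x * y ∈ lenLE R V (n + k) := by
  have h := Submodule.mul_mem_mul hx hy
  rw [lenLE, lenLE, Submodule.span_mul_span] at h
  refine Submodule.span_mono ?_ h
  rintro _ ⟨_, ⟨l, hl, rfl⟩, _, ⟨l', hl', rfl⟩, rfl⟩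
  exact ⟨l ++ l', by rw [List.length_append]; omega, word_append l l'⟩

theorem ι_mul_mem_lenLE {n k : ℕ} (a : V) {y : TensorAlgebra R V}
    (hy : y ∈ lenLE R V k) (h : k + 1 ≤ n) : TensorAlgebra.ι R a * y ∈ lenLE R V n := by
  have : TensorAlgebra.ι R a ∈ lenLE R V 1 := by
    simpa using word_mem_lenLE (R := R) (l := [a]) le_rfl
  exact lenLE_mono (by omega) (mul_mem_lenLE this hy)

theorem algebraMap_mem_lenLE (n : ℕ) (r : R) : algebraMap R _ r ∈ lenLE R V n := by
  rw [Algebra.algebraMap_eq_smul_one]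
  exact Submodule.smul_mem _ _ (word_mem_lenLE (l := []) (Nat.zero_le _))

/-- Each output letter consumes at least one input letter, because `p 1 = 1` has no letters. -/
theorem IsCoalgHom.word_mem {p : TensorAlgebra R V →ₗ[R] TensorAlgebra R W}
    (hp : IsCoalgHom p) (l : List V) : p (word R l) ∈ lenLE R W l.length := by
  induction hk : l.length using Nat.strong_induction_on generalizing l with
  | _ k ih =>
    subst hk
    rw [hp.word_eq]
    refine add_mem (algebraMap_mem_lenLE _ _) (sum_mem fun i hi => ?_)
    rw [Finset.mem_range] at hi
    have hd := List.length_drop (i := i + 1) (l := l)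
    exact ι_mul_mem_lenLE _ (ih _ (by omega) (l.drop (i + 1)) rfl) (by omega)

theorem IsCoalgHom.map_mem {p : TensorAlgebra R V →ₗ[R] TensorAlgebra R W}
    (hp : IsCoalgHom p) {n : ℕ} {x : TensorAlgebra R V} (hx : x ∈ lenLE R V n) :
    p x ∈ lenLE R W n :=
  map_mem_of_mem_lenLE (fun l hl => lenLE_mono hl (hp.word_mem l)) hx

/-- The one letter produced by the corestriction of `g` consumes at least `j` input letters, and `p`
and `q` do not lengthen words, so the length drops by at least `j - 1`. The bound avoids subtraction
in order to include `j = 0`. -/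
theorem IsCoder.word_mem {p q g : TensorAlgebra R V →ₗ[R] TensorAlgebra R W}
    (hp : IsCoalgHom p) (hq : IsCoalgHom q) (hg : IsCoder p q g) {j : ℕ}
    (h : ∀ l : List V, l.length < j → TensorAlgebra.ιInv (g (word R l)) = 0) {r : ℕ} (l : List V)
    (hl : l.length + 1 ≤ r + j) : g (word R l) ∈ lenLE R W r := by
  induction hk : l.length using Nat.strong_induction_on generalizing l r with
  | _ k ih =>
    subst hk
    rw [hg.word_eq hp hq]
    refine add_mem (sum_mem fun i hi => ?_) (sum_mem fun i hi => ?_)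
    · rw [Finset.mem_range] at hi
      have hd := List.length_drop (i := i) (l := l)
      rcases Nat.lt_or_ge i j with hij | hij
      · rw [h _ (by rw [List.length_take]; omega), map_zero, zero_mul]
        exact zero_mem _
      · exact ι_mul_mem_lenLE _ (hq.word_mem (l.drop i)) (by omega)
    · rw [Finset.mem_range] at hi
      have hd := List.length_drop (i := i + 1) (l := l)
      -- For `r = 0` there is no room for a letter in front, but then the word is shorter than `j`
      -- and `g` kills it.
      rcases Nat.eq_zero_or_pos r with hr | hr
      · rw [hg.word_eq_zero hp hq h _ (by omega), mul_zero]
        exact zero_mem _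
      · exact ι_mul_mem_lenLE (k := r - 1) _ (ih _ (by omega) (l.drop (i + 1)) (by omega) rfl)
          (by omega)

theorem IsCoder.map_mem {p q g : TensorAlgebra R V →ₗ[R] TensorAlgebra R W}
    (hp : IsCoalgHom p) (hq : IsCoalgHom q) (hg : IsCoder p q g) {j : ℕ}
    (h : ∀ l : List V, l.length < j → TensorAlgebra.ιInv (g (word R l)) = 0) {r n : ℕ}
    (hn : n + 1 ≤ r + j) {x : TensorAlgebra R V} (hx : x ∈ lenLE R V n) : g x ∈ lenLE R W r :=
  map_mem_of_mem_lenLE (fun l hl => hg.word_mem hp hq h l (by omega)) hx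

theorem IsCoder.comp {p q g : TensorAlgebra R W →ₗ[R] TensorAlgebra R U}
    {p' q' h : TensorAlgebra R V →ₗ[R] TensorAlgebra R W} (hg : IsCoder p q g)
    (hh : IsCoder p' q' h) :
    deconc R U ∘ₗ g ∘ₗ h = (TensorProduct.map (g ∘ₗ h) (q ∘ₗ q')
      + TensorProduct.map (g ∘ₗ p') (q ∘ₗ h) + TensorProduct.map (p ∘ₗ h) (g ∘ₗ q')
      + TensorProduct.map (p ∘ₗ p') (g ∘ₗ h)) ∘ₗ deconc R V := by
  unfold IsCoder at *
  rw [← LinearMap.comp_assoc, hg, LinearMap.comp_assoc, hh]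
  simp only [LinearMap.add_comp, LinearMap.comp_add, TensorProduct.map_comp, LinearMap.comp_assoc]
  abel

theorem IsCoder.coalgHom_comp {f : TensorAlgebra R W →ₗ[R] TensorAlgebra R U}
    {p q g : TensorAlgebra R V →ₗ[R] TensorAlgebra R W} (hf : IsCoalgHom f)
    (hg : IsCoder p q g) : IsCoder (f ∘ₗ p) (f ∘ₗ q) (f ∘ₗ g) := by
  unfold IsCoder at *
  rw [← LinearMap.comp_assoc, hf.map_deconc, LinearMap.comp_assoc, hg]
  simp only [LinearMap.add_comp, LinearMap.comp_add, TensorProduct.map_comp, LinearMap.comp_assoc]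

theorem IsCoder.comp_coalgHom {p q g : TensorAlgebra R W →ₗ[R] TensorAlgebra R U}
    {f : TensorAlgebra R V →ₗ[R] TensorAlgebra R W} (hf : IsCoalgHom f)
    (hg : IsCoder p q g) : IsCoder (p ∘ₗ f) (q ∘ₗ f) (g ∘ₗ f) := by
  unfold IsCoder at *
  rw [← LinearMap.comp_assoc, hg, LinearMap.comp_assoc, hf.map_deconc]
  simp only [LinearMap.add_comp, TensorProduct.map_comp, LinearMap.comp_assoc]

/-- Telescoping: `p ⊗ p - q ⊗ q = (p - q) ⊗ q + p ⊗ (p - q)`. This lets coalgebra maps be compared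
through their corestrictions, with the tools for coderivations. -/
theorem IsCoalgHom.isCoder_sub {p q : TensorAlgebra R V →ₗ[R] TensorAlgebra R W}
    (hp : IsCoalgHom p) (hq : IsCoalgHom q) : IsCoder p q (p - q) := by
  unfold IsCoder
  rw [LinearMap.comp_sub, hp.map_deconc, hq.map_deconc, ← LinearMap.sub_comp]
  congr 1
  refine TensorProduct.ext' fun x y => ?_
  simp [TensorProduct.tmul_sub, TensorProduct.sub_tmul]

end Length

end TensorCoalg
end

/-! ### Homogeneous maps and Koszul signs -/

noncomputable section

/-- An additive map raises the degree by `k`. -/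
def MapsGr {X Y : Type*} [AddCommGroup X] [AddCommGroup Y] (G : ℤ → AddSubgroup X)
    (G' : ℤ → AddSubgroup Y) (k : ℤ) (u : X → Y) : Prop :=
  ∀ n, ∀ x ∈ G n, u x ∈ G' (n + k)

namespace MapsGr

variable {X Y Z : Type*} [AddCommGroup X] [AddCommGroup Y] [AddCommGroup Z]
  {G : ℤ → AddSubgroup X} {G' : ℤ → AddSubgroup Y} {G'' : ℤ → AddSubgroup Z}

theorem mem {k : ℤ} {u : X → Y} (hu : MapsGr G G' k u) {n j : ℤ} {x : X} (hx : x ∈ G n)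
    (h : j = n + k) : u x ∈ G' j :=
  h ▸ hu n x hx

variable {R : Type*} [CommRing R] [Module R X] [Module R Y] [Module R Z]

theorem id : MapsGr G G 0 (LinearMap.id : X →ₗ[R] X) := fun n x hx => by
  rw [add_zero]; exact hx

theorem comp {k l j : ℤ} {u : Y →ₗ[R] Z} {v : X →ₗ[R] Y} (hu : MapsGr G' G'' k u)
    (hv : MapsGr G G' l v) (h : j = k + l) : MapsGr G G'' j (u ∘ₗ v) := fun _ _ hx =>
  hu.mem (hv _ _ hx) (by rw [h]; ring)

theorem add {k : ℤ} {u v : X →ₗ[R] Y} (hu : MapsGr G G' k u) (hv : MapsGr G G' k v) :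
    MapsGr G G' k (u + v : X →ₗ[R] Y) := fun n x hx => add_mem (hu n x hx) (hv n x hx)

theorem sub {k : ℤ} {u v : X →ₗ[R] Y} (hu : MapsGr G G' k u) (hv : MapsGr G G' k v) :
    MapsGr G G' k (u - v : X →ₗ[R] Y) := fun n x hx => sub_mem (hu n x hx) (hv n x hx)

theorem neg {k : ℤ} {u : X →ₗ[R] Y} (hu : MapsGr G G' k u) :
    MapsGr G G' k (-u : X →ₗ[R] Y) := fun n x hx => neg_mem (hu n x hx)

theorem zsmul {k : ℤ} {u : X →ₗ[R] Y} (hu : MapsGr G G' k u) (c : ℤ) :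
    MapsGr G G' k (c • u : X →ₗ[R] Y) := fun n x hx => zsmul_mem (hu n x hx) c

end MapsGr

namespace TensorCoalg

section Graded

variable {R : Type u} [CommRing R] {𝒜 : ℤ → AddSubgroup R} {M N P : DGModule.{u, v} 𝒜}

/-- A list of homogeneous elements of total degree `n`. -/
inductive IsHomogeneousList (M : DGModule.{u, v} 𝒜) : ℤ → List M.carrier → Prop
  | nil : IsHomogeneousList M 0 []
  | cons {n p : ℤ} {a : M.carrier} {l : List M.carrier} (ha : a ∈ M.gr n)
      (hl : IsHomogeneousList M p l) : IsHomogeneousList M (n + p) (a :: l)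

theorem IsHomogeneousList.take_drop {n : ℤ} {l : List M.carrier} (h : IsHomogeneousList M n l)
    (i : ℕ) : ∃ a b : ℤ, n = a + b ∧ IsHomogeneousList M a (l.take i)
      ∧ IsHomogeneousList M b (l.drop i) := by
  induction h generalizing i with
  | nil => exact ⟨0, 0, rfl, by simpa using .nil, by simpa using .nil⟩
  | @cons n p a l ha hl ih =>
    cases i with
    | zero => exact ⟨0, n + p, (zero_add _).symm, .nil, .cons ha hl⟩
    | succ i =>
      obtain ⟨b, c, rfl, hb, hc⟩ := ih i
      exact ⟨n + b, c, by ring, .cons ha hb, hc⟩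

variable [GradedRing 𝒜]

theorem mul_mem_gr {a b : ℤ} {x y : TensorAlgebra R M.carrier} (hx : x ∈ gr M a)
    (hy : y ∈ gr M b) : x * y ∈ gr M (a + b) := by
  induction hx using AddSubgroup.closure_induction with
  | zero => rw [zero_mul]; exact zero_mem _
  | add x x' _ _ hx hx' => rw [add_mul]; exact add_mem hx hx'
  | neg x _ hx => rw [neg_mul]; exact neg_mem hx
  | mem x hx =>
    induction hy using AddSubgroup.closure_induction with
    | zero => rw [mul_zero]; exact zero_mem _
    | add y y' _ _ hy hy' => rw [mul_add]; exact add_mem hy hy'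
    | neg y _ hy => rw [mul_neg]; exact neg_mem hy
    | mem y hy => exact AddSubgroup.subset_closure (IsWord.mul hx hy)

theorem one_mem_gr (M : DGModule.{u, v} 𝒜) : 1 ∈ gr M 0 := by
  rw [← map_one (algebraMap R _)]
  exact AddSubgroup.subset_closure (.scalar SetLike.GradedOne.one_mem)

theorem mapsGr_ι (M : DGModule.{u, v} 𝒜) :
    MapsGr M.gr (gr M) 0 (TensorAlgebra.ι R) := by
  intro n a ha
  rw [← mul_one (TensorAlgebra.ι R a), ← map_one (algebraMap R _)]
  exact AddSubgroup.subset_closure (.cons ha (.scalar SetLike.GradedOne.one_mem))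

theorem IsHomogeneousList.word_mem {n : ℤ} {l : List M.carrier} (h : IsHomogeneousList M n l) :
    word R l ∈ gr M n := by
  induction h with
  | nil => exact one_mem_gr M
  | cons ha hl ih =>
    rw [word_cons]
    exact mul_mem_gr ((mapsGr_ι M).mem ha (add_zero _).symm) ih

theorem IsWord.exists_smul_word {n : ℤ} {w : TensorAlgebra R M.carrier} (h : IsWord M n w) :
    ∃ (i j : ℤ) (r : R) (l : List M.carrier), n = i + j ∧ r ∈ 𝒜 i ∧ IsHomogeneousList M j l
      ∧ w = r • word R l := by
  induction h with
  | @scalar n r hr =>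
    exact ⟨n, 0, r, [], (add_zero n).symm, hr, .nil, Algebra.algebraMap_eq_smul_one r⟩
  | @cons n p a w ha hw ih =>
    obtain ⟨i, j, r, l, rfl, hr, hl, rfl⟩ := ih
    exact ⟨i, n + j, r, a :: l, by ring, hr, .cons ha hl, by simp⟩

theorem mapsGr_of_words {Y : Type*} [AddCommGroup Y] [Module R Y] {G : ℤ → AddSubgroup Y}
    (hG : ∀ {i j : ℤ} {r : R} {y : Y}, r ∈ 𝒜 i → y ∈ G j → r • y ∈ G (i + j)) {k : ℤ}
    {u : TensorAlgebra R M.carrier →ₗ[R] Y}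
    (h : ∀ n l, IsHomogeneousList M n l → u (word R l) ∈ G (n + k)) : MapsGr (gr M) G k u := by
  intro n x hx
  induction hx using AddSubgroup.closure_induction with
  | zero => rw [map_zero]; exact zero_mem _
  | add x y _ _ hx hy => rw [map_add]; exact add_mem hx hy
  | neg x _ hx => rw [map_neg]; exact neg_mem hx
  | mem x hx =>
    obtain ⟨i, j, r, l, rfl, hr, hl, rfl⟩ := IsWord.exists_smul_word hx
    rw [map_smul, add_assoc]
    exact hG hr (h j l hl)

theorem mapsGr_conv {a b c : ℤ} {u v : TensorAlgebra R M.carrier →ₗ[R] TensorAlgebra R N.carrier}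
    (hu : MapsGr (gr M) (gr N) a u) (hv : MapsGr (gr M) (gr N) b v) (h : c = a + b) :
    MapsGr (gr M) (gr N) c (conv u v) := by
  refine mapsGr_of_words (M := M) (fun hr hx => smul_mem_gr N hr hx) fun n l hl => ?_
  rw [conv_word]
  refine sum_mem fun i _ => ?_
  obtain ⟨a', b', rfl, ha, hb⟩ := hl.take_drop i
  have := mul_mem_gr (hu _ _ ha.word_mem) (hv _ _ hb.word_mem)
  rwa [show a' + b' + c = a' + a + (b' + b) by rw [h]; ring]

theorem mapsGr_coext {k : ℤ} {p q : TensorAlgebra R M.carrier →ₗ[R] TensorAlgebra R N.carrier}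
    {φ : TensorAlgebra R M.carrier →ₗ[R] N.carrier} (hp : MapsGr (gr M) (gr N) 0 p)
    (hq : MapsGr (gr M) (gr N) 0 q) (hφ : MapsGr (gr M) N.gr k φ) :
    MapsGr (gr M) (gr N) k (coext p q φ) :=
  mapsGr_conv hp (mapsGr_conv ((mapsGr_ι N).comp hφ (zero_add k).symm) hq (add_zero k).symm)
    (zero_add k).symm

theorem mapsGr_ιInv (M : DGModule.{u, v} 𝒜) :
    MapsGr (gr M) M.gr 0 (TensorAlgebra.ιInv (R := R)) := by
  refine mapsGr_of_words (M := M) M.smul_mem fun n l hl => ?_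
  rw [add_zero]
  cases hl with
  | nil => rw [word_nil, ιInv_one]; exact zero_mem _
  | @cons n p a l ha hl =>
    rw [word_cons, ιInv_ι_mul]
    cases hl with
    | nil => simpa using ha
    | cons ha hl =>
      rw [algebraMapInv_word_of_ne_nil (by simp), zero_smul]
      exact zero_mem _

theorem mapsGr_lift {f : M.carrier →ₗ[R] N.carrier} (hf : MapsGr M.gr N.gr 0 f) :
    MapsGr (gr M) (gr N) 0
      (TensorAlgebra.lift R (TensorAlgebra.ι R ∘ₗ f)).toLinearMap := by
  refine mapsGr_of_words (M := M) (fun hr hx => smul_mem_gr N hr hx) fun n l hl => ?_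
  rw [add_zero, AlgHom.toLinearMap_apply]
  induction hl with
  | nil => rw [word_nil, map_one]; exact one_mem_gr N
  | cons ha hl ih =>
    rw [word_cons, map_mul]
    refine mul_mem_gr ?_ ih
    rw [TensorAlgebra.lift_ι_apply]
    exact ((mapsGr_ι N).comp hf (add_zero 0).symm).mem ha (add_zero _).symm

variable [IsEvenlyGraded 𝒜]

theorem isCoalgHom_sgn (M : DGModule.{u, v} 𝒜) (k : ℤ) : IsCoalgHom (sgn M k) :=
  isCoalgHom_map _

theorem mapsGr_sgn (M : DGModule.{u, v} 𝒜) (k : ℤ) : MapsGr (gr M) (gr M) 0 (sgn M k) := by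
  intro n x hx
  rw [sgn_of_mem k hx, add_zero]
  exact zsmul_mem hx _

theorem sgn_comp_of_mapsGr {l : ℤ}
    {f : TensorAlgebra R M.carrier →ₗ[R] TensorAlgebra R N.carrier}
    (hf : MapsGr (gr M) (gr N) l f) (k : ℤ) :
    sgn N k ∘ₗ f = ((k * l).negOnePow : ℤ) • (f ∘ₗ sgn M k) := by
  refine ext_words M fun n w hw => ?_
  have hw' : w ∈ gr M n := AddSubgroup.subset_closure hw
  rw [LinearMap.comp_apply, sgn_of_mem k (hf n w hw'), LinearMap.smul_apply,
    LinearMap.comp_apply, sgn_word k hw, map_zsmul, smul_smul, mul_add, Int.negOnePow_add,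
    Units.val_mul, mul_comm]

theorem sgn_comp_of_mapsGr_zero
    {f : TensorAlgebra R M.carrier →ₗ[R] TensorAlgebra R N.carrier}
    (hf : MapsGr (gr M) (gr N) 0 f) (k : ℤ) : sgn N k ∘ₗ f = f ∘ₗ sgn M k := by
  simpa using sgn_comp_of_mapsGr hf k

theorem sgn_zero (M : DGModule.{u, v} 𝒜) : sgn M 0 = LinearMap.id :=
  ext_words M fun n w hw => by simp [sgn_word 0 hw]

/-- The graded commutator `g m - (-1)^k m' g` of a coderivation of degree `k` with two
coderivations of degree `-1` is a coderivation. -/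
theorem IsCoder.graded_comm {k : ℤ}
    {p q g : TensorAlgebra R M.carrier →ₗ[R] TensorAlgebra R N.carrier}
    {m : TensorAlgebra R M.carrier →ₗ[R] TensorAlgebra R M.carrier}
    {m' : TensorAlgebra R N.carrier →ₗ[R] TensorAlgebra R N.carrier}
    (hp : MapsGr (gr M) (gr N) 0 p) (hg : MapsGr (gr M) (gr N) k g)
    (hm : MapsGr (gr M) (gr M) (-1) m)
    (cg : IsCoder (p ∘ₗ sgn M k) q g) (cm : IsCoder (sgn M (-1)) LinearMap.id m)
    (cm' : IsCoder (sgn N (-1)) LinearMap.id m') (hpm : p ∘ₗ m = m' ∘ₗ p)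
    (hqm : q ∘ₗ m = m' ∘ₗ q) :
    IsCoder (p ∘ₗ sgn M (k - 1)) q (g ∘ₗ m - (k.negOnePow : ℤ) • (m' ∘ₗ g)) := by
  have h1 := cg.comp cm
  have h2 := cm'.comp cg
  have e1 : p ∘ₗ sgn M k ∘ₗ m = (k.negOnePow : ℤ) • (m' ∘ₗ p ∘ₗ sgn M k) := by
    rw [sgn_comp_of_mapsGr hm, LinearMap.comp_smul, ← LinearMap.comp_assoc _ m p, hpm,
      LinearMap.comp_assoc]
    simp
  have e2 : sgn N (-1) ∘ₗ g = (k.negOnePow : ℤ) • (g ∘ₗ sgn M (-1)) := by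
    rw [sgn_comp_of_mapsGr hg]
    simp
  have e3 : p ∘ₗ sgn M k ∘ₗ sgn M (-1) = p ∘ₗ sgn M (k - 1) := by
    rw [sgn_comp_sgn, sub_eq_add_neg]
  have e4 : sgn N (-1) ∘ₗ p ∘ₗ sgn M k = p ∘ₗ sgn M (k - 1) := by
    rw [← LinearMap.comp_assoc, sgn_comp_of_mapsGr_zero hp, LinearMap.comp_assoc, sgn_comp_sgn,
      neg_add_eq_sub]
  have hs : (k.negOnePow : ℤ) * (k.negOnePow : ℤ) = 1 := by
    rw [← Units.val_mul, Int.units_mul_self, Units.val_one]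
  unfold IsCoder
  rw [LinearMap.comp_assoc, LinearMap.comp_assoc, e3, e1] at h1
  rw [e2, e4] at h2
  -- Of the eight terms, those with `p m` or `q m` cancel against those with `m' p` or `m' q`; by
  -- `e1` and `e2` their signs match, using `s * s = 1`.
  rw [LinearMap.comp_sub, LinearMap.comp_smul, h1, h2]
  generalize (k.negOnePow : ℤ) = s at hs ⊢
  rw [← LinearMap.smul_comp s _ (deconc R M.carrier), ← LinearMap.sub_comp]
  congr 1
  refine TensorProduct.ext' fun x y => ?_
  have hqm' := LinearMap.congr_fun hqm y
  simp only [LinearMap.comp_apply] at hqm'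
  simp only [LinearMap.sub_apply, LinearMap.comp_apply, LinearMap.add_apply,
    LinearMap.smul_apply, TensorProduct.map_tmul, LinearMap.id_apply, hqm',
    smul_add, TensorProduct.tmul_sub, TensorProduct.sub_tmul, TensorProduct.tmul_smul,
    ← TensorProduct.smul_tmul', smul_smul, hs, one_smul]
  abel

end Graded

end TensorCoalg
end

/-! ### Quasi-isomorphisms of cell modules are homotopy equivalences -/

noncomputable section

namespace DGModule

variable {R : Type u} [CommRing R] {𝒜 : ℤ → AddSubgroup R} {M N : DGModule.{u, v} 𝒜}

/-- The projection to the part of degree `n`. -/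
def proj (M : DGModule.{u, v} 𝒜) (n : ℤ) : M.carrier →+ M.carrier :=
  letI := M.isInternal.chooseDecomposition
  (M.gr n).subtype.comp
    ((DFinsupp.evalAddMonoidHom n).comp (DirectSum.decomposeAddEquiv M.gr).toAddMonoidHom)

theorem proj_mem (M : DGModule.{u, v} 𝒜) (n : ℤ) (x : M.carrier) : M.proj n x ∈ M.gr n :=
  SetLike.coe_mem _

theorem proj_of_mem {n : ℤ} {x : M.carrier} (hx : x ∈ M.gr n) : M.proj n x = x := by
  let _ := M.isInternal.chooseDecomposition
  exact DirectSum.decompose_of_mem_same M.gr hx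

theorem proj_of_mem_ne {n k : ℤ} {x : M.carrier} (hx : x ∈ M.gr n) (h : n ≠ k) :
    M.proj k x = 0 := by
  let _ := M.isInternal.chooseDecomposition
  exact DirectSum.decompose_of_mem_ne M.gr hx h

theorem mem_of_proj_mem {S : AddSubgroup M.carrier} {x : M.carrier}
    (h : ∀ n, M.proj n x ∈ S) : x ∈ S := by
  classical
  let _ := M.isInternal.chooseDecomposition
  rw [← DirectSum.sum_support_decompose M.gr x]
  exact sum_mem fun n _ => h n

theorem proj_comm_of_mem {u : M.carrier →+ N.carrier} {k n : ℤ} {x : M.carrier}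
    (hx : x ∈ M.gr n) (hu : u x ∈ N.gr (n + k)) (j : ℤ) :
    u (M.proj j x) = N.proj (j + k) (u x) := by
  rcases eq_or_ne n j with rfl | h
  · rw [proj_of_mem hx, proj_of_mem hu]
  · rw [proj_of_mem_ne hx h, proj_of_mem_ne hu (by omega), map_zero]

theorem proj_comm {u : M.carrier →ₗ[R] N.carrier} {k : ℤ} (hu : MapsGr M.gr N.gr k u) (j : ℤ)
    (x : M.carrier) : u (M.proj j x) = N.proj (j + k) (u x) := by
  induction x using M.induction_gr with
  | h0 => simp
  | ha x y hx hy => simp only [map_add, hx, hy]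
  | hh n x hx => exact proj_comm_of_mem (u := u.toAddMonoidHom) hx (hu n x hx) j

theorem mapsGr_d (M : DGModule.{u, v} 𝒜) : MapsGr M.gr M.gr (-1) M.d := fun _ _ hx => M.d_mem hx

theorem Hom.mapsGr (f : Hom M N) : MapsGr M.gr N.gr 0 f.toFun := fun _ _ hx => by
  rw [add_zero]; exact f.map_gr hx

theorem Hom.onHomology_mk (f : Hom M N) (z : M.cycles) :
    f.onHomology (M.boundaries.mkQ z) = N.boundaries.mkQ (f.onCycles z) :=
  rfl

theorem mkQ_eq_zero_iff {z : M.cycles} : M.boundaries.mkQ z = 0 ↔ ∃ x, M.d x = z := by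
  rw [Submodule.mkQ_apply, Submodule.Quotient.mk_eq_zero]
  rfl

theorem mkQ_eq_iff {z z' : M.cycles} :
    M.boundaries.mkQ z = M.boundaries.mkQ z' ↔ ∃ x, M.d x = z - z' := by
  rw [← sub_eq_zero, ← map_sub, mkQ_eq_zero_iff]
  rfl

/-- The cone of a quasi-isomorphism is acyclic. -/
theorem Hom.IsQuasiIso.exists_lift {f : Hom M N} (hf : f.IsQuasiIso) {n : ℤ} {z : M.carrier}
    {y : N.carrier} (hz : z ∈ M.gr (n - 1)) (hdz : M.d z = 0) (hy : y ∈ N.gr n)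
    (h : f.toFun z = N.d y) :
    ∃ x' ∈ M.gr n, ∃ y' ∈ N.gr (n + 1), M.d x' = z ∧ y = f.toFun x' - N.d y' := by
  -- The class of `z` dies in the homology of `N`, so injectivity makes `z` a boundary.
  obtain ⟨x₀, hx₀⟩ : ∃ x, M.d x = z := by
    refine (mkQ_eq_zero_iff (z := ⟨z, hdz⟩)).1 (hf.1 ?_)
    rw [f.onHomology_mk, map_zero, mkQ_eq_zero_iff]
    exact ⟨y, h.symm⟩
  -- The error of the first choice is a cycle; surjectivity provides a cycle `x₁` to correct `x₀`.
  have hc : N.d (y - f.toFun x₀) = 0 := by rw [map_sub, ← f.map_d, hx₀, h, sub_self]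
  obtain ⟨q, hq⟩ := hf.2 (N.boundaries.mkQ ⟨y - f.toFun x₀, hc⟩)
  obtain ⟨⟨x₁, hx₁⟩, rfl⟩ := M.boundaries.mkQ_surjective q
  rw [f.onHomology_mk, mkQ_eq_iff] at hq
  obtain ⟨y', hy'⟩ := hq
  have hy' : N.d y' = f.toFun x₁ - (y - f.toFun x₀) := hy'
  have hx₁ : M.d x₁ = 0 := hx₁
  -- The solution found need not be homogeneous; its components in the required degrees solve the
  -- same equations.
  refine ⟨M.proj n (x₀ + x₁), proj_mem _ _ _, N.proj (n + 1) y', proj_mem _ _ _, ?_, ?_⟩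
  · rw [proj_comm M.mapsGr_d, map_add, hx₀, hx₁, add_zero, ← sub_eq_add_neg, proj_of_mem hz]
  · rw [proj_comm N.mapsGr_d, proj_comm f.mapsGr, hy', add_neg_cancel_right, add_zero, ← map_sub,
      map_add, show f.toFun x₀ + f.toFun x₁ - (f.toFun x₁ - (y - f.toFun x₀)) = y by abel,
      proj_of_mem hy]

/-- A map of complexes with acyclic cone is a quasi-isomorphism. -/
theorem Hom.isQuasiIso_of_exists_lift {f : Hom M N}
    (H : ∀ (n : ℤ) (z : M.carrier) (y : N.carrier), z ∈ M.gr (n - 1) → M.d z = 0 → y ∈ N.gr n →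
      f.toFun z = N.d y → ∃ x' y', M.d x' = z ∧ y = f.toFun x' + N.d y') : f.IsQuasiIso := by
  constructor
  · refine (injective_iff_map_eq_zero f.onHomology).2 fun q hq => ?_
    obtain ⟨⟨z, hz⟩, rfl⟩ := M.boundaries.mkQ_surjective q
    rw [f.onHomology_mk, mkQ_eq_zero_iff] at hq
    rw [mkQ_eq_zero_iff]
    obtain ⟨y, hy⟩ := hq
    have hy : N.d y = f.toFun z := hy
    have hz : M.d z = 0 := hz
    -- The hypothesis concerns homogeneous elements only, so `z` is shown to be a boundary component
    -- by component.
    refine mem_of_proj_mem (S := M.d.toAddMonoidHom.range) fun n => ?_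
    have e : n + 1 + -1 = n := by ring
    obtain ⟨x', _, hx', -⟩ := H (n + 1) (M.proj n z) (N.proj (n + 1) y)
      (by rw [add_sub_cancel_right]; exact proj_mem _ _ _)
      (by rw [proj_comm M.mapsGr_d, hz, map_zero]) (proj_mem _ _ _)
      (by rw [proj_comm f.mapsGr, proj_comm N.mapsGr_d, hy, e, add_zero])
    exact ⟨x', hx'⟩
  · intro q
    obtain ⟨⟨y, hy⟩, rfl⟩ := N.boundaries.mkQ_surjective q
    have hy : N.d y = 0 := hy
    have key : y ∈ (M.cycles.map f.toFun ⊔ LinearMap.range N.d).toAddSubgroup := by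
      refine mem_of_proj_mem fun n => ?_
      -- With first coordinate `0`, a cycle of the cone is just a cycle of `N`.
      obtain ⟨x', y', hx', hy'⟩ := H n 0 (N.proj n y) (zero_mem _) (map_zero _) (proj_mem _ _ _)
        (by rw [proj_comm N.mapsGr_d, hy, map_zero, map_zero])
      exact Submodule.mem_sup.2 ⟨_, ⟨x', hx', rfl⟩, _, ⟨y', rfl⟩, hy'.symm⟩
    obtain ⟨_, ⟨x, hx, rfl⟩, _, ⟨y', rfl⟩, h⟩ := Submodule.mem_sup.1 key
    refine ⟨M.boundaries.mkQ ⟨x, hx⟩, ?_⟩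
    rw [f.onHomology_mk, mkQ_eq_iff]
    refine ⟨-y', ?_⟩
    change N.d (-y') = f.toFun x - y
    rw [← h, map_neg]
    abel

variable [GradedRing 𝒜]

/-- Commutation with the projections is additive, so it can be checked on homogeneous multiples of
basis elements; the coefficients of a homogeneous vector need not be analysed. -/
theorem mapsGr_of_basis {ι : Type*} (b : Module.Basis ι R M.carrier) {deg : ι → ℤ}
    (hb : ∀ i, b i ∈ M.gr (deg i)) {k : ℤ} {L : M.carrier →ₗ[R] N.carrier}
    (hL : ∀ i, L (b i) ∈ N.gr (deg i + k)) : MapsGr M.gr N.gr k L := by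
  have key : ∀ x j, L (M.proj j x) = N.proj (j + k) (L x) := by
    intro x j
    obtain ⟨c, rfl⟩ := b.repr.symm.surjective x
    induction c using Finsupp.induction_linear with
    | zero => simp
    | add x y hx hy => simp only [map_add, hx, hy]
    | single i r =>
      rw [Module.Basis.repr_symm_single]
      induction r using DirectSum.Decomposition.inductionOn 𝒜 with
      | zero => simp
      | add r r' hr hr' => simp only [add_smul, map_add, hr, hr']
      | @homogeneous m r =>
        refine proj_comm_of_mem (u := L.toAddMonoidHom) (M.smul_mem r.2 (hb i)) ?_ j
        change L ((r : R) • b i) ∈ _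
        rw [map_smul, add_assoc]
        exact N.smul_mem r.2 (hL i)
  intro n x hx
  rw [← proj_of_mem hx, key]
  exact proj_mem _ _ _

/-- A quasi-isomorphism to a cell module has a right homotopy inverse. -/
theorem Hom.IsQuasiIso.exists_right_inverse {f : Hom M N} (hf : f.IsQuasiIso) (hN : N.IsCell) :
    ∃ (s : Hom N M) (h : N.carrier →ₗ[R] N.carrier), MapsGr N.gr N.gr 1 h ∧
      ∀ x, f.toFun (s.toFun x) - x = N.d (h x) + h (N.d x) := by
  classical
  obtain ⟨ι, b, deg, rk, hb, hd⟩ := hN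
  -- `t` is the value already found on `d (b i)`, and `q` the value sought on `b i`: first
  -- coordinates will form the section `s`, second coordinates the homotopy `h`.
  let good (i : ι) (t q : M.carrier × N.carrier) : Prop :=
    q.1 ∈ M.gr (deg i) ∧ q.2 ∈ N.gr (deg i + 1) ∧ M.d q.1 = t.1 ∧
      b i + t.2 = f.toFun q.1 - N.d q.2
  -- The default `0` is never taken: `key` shows, by induction on the rank, that a good value always
  -- exists.
  let step (i : ι) (t : M.carrier × N.carrier) : M.carrier × N.carrier :=
    if h : ∃ q, good i t q then h.choose else 0
  have hstep : ∀ i t, (∃ q, good i t q) → good i t (step i t) := fun i t h => by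
    simp only [step, dif_pos h]
    exact h.choose_spec
  let wf : WellFounded fun i j : ι => rk i < rk j := (measure rk).wf
  let F (i : ι) (rec : ∀ j, rk j < rk i → M.carrier × N.carrier) : M.carrier × N.carrier :=
    step i (b.constr R (fun j => if h : rk j < rk i then rec j h else 0) (N.d (b i)))
  let val : ι → M.carrier × N.carrier := wf.fix F
  let L : N.carrier →ₗ[R] M.carrier × N.carrier := b.constr R val
  -- The truncation to smaller rank agrees with `L` on `d (b i)`. By the inductive hypothesis its
  -- two components are homogeneous on all of `N`, which is not yet known for `L`.
  let L' (i : ι) : N.carrier →ₗ[R] M.carrier × N.carrier :=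
    b.constr R (fun j => if rk j < rk i then val j else 0)
  have hLL' : ∀ i, L' i (N.d (b i)) = L (N.d (b i)) := fun i => by
    refine LinearMap.eqOn_span ?_ (hd i)
    rintro _ ⟨j, hj, rfl⟩
    simp only [L, L', Module.Basis.constr_basis]
    exact if_pos hj
  have hval : ∀ i, L (b i) = step i (L (N.d (b i))) := fun i => by
    rw [← hLL']
    simp only [L, Module.Basis.constr_basis]
    exact wf.fix_eq F i
  have key : ∀ i, good i (L (N.d (b i))) (L (b i)) := by
    intro i
    induction hk : rk i using Nat.strong_induction_on generalizing i with
    | _ k ih =>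
      subst hk
      rw [hval]
      refine hstep _ _ ?_
      have hs : ∀ x ∈ Submodule.span R (b '' {j | rk j < rk i}),
          (M.d ∘ₗ LinearMap.fst R _ _ ∘ₗ L) x = (LinearMap.fst R _ _ ∘ₗ L ∘ₗ N.d) x := by
        refine LinearMap.eqOn_span ?_
        rintro _ ⟨j, hj, rfl⟩
        exact (ih _ hj j rfl).2.2.1
      have hh : ∀ x ∈ Submodule.span R (b '' {j | rk j < rk i}),
          (LinearMap.id + LinearMap.snd R _ _ ∘ₗ L ∘ₗ N.d : N.carrier →ₗ[R] N.carrier) x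
            = (f.toFun ∘ₗ LinearMap.fst R _ _ ∘ₗ L - N.d ∘ₗ LinearMap.snd R _ _ ∘ₗ L) x := by
        refine LinearMap.eqOn_span ?_
        rintro _ ⟨j, hj, rfl⟩
        exact (ih _ hj j rfl).2.2.2
      have hs' := hs _ (hd i)
      have hh' := hh _ (hd i)
      simp only [LinearMap.comp_apply, LinearMap.add_apply, LinearMap.sub_apply, LinearMap.id_apply,
        LinearMap.fst_apply, LinearMap.snd_apply, N.d_d, map_zero, add_zero] at hs' hh'
      have g1 : MapsGr N.gr M.gr 0 (LinearMap.fst R _ _ ∘ₗ L' i) := by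
        refine mapsGr_of_basis b hb fun j => ?_
        rw [add_zero, LinearMap.comp_apply, LinearMap.fst_apply]
        simp only [L', Module.Basis.constr_basis]
        split_ifs with hj
        · have := (ih _ hj j rfl).1
          simpa only [L, Module.Basis.constr_basis] using this
        · exact zero_mem _
      have g2 : MapsGr N.gr N.gr 1 (LinearMap.snd R _ _ ∘ₗ L' i) := by
        refine mapsGr_of_basis b hb fun j => ?_
        rw [LinearMap.comp_apply, LinearMap.snd_apply]
        simp only [L', Module.Basis.constr_basis]
        split_ifs with hj
        · have := (ih _ hj j rfl).2.1
          simpa only [L, Module.Basis.constr_basis] using this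
        · exact zero_mem _
      have hz : (L (N.d (b i))).1 ∈ M.gr (deg i - 1) := by
        rw [← hLL']
        exact g1.mem (N.d_mem (hb i)) (add_zero _).symm
      have hw : (L (N.d (b i))).2 ∈ N.gr (deg i) := by
        rw [← hLL']
        exact g2.mem (N.d_mem (hb i)) (sub_add_cancel _ _).symm
      -- `hs'` and `hh'` say that `(s d b, b + h d b)` is a cycle of the cone of `f`. Acyclicity of
      -- the cone gives the value on `b`.
      obtain ⟨x', hx', y', hy', e1, e2⟩ := hf.exists_lift hz hs' (add_mem (hb i) hw)
        (by rw [map_add]; exact (sub_eq_iff_eq_add.1 hh'.symm))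
      exact ⟨(x', y'), hx', hy', e1, e2⟩
  have e1 : LinearMap.fst R _ _ ∘ₗ L ∘ₗ N.d = M.d ∘ₗ LinearMap.fst R _ _ ∘ₗ L :=
    b.ext fun i => (key i).2.2.1.symm
  have e2 : LinearMap.id + LinearMap.snd R _ _ ∘ₗ L ∘ₗ N.d
      = f.toFun ∘ₗ LinearMap.fst R _ _ ∘ₗ L - N.d ∘ₗ LinearMap.snd R _ _ ∘ₗ L :=
    b.ext fun i => (key i).2.2.2
  have g : MapsGr N.gr M.gr 0 (LinearMap.fst R _ _ ∘ₗ L) :=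
    mapsGr_of_basis b hb fun i => by rw [add_zero]; exact (key i).1
  refine ⟨⟨LinearMap.fst R _ _ ∘ₗ L, fun hx => g.mem hx (add_zero _).symm,
    LinearMap.congr_fun e1⟩, LinearMap.snd R _ _ ∘ₗ L,
    mapsGr_of_basis b hb fun i => (key i).2.1, fun x => ?_⟩
  have := LinearMap.congr_fun e2 x
  simp only [LinearMap.comp_apply, LinearMap.add_apply, LinearMap.sub_apply, LinearMap.id_apply]
    at this ⊢
  rw [eq_sub_iff_add_eq] at this
  rw [← this]
  abel

/-- A quasi-isomorphism between cell modules is a homotopy equivalence. -/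
theorem Hom.IsQuasiIso.exists_inverse {f : Hom M N} (hf : f.IsQuasiIso) (hM : M.IsCell)
    (hN : N.IsCell) : ∃ (s : Hom N M) (h : N.carrier →ₗ[R] N.carrier)
      (k : M.carrier →ₗ[R] M.carrier), MapsGr N.gr N.gr 1 h ∧ MapsGr M.gr M.gr 1 k ∧
      (∀ x, f.toFun (s.toFun x) - x = N.d (h x) + h (N.d x)) ∧
      ∀ x, s.toFun (f.toFun x) - x = M.d (k x) + k (M.d x) := by
  obtain ⟨s, h, gh, hs⟩ := hf.exists_right_inverse hN
  -- Since `f s` is homotopic to the identity, `s` is inverse to `f` on homology; the construction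
  -- can be repeated for `s`, whose target is also a cell module.
  have hsq : s.IsQuasiIso := by
    refine (Function.Bijective.of_comp_iff' hf s.onHomology).1 ?_
    convert Function.bijective_id
    ext1 q
    obtain ⟨⟨z, hz⟩, rfl⟩ := N.boundaries.mkQ_surjective q
    rw [Function.comp_apply, s.onHomology_mk, f.onHomology_mk, id, mkQ_eq_iff]
    have hz : N.d z = 0 := hz
    have := hs z
    rw [hz, map_zero, add_zero] at this
    exact ⟨h z, this.symm⟩
  obtain ⟨f', k, gk, hk⟩ := hsq.exists_right_inverse hM
  -- Both `f` and `f'` are homotopic to `f s f'`, and `h f' - f k` is the resulting homotopy between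
  -- them. Composing with `s` and adding the homotopy `k` from `s f'` to the identity gives the one
  -- for `s f`.
  refine ⟨s, h, k + s.toFun ∘ₗ (h ∘ₗ f'.toFun - f.toFun ∘ₗ k), gh, ?_, hs, fun x => ?_⟩
  · exact gk.add (s.mapsGr.comp ((gh.comp f'.mapsGr (add_zero 1).symm).sub
      (f.mapsGr.comp gk (zero_add 1).symm)) (zero_add 1).symm)
  · have h1 := congrArg f.toFun (hk x)
    have h2 := hs (f'.toFun x)
    have h3 := hk x
    have h4 : f.toFun x - f'.toFun x = N.d (h (f'.toFun x)) + h (f'.toFun (M.d x))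
        - f.toFun (M.d (k x)) - f.toFun (k (M.d x)) := by
      rw [map_sub, map_add] at h1
      rw [← f'.map_d] at h2
      rw [sub_sub, ← h1, ← h2]
      abel
    have h5 := congrArg s.toFun h4
    simp only [map_sub, map_add, LinearMap.add_apply, LinearMap.comp_apply, LinearMap.sub_apply,
      ← s.map_d, ← f.map_d] at h5 ⊢
    rw [sub_eq_iff_eq_add] at h3 h5
    rw [h5, h3]
    abel

end DGModule
end

/-! ### Tensor powers of homotopies, and completeness of the coderivations -/

noncomputable section

namespace TensorCoalg

section TensorMap

variable {R : Type*} [CommRing R] {V W U : Type*} [AddCommGroup V] [Module R V]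
  [AddCommGroup W] [Module R W] [AddCommGroup U] [Module R U]

/-- The map of tensor coalgebras induced by a linear map. -/
def tensorMap (f : V →ₗ[R] W) : TensorAlgebra R V →ₗ[R] TensorAlgebra R W :=
  (TensorAlgebra.lift R (TensorAlgebra.ι R ∘ₗ f)).toLinearMap

theorem isCoalgHom_tensorMap (f : V →ₗ[R] W) : IsCoalgHom (tensorMap f) := isCoalgHom_map f

theorem tensorMap_word (f : V →ₗ[R] W) (l : List V) :
    tensorMap f (word R l) = word R (l.map f) := by
  induction l with
  | nil => exact map_one (TensorAlgebra.lift R (TensorAlgebra.ι R ∘ₗ f))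
  | cons a l ih =>
    have : tensorMap f (TensorAlgebra.ι R a * word R l)
        = TensorAlgebra.lift R (TensorAlgebra.ι R ∘ₗ f) (TensorAlgebra.ι R a)
          * tensorMap f (word R l) := map_mul (TensorAlgebra.lift R (TensorAlgebra.ι R ∘ₗ f)) _ _
    rw [word_cons, this, ih]
    simp

theorem tensorMap_comp (g : W →ₗ[R] U) (f : V →ₗ[R] W) :
    tensorMap (g ∘ₗ f) = tensorMap g ∘ₗ tensorMap f :=
  linearMap_ext_word fun l => by simp [tensorMap_word]

theorem ιInv_word_of_length {l : List V} (h : 2 ≤ l.length) :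
    TensorAlgebra.ιInv (word R l) = 0 := by
  match l, h with
  | a :: b :: l, _ => rw [word_cons, ιInv_ι_mul, algebraMapInv_word_of_ne_nil (by simp), zero_smul]

theorem ιInv_comp_tensorMap (f : V →ₗ[R] W) :
    TensorAlgebra.ιInv ∘ₗ tensorMap f = f ∘ₗ TensorAlgebra.ιInv := by
  refine linearMap_ext_word fun l => ?_
  rw [LinearMap.comp_apply, LinearMap.comp_apply, tensorMap_word]
  match l with
  | [] => simp [ιInv_one]
  | [a] => simp [ιInv_ι]
  | a :: b :: l => rw [ιInv_word_of_length (by simp), ιInv_word_of_length (by simp), map_zero]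

/-- A pointwise finite sum of linear maps on the tensor algebra. -/
theorem exists_sum_of_vanishing {P : Type*} [AddCommGroup P] [Module R P]
    (u : ℕ → TensorAlgebra R V →ₗ[R] P)
    (hu : ∀ n (l : List V), l.length < n → u n (word R l) = 0) :
    ∃ U : TensorAlgebra R V →ₗ[R] P, ∀ N (l : List V), l.length < N →
      U (word R l) = ∑ i ∈ Finset.range N, u i (word R l) := by
  let G : ℕ → Submodule R (TensorAlgebra R V) := (LinearMap.range (TensorAlgebra.ι R (M := V)) ^ ·)
  -- On words of length `n` only `u 0, …, u n` can be nonzero, so the sum is truncated separately in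
  -- each length.
  let U : TensorAlgebra R V →ₗ[R] P :=
    DirectSum.toModule R ℕ P (fun n => (∑ i ∈ Finset.range (n + 1), u i) ∘ₗ (G n).subtype)
      ∘ₗ (DirectSum.decomposeLinearEquiv G).toLinearMap
  have hw : ∀ l : List V, word R l ∈ G l.length := by
    intro l
    induction l with
    | nil => simp [G]
    | cons a l ih =>
      rw [word_cons, List.length_cons]
      change _ ∈ LinearMap.range (TensorAlgebra.ι R (M := V)) ^ (l.length + 1)
      rw [pow_succ']
      exact Submodule.mul_mem_mul ⟨a, rfl⟩ ih
  refine ⟨U, fun N l hl => ?_⟩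
  have : U (word R l) = ∑ i ∈ Finset.range (l.length + 1), u i (word R l) := by
    simp only [U, LinearMap.comp_apply, LinearEquiv.coe_coe, DirectSum.decomposeLinearEquiv_apply]
    rw [DirectSum.decompose_of_mem G (hw l)]
    erw [DirectSum.toModule_lof]
    simp
  rw [this]
  refine Finset.sum_subset (fun i hi => ?_) fun i _ hi => hu i l ?_
  · simp only [Finset.mem_range] at hi ⊢
    omega
  · simp only [Finset.mem_range] at hi
    omega

/-- A coderivation without constant and linear part lowers the length. -/
theorem IsCoder.apply_eq_zero {p q g : TensorAlgebra R V →ₗ[R] TensorAlgebra R W}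
    (hp : IsCoalgHom p) (hq : IsCoalgHom q) (hg : IsCoder p q g)
    (h : ∀ l : List V, l.length < 2 → TensorAlgebra.ιInv (g (word R l)) = 0) {n : ℕ}
    {P : Type*} [AddCommGroup P] [Module R P] {φ : TensorAlgebra R W →ₗ[R] P}
    (hφ : ∀ l : List W, l.length < n → φ (word R l) = 0) {x : TensorAlgebra R V}
    (hx : x ∈ lenLE R V n) : φ (g x) = 0 := by
  cases n with
  | zero =>
    have : g x ∈ (⊥ : Submodule R (TensorAlgebra R W)) :=
      map_mem_of_mem_lenLE (fun l hl => by
        rw [hg.word_eq_zero hp hq h l (by omega)]; exact zero_mem _) hx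
    rw [(Submodule.mem_bot R).1 this, map_zero]
  | succ n =>
    exact (Submodule.mem_bot R).1 (map_mem_of_mem_lenLE (S := ⊥)
      (fun l hl => (Submodule.mem_bot R).2 (hφ l (by omega)))
      (hg.map_mem hp hq h (r := n) (by omega) hx))

theorem IsCoder.eq_ι_of_mem_lenLE {p q g : TensorAlgebra R V →ₗ[R] TensorAlgebra R W}
    (hp : IsCoalgHom p) (hq : IsCoalgHom q) (hg : IsCoder p q g) {n : ℕ}
    (h : ∀ l : List V, l.length < n → g (word R l) = 0) {x : TensorAlgebra R V}
    (hx : x ∈ lenLE R V n) : g x = TensorAlgebra.ι R (TensorAlgebra.ιInv (g x)) := by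
  have : (g - TensorAlgebra.ι R ∘ₗ TensorAlgebra.ιInv ∘ₗ g) x
      ∈ (⊥ : Submodule R (TensorAlgebra R W)) :=
    map_mem_of_mem_lenLE (fun l hl => (Submodule.mem_bot R).2
      (sub_eq_zero.2 (hg.word_eq_ι hp hq h l hl))) hx
  exact sub_eq_zero.1 ((Submodule.mem_bot R).1 this)

end TensorMap

section Linear

variable {R : Type u} [CommRing R] {𝒜 : ℤ → AddSubgroup R} [GradedRing 𝒜] [IsEvenlyGraded 𝒜]
  {M N : DGModule.{u, v} 𝒜}

/-- The differential of the tensor powers of `M`. -/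
def linD (M : DGModule.{u, v} 𝒜) : TensorAlgebra R M.carrier →ₗ[R] TensorAlgebra R M.carrier :=
  coext (sgn M (-1)) LinearMap.id (M.d ∘ₗ TensorAlgebra.ιInv)

theorem isCoder_linD (M : DGModule.{u, v} 𝒜) : IsCoder (sgn M (-1)) LinearMap.id (linD M) :=
  isCoder_coext (isCoalgHom_sgn M _) .id _

theorem mapsGr_linD (M : DGModule.{u, v} 𝒜) : MapsGr (gr M) (gr M) (-1) (linD M) :=
  mapsGr_coext (mapsGr_sgn M _) .id (M.mapsGr_d.comp (mapsGr_ιInv M) (add_zero _).symm)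

theorem ιInv_linD (M : DGModule.{u, v} 𝒜) :
    TensorAlgebra.ιInv ∘ₗ linD M = M.d ∘ₗ TensorAlgebra.ιInv :=
  ιInv_coext (isCoalgHom_sgn M _) .id _

theorem mapsGr_tensorMap {f : M.carrier →ₗ[R] N.carrier} (hf : MapsGr M.gr N.gr 0 f) :
    MapsGr (gr M) (gr N) 0 (tensorMap f) := mapsGr_lift hf

/-- Both composites are coderivations for the same pair of coalgebra maps, so comparing
corestrictions suffices. -/
theorem tensorMap_comp_linD {f : M.carrier →ₗ[R] N.carrier} (hf : MapsGr M.gr N.gr 0 f)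
    (hd : f ∘ₗ M.d = N.d ∘ₗ f) : tensorMap f ∘ₗ linD M = linD N ∘ₗ tensorMap f := by
  have hs := sgn_comp_of_mapsGr_zero (mapsGr_tensorMap hf) (-1)
  have h1 := (isCoder_linD M).coalgHom_comp (isCoalgHom_tensorMap f)
  have h2 := (isCoder_linD N).comp_coalgHom (isCoalgHom_tensorMap f)
  rw [hs] at h2
  refine h1.eq_of_ιInv ((isCoalgHom_tensorMap f).comp (isCoalgHom_sgn M _))
    (isCoalgHom_tensorMap f) h2 ?_
  rw [← LinearMap.comp_assoc, ιInv_comp_tensorMap, LinearMap.comp_assoc, ιInv_linD,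
    ← LinearMap.comp_assoc, hd, ← LinearMap.comp_assoc, ιInv_linD, LinearMap.comp_assoc,
    LinearMap.comp_assoc, ιInv_comp_tensorMap]

/-- A homotopy `e ≃ 1` induces a homotopy on the tensor coalgebra. -/
theorem exists_tensor_homotopy {e h : M.carrier →ₗ[R] M.carrier} (he : MapsGr M.gr M.gr 0 e)
    (hd : e ∘ₗ M.d = M.d ∘ₗ e) (hh : MapsGr M.gr M.gr 1 h)
    (H : ∀ x, e x - x = M.d (h x) + h (M.d x)) :
    ∃ K : TensorAlgebra R M.carrier →ₗ[R] TensorAlgebra R M.carrier,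
      MapsGr (gr M) (gr M) 1 K ∧
      (∀ n x, x ∈ lenLE R M.carrier n → K x ∈ lenLE R M.carrier n) ∧
      ∀ x, tensorMap e x - x = linD M (K x) + K (linD M x) := by
  have ce := isCoalgHom_tensorMap e
  have cp := ce.comp (isCoalgHom_sgn M 1)
  have ge := mapsGr_tensorMap he
  -- Up to sign, `K` is the sum of `e ⊗ ⋯ ⊗ e ⊗ h ⊗ 1 ⊗ ⋯ ⊗ 1`. With `e` on one side and `1` on the
  -- other, its boundary telescopes from `1` to the tensor powers of `e`.
  let K := coext (tensorMap e ∘ₗ sgn M 1) LinearMap.id (h ∘ₗ TensorAlgebra.ιInv)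
  have cK : IsCoder (tensorMap e ∘ₗ sgn M 1) LinearMap.id K := isCoder_coext cp .id _
  have hK : TensorAlgebra.ιInv ∘ₗ K = h ∘ₗ TensorAlgebra.ιInv := ιInv_coext cp .id _
  have gK : MapsGr (gr M) (gr M) 1 K :=
    mapsGr_coext (ge.comp (mapsGr_sgn M 1) (add_zero 0).symm) .id
      (hh.comp (mapsGr_ιInv M) (add_zero _).symm)
  refine ⟨K, gK, fun n x hx => ?_, ?_⟩
  · refine cK.map_mem (j := 1) cp .id (fun l hl => ?_) le_rfl hx
    have h := LinearMap.congr_fun hK (word R l)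
    rw [List.length_eq_zero_iff.1 (Nat.lt_one_iff.1 hl)] at h ⊢
    rw [LinearMap.comp_apply] at h
    rw [h, LinearMap.comp_apply, word_nil, ιInv_one, map_zero]
  · have h1 := cK.graded_comm ge gK (mapsGr_linD M) (isCoder_linD M) (isCoder_linD M)
      (tensorMap_comp_linD he hd) (by rw [LinearMap.id_comp, LinearMap.comp_id])
    rw [sub_self, sgn_zero, LinearMap.comp_id] at h1
    -- Both `tensorMap e - 1` and the graded commutator of `K` with `linD` are coderivations for the
    -- pair `(tensorMap e, 1)`; on corestrictions the claim is `H`.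
    have key := (ce.isCoder_sub .id).eq_of_ιInv ce .id h1 (by
      simp only [Int.negOnePow_one, Units.val_neg, Units.val_one, neg_one_smul, sub_neg_eq_add,
        LinearMap.comp_add, LinearMap.comp_sub]
      rw [ιInv_comp_tensorMap, ← LinearMap.comp_assoc, hK, ← LinearMap.comp_assoc, ιInv_linD,
        LinearMap.comp_assoc, ιInv_linD, LinearMap.comp_assoc, hK]
      ext1 x
      have := H (TensorAlgebra.ιInv x)
      simp only [LinearMap.sub_apply, LinearMap.add_apply, LinearMap.comp_apply,
        LinearMap.id_apply, this]
      abel)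
    intro x
    have := LinearMap.congr_fun key x
    simp only [LinearMap.sub_apply, LinearMap.id_apply, Int.negOnePow_one, Units.val_neg, Units.val_one, neg_one_smul, sub_neg_eq_add] at this
    rw [this, add_comm]
    rfl

/-- The coderivations of degree `k` along a coalgebra map `p`. -/
def coderAlong (p : TensorAlgebra R M.carrier →ₗ[R] TensorAlgebra R N.carrier) (k : ℤ) :
    AddSubgroup (TensorAlgebra R M.carrier →ₗ[R] TensorAlgebra R N.carrier) where
  carrier := {g | MapsGr (gr M) (gr N) k g ∧ IsCoder (p ∘ₗ sgn M k) p g}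
  zero_mem' := ⟨fun n x _ => zero_mem _, by simp [IsCoder]⟩
  add_mem' := by
    rintro f g ⟨hf, hf'⟩ ⟨hg, hg'⟩
    refine ⟨hf.add hg, ?_⟩
    unfold IsCoder at *
    rw [LinearMap.comp_add, hf', hg', TensorProduct.map_add_left, TensorProduct.map_add_right]
    simp only [LinearMap.add_comp]
    abel
  neg_mem' := by
    rintro f ⟨hf, hf'⟩
    refine ⟨hf.neg, ?_⟩
    unfold IsCoder at *
    rw [LinearMap.comp_neg, hf', ← neg_one_smul R f, TensorProduct.map_smul_left,
      TensorProduct.map_smul_right, ← smul_add, LinearMap.smul_comp]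
    module

instance coderAlong_gradedSMul
    (p : TensorAlgebra R M.carrier →ₗ[R] TensorAlgebra R N.carrier) :
    SetLike.GradedSMul 𝒜 (coderAlong p) where
  smul_mem := by
    rintro i k r f hr ⟨hf, hf'⟩
    refine ⟨fun n x hx => ?_, ?_⟩
    · have := smul_mem_gr N hr (hf n x hx)
      rwa [add_left_comm] at this
    · rcases DGModule.even_or_eq_zero hr with h | h
      · unfold IsCoder at *
        rw [vadd_eq_add, sgn_congr M h, LinearMap.comp_smul, hf', TensorProduct.map_smul_left,
          TensorProduct.map_smul_right, ← smul_add, LinearMap.smul_comp]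
      · simp [h, IsCoder]

theorem coext_mem_coderAlong {p : TensorAlgebra R M.carrier →ₗ[R] TensorAlgebra R N.carrier}
    (hp : IsCoalgHom p) (gp : MapsGr (gr M) (gr N) 0 p) {k : ℤ}
    {φ : TensorAlgebra R M.carrier →ₗ[R] N.carrier} (hφ : MapsGr (gr M) N.gr k φ) :
    coext (p ∘ₗ sgn M k) p φ ∈ coderAlong p k :=
  ⟨mapsGr_coext (gp.comp (mapsGr_sgn M k) (add_zero 0).symm) gp hφ,
    isCoder_coext (hp.comp (isCoalgHom_sgn M k)) hp φ⟩

/-- Linear maps vanishing on the words of length less than `n`. -/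
def vanishing (R : Type*) [CommRing R] (V W : Type*) [AddCommGroup V] [Module R V]
    [AddCommGroup W] [Module R W] (n : ℕ) : AddSubgroup (TensorAlgebra R V →ₗ[R] W) where
  carrier := {g | ∀ l : List V, l.length < n → g (word R l) = 0}
  zero_mem' := fun _ _ => rfl
  add_mem' := fun hf hg l hl => by rw [LinearMap.add_apply, hf l hl, hg l hl, add_zero]
  neg_mem' := fun hf l hl => by rw [LinearMap.neg_apply, hf l hl, neg_zero]

/-- Completeness of the length filtration: the corestrictions are summed, finitely many on each
word, and the sum is extended again to a coderivation. -/
theorem exists_sum_coderAlong {p : TensorAlgebra R M.carrier →ₗ[R] TensorAlgebra R N.carrier}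
    (hp : IsCoalgHom p) (gp : MapsGr (gr M) (gr N) 0 p) {k : ℤ}
    (u : ℕ → coderAlong p k) (hu : ∀ n, (u n).1 ∈ vanishing R M.carrier _ n) :
    ∃ U : coderAlong p k, ∀ n,
      (U - ∑ i ∈ Finset.range n, u i).1 ∈ vanishing R M.carrier _ n := by
  obtain ⟨φ, hφ⟩ := exists_sum_of_vanishing (fun n => TensorAlgebra.ιInv ∘ₗ (u n).1)
    fun n l hl => by rw [LinearMap.comp_apply, hu n l hl, map_zero]
  have gφ : MapsGr (gr M) N.gr k φ := by
    refine mapsGr_of_words (M := M) N.smul_mem fun n l hl => ?_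
    rw [hφ _ l (Nat.lt_succ_self _)]
    exact sum_mem fun i _ => ((mapsGr_ιInv N).comp (u i).2.1 (zero_add k).symm) _ _ hl.word_mem
  refine ⟨⟨_, coext_mem_coderAlong hp gp gφ⟩, fun n l hl => ?_⟩
  refine (Subtype.prop (_ - _ : coderAlong p k)).2.word_eq_zero
    (hp.comp (isCoalgHom_sgn M k)) hp (fun l hl => ?_) l hl
  have e := LinearMap.congr_fun (ιInv_coext (hp.comp (isCoalgHom_sgn M k)) hp φ) (word R l)
  rw [LinearMap.comp_apply] at e
  rw [AddSubgroup.coe_sub, LinearMap.sub_apply, map_sub, e, hφ n l hl, AddSubgroup.val_finsetSum]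
  simp

end Linear

end TensorCoalg
end

/-! ### Acyclic cones from homotopy equivalences, and successive approximation -/

noncomputable section

section LinearCones

variable {R : Type*} [CommRing R] {P Q Z W : Type*} [AddCommGroup P] [Module R P] [AddCommGroup Q]
  [Module R Q] [AddCommGroup Z] [Module R Z] [AddCommGroup W] [Module R W]

/-- Precomposition with a homotopy equivalence has an acyclic cone, on submodules preserved by
all the maps involved. -/
theorem exists_precomp_lift {P₀ : Submodule R P} {Q₀ : Submodule R Q} {DP : P →ₗ[R] P}
    {DQ : Q →ₗ[R] Q} {F : P →ₗ[R] Q} {S : Q →ₗ[R] P} {H : Q →ₗ[R] Q} {K : P →ₗ[R] P}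
    {d : Z →ₗ[R] Z} (s : ℤˣ)
    (hFD : ∀ x, F (DP x) = DQ (F x)) (hSD : ∀ x, S (DQ x) = DP (S x))
    (hH : ∀ x, F (S x) - x = DQ (H x) + H (DQ x)) (hK : ∀ x, S (F x) - x = DP (K x) + K (DP x))
    (mF : ∀ x ∈ P₀, F x ∈ Q₀) (mS : ∀ x ∈ Q₀, S x ∈ P₀) (mH : ∀ x ∈ Q₀, H x ∈ Q₀)
    (mK : ∀ x ∈ P₀, K x ∈ P₀) {ξ : Q →ₗ[R] Z} {η : P →ₗ[R] Z}
    (h1 : ∀ x ∈ Q₀, ξ (DQ x) = -((s : ℤ) • d (ξ x)))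
    (h2 : ∀ x ∈ P₀, ξ (F x) = η (DP x) - (s : ℤ) • d (η x)) {ξ₀ ξ' : Q →ₗ[R] Z}
    {η₁ η' : P →ₗ[R] Z} (e0 : ξ₀ = η ∘ₗ S - ξ ∘ₗ H) (e1 : η₁ = η - ξ₀ ∘ₗ F)
    (e2 : ξ' = ξ₀ + η₁ ∘ₗ S) (e3 : η' = -(η₁ ∘ₗ K)) :
    (∀ x ∈ Q₀, ξ' (DQ x) - (s : ℤ) • d (ξ' x) = ξ x) ∧
      ∀ x ∈ P₀, ξ' (F x) + (η' (DP x) + (s : ℤ) • d (η' x)) = η x := by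
  -- `ξ₀` already solves the first equation. The equations are required only on `P₀` and `Q₀`, since
  -- leading-order identities hold only on short words.
  have A0 : ∀ x ∈ Q₀, ξ₀ (DQ x) - (s : ℤ) • d (ξ₀ x) = ξ x := by
    intro x hx
    have a := h2 _ (mS x hx)
    have b := h1 _ (mH x hx)
    have c := congrArg ξ (hH x)
    simp only [map_sub, map_add] at c
    simp only [e0, LinearMap.sub_apply, LinearMap.comp_apply, hSD, map_sub, smul_sub]
    linear_combination (norm := module) b + c - a
  -- The defect `η₁` in the second equation is a cycle, so `η₁ S` can be added to `ξ₀` without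
  -- spoiling the first equation.
  have A1 : ∀ x ∈ P₀, η₁ (DP x) = (s : ℤ) • d (η₁ x) := by
    intro x hx
    have a := h2 _ hx
    have b := A0 _ (mF x hx)
    simp only [e1, LinearMap.sub_apply, LinearMap.comp_apply, hFD, map_sub, smul_sub]
    linear_combination (norm := module) -a - b
  constructor
  · intro x hx
    have a := A0 x hx
    have b := A1 _ (mS x hx)
    simp only [e2, LinearMap.add_apply, LinearMap.comp_apply, hSD, map_add, smul_add]
    linear_combination (norm := module) a + b
  -- `η₁ S F` differs from `η₁` by the boundary of `η₁ K`, which `η'` removes.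
  · intro x hx
    have a := congrArg η₁ (hK x)
    have b := A1 _ (mK x hx)
    have c : η₁ x = η x - ξ₀ (F x) := by rw [e1]; rfl
    simp only [map_sub, map_add] at a
    simp only [e2, e3, LinearMap.add_apply, LinearMap.neg_apply, LinearMap.comp_apply,
      map_neg, smul_neg]
    linear_combination (norm := module) a + b + c

/-- Postcomposition with a homotopy equivalence has an acyclic cone. -/
theorem exists_postcomp_lift {W₀ : Submodule R W} {D : W →ₗ[R] W} {dP : P →ₗ[R] P}
    {dQ : Q →ₗ[R] Q} {f : P →ₗ[R] Q} {g : Q →ₗ[R] P} {h : Q →ₗ[R] Q} {k : P →ₗ[R] P} (s : ℤˣ)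
    (hf : ∀ x, f (dP x) = dQ (f x)) (hg : ∀ x, g (dQ x) = dP (g x))
    (hh : ∀ x, f (g x) - x = dQ (h x) + h (dQ x)) (hk : ∀ x, g (f x) - x = dP (k x) + k (dP x))
    {ξ : W →ₗ[R] P} {η : W →ₗ[R] Q}
    (h1 : ∀ x ∈ W₀, ξ (D x) = -((s : ℤ) • dP (ξ x)))
    (h2 : ∀ x ∈ W₀, f (ξ x) = η (D x) - (s : ℤ) • dQ (η x)) {ξ₀ ξ' : W →ₗ[R] P}
    {η₁ η' : W →ₗ[R] Q} (e0 : ξ₀ = g ∘ₗ η + (s : ℤ) • k ∘ₗ ξ) (e1 : η₁ = η - f ∘ₗ ξ₀)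
    (e2 : ξ' = ξ₀ + g ∘ₗ η₁) (e3 : η' = -((s : ℤ) • h ∘ₗ η₁)) :
    (∀ x ∈ W₀, ξ' (D x) - (s : ℤ) • dP (ξ' x) = ξ x) ∧
      ∀ x ∈ W₀, f (ξ' x) + (η' (D x) + (s : ℤ) • dQ (η' x)) = η x := by
  -- The scheme is that of `exists_precomp_lift`. The homotopies now act on the target, where the
  -- differential carries the sign `s`, so they carry the factor `s` too.
  have A0 : ∀ x ∈ W₀, ξ₀ (D x) - (s : ℤ) • dP (ξ₀ x) = ξ x := by
    intro x hx
    have a := congrArg g (h2 x hx)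
    have b := congrArg k (h1 x hx)
    have c := hk (ξ x)
    simp only [map_sub, map_neg, map_zsmul, hg] at a b
    simp only [e0, LinearMap.add_apply, LinearMap.smul_apply, LinearMap.comp_apply, map_add,
      map_zsmul]
    rcases Int.units_eq_one_or s with rfl | rfl <;>
      simp only [Units.val_one, Units.val_neg, one_smul, neg_smul, neg_neg] at a b ⊢
    · linear_combination (norm := module) b + c - a
    · linear_combination (norm := module) c - b - a
  have A1 : ∀ x ∈ W₀, η₁ (D x) = (s : ℤ) • dQ (η₁ x) := by
    intro x hx
    have a := h2 _ hx
    have b := congrArg f (A0 _ hx)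
    simp only [map_sub, map_zsmul, hf] at b
    simp only [e1, LinearMap.sub_apply, LinearMap.comp_apply, map_sub, smul_sub]
    linear_combination (norm := module) -a - b
  constructor
  · intro x hx
    have a := A0 x hx
    have b := congrArg g (A1 _ hx)
    simp only [map_zsmul, hg] at b
    simp only [e2, LinearMap.add_apply, LinearMap.comp_apply, map_add, smul_add]
    linear_combination (norm := module) a + b
  · intro x hx
    have a := hh (η₁ x)
    have b := congrArg h (A1 _ hx)
    have c : η₁ x = η x - f (ξ₀ x) := by rw [e1]; rfl
    simp only [map_zsmul] at b
    simp only [e2, e3, LinearMap.add_apply, LinearMap.neg_apply, LinearMap.comp_apply,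
      LinearMap.smul_apply, map_neg, map_zsmul, map_add, smul_neg]
    rcases Int.units_eq_one_or s with rfl | rfl <;>
      simp only [Units.val_one, Units.val_neg, one_smul, neg_smul, neg_neg] at b ⊢
    · linear_combination (norm := module) a + c - b
    · linear_combination (norm := module) a + c + b

end LinearCones

/-- Solving an equation degree by degree in a complete filtered group. -/
theorem exists_eq_of_filtration {B E : Type*} [AddCommGroup B] [AddCommGroup E] (D : B →+ E)
    (Z : AddSubgroup E) (FB : ℕ → AddSubgroup B) (FE : ℕ → AddSubgroup E)
    (hZ : ∀ b, D b ∈ Z) (hD : ∀ n, ∀ b ∈ FB n, D b ∈ FE n) (h0 : ∀ z, z ∈ FE 0)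
    (hstep : ∀ n, ∀ z ∈ Z, z ∈ FE n → ∃ b ∈ FB n, z - D b ∈ FE (n + 1))
    (hcomplete : ∀ u : ℕ → B, (∀ n, u n ∈ FB n) →
      ∃ U, ∀ n, U - ∑ i ∈ Finset.range n, u i ∈ FB n)
    (hsep : ∀ z, (∀ n, z ∈ FE n) → z = 0) {z : E} (hz : z ∈ Z) : ∃ b, D b = z := by
  choose! β hβ hβ' using hstep
  -- `e n` is the remainder after `n` corrections.
  let e : ℕ → E := fun n => Nat.rec z (fun n y => y - D (β n y)) n
  have he : ∀ n, e n ∈ Z ∧ e n ∈ FE n := by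
    intro n
    induction n with
    | zero => exact ⟨hz, h0 z⟩
    | succ n ih => exact ⟨sub_mem ih.1 (hZ _), hβ' n _ ih.1 ih.2⟩
  have hsum : ∀ n, e n = z - D (∑ i ∈ Finset.range n, β i (e i)) := by
    intro n
    induction n with
    | zero => simp [e]
    | succ n ih =>
      rw [Finset.sum_range_succ, map_add, ← sub_sub, ← ih]
  obtain ⟨U, hU⟩ := hcomplete (fun n => β n (e n)) fun n => hβ n _ (he n).1 (he n).2
  refine ⟨U, (sub_eq_zero.1 (hsep _ fun n => ?_)).symm⟩
  -- `z - D U` is the `n`-th remainder minus `D` of an element of `FB n`, so it lies in every `FE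
  -- n`.
  have := sub_mem (he n).2 (hD n _ (hU n))
  rwa [hsum, map_sub, sub_sub, add_sub_cancel] at this

end

/-! ### Coderivations along an `A∞`-morphism and their leading terms -/

noncomputable section

open TensorCoalg

namespace DGModule

variable {R : Type u} [CommRing R] {𝒜 : ℤ → AddSubgroup R}

theorem IsCell.susp {M : DGModule.{u, v} 𝒜} (h : M.IsCell) : M.susp.IsCell := by
  obtain ⟨ι, b, deg, rk, hb, hd⟩ := h
  refine ⟨ι, b, fun i => deg i + 1, rk, fun i => ?_, hd⟩
  change b i ∈ M.gr (deg i + 1 - 1)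
  rw [add_sub_cancel_right]
  exact hb i

end DGModule

namespace AInfAlgebra

variable {R : Type u} [CommRing R] {𝒜 : ℤ → AddSubgroup R} [GradedRing 𝒜] [IsEvenlyGraded 𝒜]
  {A C P : AInfAlgebra.{u, v} 𝒜}

theorem Hom.isCoalgHom (f : Hom A C) : IsCoalgHom f.toFun :=
  ⟨f.map_deconc, f.map_counit, f.map_one⟩

theorem Hom.mapsGr (f : Hom A C) : MapsGr (gr A.susp) (gr C.susp) 0 f.toFun := fun n x hx => by
  rw [add_zero]; exact f.map_gr n x hx

/-- The identity `A∞`-morphism. -/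
def Hom.id (A : AInfAlgebra.{u, v} 𝒜) : Hom A A where
  toFun := LinearMap.id
  map_gr _ _ hx := hx
  map_deconc := by simp
  map_counit _ := rfl
  map_m := rfl
  map_one := rfl

theorem mapsGr_m (A : AInfAlgebra.{u, v} 𝒜) : MapsGr (gr A.susp) (gr A.susp) (-1) A.m :=
  A.m_mem.1

theorem isCoder_m (A : AInfAlgebra.{u, v} 𝒜) : IsCoder (sgn A.susp (-1)) LinearMap.id A.m :=
  A.m_mem.2

/-- The differential `g ↦ g m - (-1)^k m g` of the coderivations along an `A∞`-morphism. -/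
def alongD (A C : AInfAlgebra.{u, v} 𝒜) (k : ℤ)
    (g : TensorAlgebra R A.susp.carrier →ₗ[R] TensorAlgebra R C.susp.carrier) :
    TensorAlgebra R A.susp.carrier →ₗ[R] TensorAlgebra R C.susp.carrier :=
  g ∘ₗ A.m - (k.negOnePow : ℤ) • (C.m ∘ₗ g)

theorem alongD_mem (f : Hom A C) {k : ℤ}
    {g : TensorAlgebra R A.susp.carrier →ₗ[R] TensorAlgebra R C.susp.carrier}
    (hg : g ∈ coderAlong f.toFun k) : alongD A C k g ∈ coderAlong f.toFun (k - 1) := by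
  refine ⟨?_, IsCoder.graded_comm f.mapsGr hg.1 A.mapsGr_m hg.2 A.isCoder_m C.isCoder_m f.map_m
    f.map_m⟩
  exact (hg.1.comp A.mapsGr_m (sub_eq_add_neg k 1)).sub
    ((C.mapsGr_m.comp hg.1 (by ring)).zsmul _)

/-- The differential on coderivations of degree `k` along `f`. -/
def Hom.degD (f : Hom A C) (k : ℤ) :
    coderAlong f.toFun k →+ coderAlong f.toFun (k - 1) where
  toFun g := ⟨alongD A C k g, alongD_mem f g.2⟩
  map_zero' := by ext1; simp [alongD]
  map_add' g g' := by
    ext1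
    simp only [alongD, AddSubgroup.coe_add, LinearMap.add_comp, LinearMap.comp_add, smul_add]
    abel

theorem coe_negOnePow_sub_one (k : ℤ) :
    (((k - 1).negOnePow : ℤˣ) : ℤ) = -(k.negOnePow : ℤ) := by
  rw [Int.negOnePow_sub]; simp

theorem coe_negOnePow_add_one (k : ℤ) :
    (((k + 1).negOnePow : ℤˣ) : ℤ) = -(k.negOnePow : ℤ) := by
  rw [Int.negOnePow_succ]; simp

theorem alongD_alongD (k : ℤ)
    (g : TensorAlgebra R A.susp.carrier →ₗ[R] TensorAlgebra R C.susp.carrier) :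
    alongD A C (k - 1) (alongD A C k g) = 0 := by
  simp only [alongD, coe_negOnePow_sub_one, LinearMap.sub_comp, LinearMap.comp_sub,
    LinearMap.smul_comp, LinearMap.comp_smul, LinearMap.comp_assoc, A.m_m, LinearMap.comp_zero]
  rw [← LinearMap.comp_assoc g C.m C.m, C.m_m]
  simp

theorem mem_vanishing_of_ιInv {f : Hom A C} {k : ℤ}
    {g : TensorAlgebra R A.susp.carrier →ₗ[R] TensorAlgebra R C.susp.carrier}
    (hg : g ∈ coderAlong f.toFun k) {n : ℕ}
    (h : ∀ l : List A.susp.carrier, l.length < n → TensorAlgebra.ιInv (g (word R l)) = 0) :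
    g ∈ vanishing R A.susp.carrier _ n :=
  hg.2.word_eq_zero (f.isCoalgHom.comp (isCoalgHom_sgn _ k)) f.isCoalgHom h

/-- `m` has no constant term, so each letter it produces consumes at least one. -/
theorem m_mem_lenLE (A : AInfAlgebra.{u, v} 𝒜) {n : ℕ} {x : TensorAlgebra R A.susp.carrier}
    (hx : x ∈ lenLE R A.susp.carrier n) : A.m x ∈ lenLE R A.susp.carrier n := by
  refine A.isCoder_m.map_mem (j := 1) (isCoalgHom_sgn _ _) .id (fun l hl => ?_) le_rfl hx
  rw [List.length_eq_zero_iff.1 (Nat.lt_one_iff.1 hl), word_nil, A.m_one, map_zero]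

theorem apply_eq_zero_of_mem_lenLE {V W : Type*} [AddCommGroup V] [Module R V] [AddCommGroup W]
    [Module R W] {g : TensorAlgebra R V →ₗ[R] W} {n j : ℕ} (hg : g ∈ vanishing R V W n)
    {x : TensorAlgebra R V} (hx : x ∈ lenLE R V j) (h : j < n) : g x = 0 :=
  (Submodule.mem_bot R).1 (map_mem_of_mem_lenLE (S := ⊥)
    (fun l hl => (Submodule.mem_bot R).2 (hg l (by omega))) hx)

theorem alongD_mem_vanishing {n : ℕ} {k : ℤ}
    {g : TensorAlgebra R A.susp.carrier →ₗ[R] TensorAlgebra R C.susp.carrier}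
    (hg : g ∈ vanishing R A.susp.carrier _ n) :
    alongD A C k g ∈ vanishing R A.susp.carrier _ n := by
  intro l hl
  simp only [alongD, LinearMap.sub_apply, LinearMap.comp_apply, LinearMap.smul_apply]
  rw [apply_eq_zero_of_mem_lenLE hg (A.m_mem_lenLE (word_mem_lenLE le_rfl)) hl, hg l hl]
  simp

/-- The leading term of `m` is the differential of the tensor powers. -/
theorem apply_m_eq (A : AInfAlgebra.{u, v} 𝒜) {Q : Type*} [AddCommGroup Q] [Module R Q] {n : ℕ}
    {φ : TensorAlgebra R A.susp.carrier →ₗ[R] Q} (hφ : φ ∈ vanishing R A.susp.carrier _ n)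
    {x : TensorAlgebra R A.susp.carrier} (hx : x ∈ lenLE R A.susp.carrier n) :
    φ (A.m x) = φ (linD A.susp x) := by
  rw [← sub_eq_zero, ← map_sub]
  -- `m - linD` has neither constant nor linear part, so it strictly shortens words.
  refine (A.isCoder_m.sub (isCoder_linD A.susp)).apply_eq_zero (isCoalgHom_sgn _ _) .id
    (fun l hl => ?_) hφ hx
  have h := LinearMap.congr_fun (ιInv_linD A.susp) (word R l)
  rw [LinearMap.comp_apply, LinearMap.comp_apply] at h
  rw [LinearMap.sub_apply, map_sub, h]
  match l, hl with
  | [], _ => rw [word_nil, A.m_one, ιInv_one, map_zero, map_zero, sub_zero]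
  | [a], _ => rw [word_cons, word_nil, mul_one, A.m_comp_one, ιInv_ι, sub_self]

/-- The leading term of an `A∞`-morphism is the tensor power of its first component. -/
theorem Hom.apply_eq (f : Hom A C) {Q : Type*} [AddCommGroup Q] [Module R Q] {n : ℕ}
    {φ : TensorAlgebra R C.susp.carrier →ₗ[R] Q} (hφ : φ ∈ vanishing R C.susp.carrier _ n)
    {x : TensorAlgebra R A.susp.carrier} (hx : x ∈ lenLE R A.susp.carrier n) :
    φ (f.toFun x) = φ (tensorMap f.component_one x) := by
  rw [← sub_eq_zero, ← map_sub]
  refine (f.isCoalgHom.isCoder_sub (isCoalgHom_tensorMap f.component_one)).apply_eq_zero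
    f.isCoalgHom (isCoalgHom_tensorMap _) (fun l hl => ?_) hφ hx
  have h := LinearMap.congr_fun (ιInv_comp_tensorMap f.component_one) (word R l)
  rw [LinearMap.comp_apply, LinearMap.comp_apply] at h
  rw [LinearMap.sub_apply, map_sub, h]
  match l, hl with
  | [], _ => rw [word_nil, f.map_one, ιInv_one, ιInv_one, map_zero, sub_zero]
  | [a], _ =>
    rw [word_cons, word_nil, mul_one, ιInv_ι]
    exact sub_self _

theorem eq_ι_of_vanishing {f : Hom A C} {k : ℤ}
    {g : TensorAlgebra R A.susp.carrier →ₗ[R] TensorAlgebra R C.susp.carrier}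
    (hg : g ∈ coderAlong f.toFun k) {n : ℕ} (hn : g ∈ vanishing R A.susp.carrier _ n)
    {x : TensorAlgebra R A.susp.carrier} (hx : x ∈ lenLE R A.susp.carrier n) :
    g x = TensorAlgebra.ι R (TensorAlgebra.ιInv (g x)) :=
  hg.2.eq_ι_of_mem_lenLE (f.isCoalgHom.comp (isCoalgHom_sgn _ k)) f.isCoalgHom hn hx

theorem ιInv_comp_mem_vanishing {V W : Type*} [AddCommGroup V] [Module R V] [AddCommGroup W]
    [Module R W] {n : ℕ} {g : TensorAlgebra R V →ₗ[R] TensorAlgebra R W}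
    (hg : g ∈ vanishing R V _ n) : TensorAlgebra.ιInv ∘ₗ g ∈ vanishing R V _ n := fun l hl => by
  rw [LinearMap.comp_apply, hg l hl, map_zero]

/-- The leading term of the differential on coderivations. -/
theorem ιInv_alongD {f : Hom A C} {k j : ℤ}
    {g : TensorAlgebra R A.susp.carrier →ₗ[R] TensorAlgebra R C.susp.carrier}
    (hg : g ∈ coderAlong f.toFun k) {n : ℕ} (hn : g ∈ vanishing R A.susp.carrier _ n)
    {x : TensorAlgebra R A.susp.carrier} (hx : x ∈ lenLE R A.susp.carrier n) :
    TensorAlgebra.ιInv (alongD A C j g x) = TensorAlgebra.ιInv (g (linD A.susp x))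
      - (j.negOnePow : ℤ) • C.susp.d (TensorAlgebra.ιInv (g x)) := by
  have h := A.apply_m_eq (ιInv_comp_mem_vanishing hn) hx
  rw [LinearMap.comp_apply, LinearMap.comp_apply] at h
  simp only [alongD, LinearMap.sub_apply, LinearMap.comp_apply, LinearMap.smul_apply, map_sub,
    map_zsmul]
  -- On words of length at most `n`, `g` takes values in single letters, where `C.m` acts through
  -- the differential.
  rw [h, ← C.m_comp_one, ← eq_ι_of_vanishing hg hn hx]

/-- The coderivation along `f` with a given corestriction. -/
def Hom.lift (f : Hom A C) (k : ℤ) (φ : TensorAlgebra R A.susp.carrier →ₗ[R] C.susp.carrier) :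
    TensorAlgebra R A.susp.carrier →ₗ[R] TensorAlgebra R C.susp.carrier :=
  coext (f.toFun ∘ₗ sgn A.susp k) f.toFun φ

theorem Hom.lift_mem (f : Hom A C) {k : ℤ}
    {φ : TensorAlgebra R A.susp.carrier →ₗ[R] C.susp.carrier}
    (hφ : MapsGr (gr A.susp) C.susp.gr k φ) : f.lift k φ ∈ coderAlong f.toFun k :=
  coext_mem_coderAlong f.isCoalgHom f.mapsGr hφ

theorem Hom.ιInv_lift (f : Hom A C) (k : ℤ)
    (φ : TensorAlgebra R A.susp.carrier →ₗ[R] C.susp.carrier) (x : TensorAlgebra R A.susp.carrier) :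
    TensorAlgebra.ιInv (f.lift k φ x) = φ x :=
  LinearMap.congr_fun (ιInv_coext (f.isCoalgHom.comp (isCoalgHom_sgn _ k)) f.isCoalgHom φ) x

theorem Hom.lift_mem_vanishing (f : Hom A C) {k : ℤ}
    {φ : TensorAlgebra R A.susp.carrier →ₗ[R] C.susp.carrier}
    (hφ : MapsGr (gr A.susp) C.susp.gr k φ) {n : ℕ} (hn : φ ∈ vanishing R A.susp.carrier _ n) :
    f.lift k φ ∈ vanishing R A.susp.carrier _ n :=
  mem_vanishing_of_ιInv (f.lift_mem hφ) fun l hl => by rw [f.ιInv_lift, hn l hl]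

/-- A map of degree `0` from the Hochschild complex of `P` to the coderivations along `f`, given by
a linear map which respects the filtrations by length and whose cone is acyclic on the associated
graded. -/
structure IsLeadingAcyclic (f : Hom A C)
    (Φ : (TensorAlgebra R P.susp.carrier →ₗ[R] TensorAlgebra R P.susp.carrier) →ₗ[R]
      TensorAlgebra R A.susp.carrier →ₗ[R] TensorAlgebra R C.susp.carrier) : Prop where
  map_mem : ∀ k, ∀ g ∈ coderAlong (Hom.id P).toFun k, Φ g ∈ coderAlong f.toFun k
  map_alongD : ∀ k g, Φ (alongD P P k g) = alongD A C k (Φ g)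
  map_vanishing : ∀ n, ∀ g ∈ vanishing R P.susp.carrier (TensorAlgebra R P.susp.carrier) n,
    Φ g ∈ vanishing R A.susp.carrier (TensorAlgebra R C.susp.carrier) n
  step : ∀ (k : ℤ) (n : ℕ), ∀ x ∈ coderAlong (Hom.id P).toFun (k - 1),
    ∀ y ∈ coderAlong f.toFun k,
    x ∈ vanishing R P.susp.carrier (TensorAlgebra R P.susp.carrier) n →
    y ∈ vanishing R A.susp.carrier (TensorAlgebra R C.susp.carrier) n →
    alongD P P (k - 1) x = 0 → Φ x = alongD A C k y →
    ∃ x' ∈ coderAlong (Hom.id P).toFun k, ∃ y' ∈ coderAlong f.toFun (k + 1),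
      x' ∈ vanishing R P.susp.carrier (TensorAlgebra R P.susp.carrier) n ∧
      y' ∈ vanishing R A.susp.carrier (TensorAlgebra R C.susp.carrier) n ∧
      x - alongD P P k x' ∈ vanishing R P.susp.carrier (TensorAlgebra R P.susp.carrier) (n + 1) ∧
      y - (Φ x' + alongD A C (k + 1) y')
        ∈ vanishing R A.susp.carrier (TensorAlgebra R C.susp.carrier) (n + 1)

end AInfAlgebra

end

/-! ### Acyclicity of the two comparison maps -/

noncomputable section

open TensorCoalg

namespace AInfAlgebra

variable {R : Type u} [CommRing R] {𝒜 : ℤ → AddSubgroup R} [GradedRing 𝒜] [IsEvenlyGraded 𝒜]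
  {A C P : AInfAlgebra.{u, v} 𝒜}

/-- The differential on coderivations as an additive map. -/
def alongDHom (A C : AInfAlgebra.{u, v} 𝒜) (k : ℤ) :
    (TensorAlgebra R A.susp.carrier →ₗ[R] TensorAlgebra R C.susp.carrier) →+
      TensorAlgebra R A.susp.carrier →ₗ[R] TensorAlgebra R C.susp.carrier where
  toFun := alongD A C k
  map_zero' := by simp [alongD]
  map_add' g g' := by
    simp only [alongD, LinearMap.add_comp, LinearMap.comp_add, smul_add]
    abel

theorem exists_sum_prod {f : Hom A C} {p : Hom P P} {k l : ℤ}
    (u : ℕ → coderAlong p.toFun k × coderAlong f.toFun l)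
    (h1 : ∀ n, (u n).1.1 ∈ vanishing R P.susp.carrier (TensorAlgebra R P.susp.carrier) n)
    (h2 : ∀ n, (u n).2.1 ∈ vanishing R A.susp.carrier (TensorAlgebra R C.susp.carrier) n) :
    ∃ U : coderAlong p.toFun k × coderAlong f.toFun l, ∀ n,
      (U - ∑ i ∈ Finset.range n, u i).1.1
          ∈ vanishing R P.susp.carrier (TensorAlgebra R P.susp.carrier) n ∧
        (U - ∑ i ∈ Finset.range n, u i).2.1
          ∈ vanishing R A.susp.carrier (TensorAlgebra R C.susp.carrier) n := by
  obtain ⟨U₁, hU₁⟩ := exists_sum_coderAlong p.isCoalgHom p.mapsGr (fun n => (u n).1) h1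
  obtain ⟨U₂, hU₂⟩ := exists_sum_coderAlong f.isCoalgHom f.mapsGr (fun n => (u n).2) h2
  refine ⟨(U₁, U₂), fun n => ⟨?_, ?_⟩⟩
  · have := hU₁ n
    rwa [Prod.fst_sub, Prod.fst_sum]
  · have := hU₂ n
    rwa [Prod.snd_sub, Prod.snd_sum]

/-- This is `exists_eq_of_filtration` for the differential of the cone of `Φ`: leading-order
solvability and completeness give an exact solution. -/
theorem IsLeadingAcyclic.exists_lift {f : Hom A C}
    {Φ : (TensorAlgebra R P.susp.carrier →ₗ[R] TensorAlgebra R P.susp.carrier) →ₗ[R]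
      TensorAlgebra R A.susp.carrier →ₗ[R] TensorAlgebra R C.susp.carrier}
    (h : IsLeadingAcyclic f Φ) {k : ℤ}
    {x : TensorAlgebra R P.susp.carrier →ₗ[R] TensorAlgebra R P.susp.carrier}
    (hx : x ∈ coderAlong (Hom.id P).toFun (k - 1))
    {y : TensorAlgebra R A.susp.carrier →ₗ[R] TensorAlgebra R C.susp.carrier}
    (hy : y ∈ coderAlong f.toFun k) (hdx : alongD P P (k - 1) x = 0)
    (hxy : Φ x = alongD A C k y) :
    ∃ x' ∈ coderAlong (Hom.id P).toFun k, ∃ y' ∈ coderAlong f.toFun (k + 1),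
      alongD P P k x' = x ∧ y = Φ x' + alongD A C (k + 1) y' := by
  let B := coderAlong (Hom.id P).toFun k × coderAlong f.toFun (k + 1)
  let E₁ := TensorAlgebra R P.susp.carrier →ₗ[R] TensorAlgebra R P.susp.carrier
  let E₂ := TensorAlgebra R A.susp.carrier →ₗ[R] TensorAlgebra R C.susp.carrier
  let p₁ : B →+ E₁ := (AddSubgroup.subtype _).comp (AddMonoidHom.fst _ _)
  let p₂ : B →+ E₂ := (AddSubgroup.subtype _).comp (AddMonoidHom.snd _ _)
  let D : B →+ E₁ × E₂ := ((alongDHom P P k).comp p₁).prod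
    (Φ.toAddMonoidHom.comp p₁ + (alongDHom A C (k + 1)).comp p₂)
  let FE (n : ℕ) : AddSubgroup (E₁ × E₂) :=
    (vanishing R P.susp.carrier (TensorAlgebra R P.susp.carrier) n).prod
      (vanishing R A.susp.carrier (TensorAlgebra R C.susp.carrier) n)
  let FB (n : ℕ) : AddSubgroup B := (FE n).comap (p₁.prod p₂)
  -- The cycles of the cone in the right degree. Remaining in `Z` keeps every remainder within reach
  -- of `h.step`.
  let Z : AddSubgroup (E₁ × E₂) :=
    (coderAlong (Hom.id P).toFun (k - 1)).prod (coderAlong f.toFun k) ⊓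
      (((alongDHom P P (k - 1)).comp (AddMonoidHom.fst _ _)).ker ⊓
        (Φ.toAddMonoidHom.comp (AddMonoidHom.fst _ _)
          - (alongDHom A C k).comp (AddMonoidHom.snd _ _)).ker)
  have hZ : ∀ z : E₁ × E₂, z ∈ Z ↔ (z.1 ∈ coderAlong (Hom.id P).toFun (k - 1)
      ∧ z.2 ∈ coderAlong f.toFun k) ∧ alongD P P (k - 1) z.1 = 0 ∧ Φ z.1 = alongD A C k z.2 :=
    fun z => and_congr Iff.rfl (and_congr Iff.rfl sub_eq_zero)
  have hDZ : ∀ b, D b ∈ Z := by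
    rintro ⟨⟨x', hx'⟩, ⟨y', hy'⟩⟩
    have e := alongD_alongD (k + 1) y'
    have e' := alongD_mem f hy'
    rw [add_sub_cancel_right] at e e'
    refine (hZ _).2 ⟨⟨alongD_mem _ hx', add_mem (h.map_mem k x' hx') e'⟩, alongD_alongD k x', ?_⟩
    change Φ (alongD P P k x') = alongDHom A C k (Φ x' + alongD A C (k + 1) y')
    rw [map_add, h.map_alongD]
    change _ = _ + alongD A C k _
    rw [e, add_zero]
    rfl
  obtain ⟨⟨⟨x', hx'⟩, ⟨y', hy'⟩⟩, hb⟩ := exists_eq_of_filtration D Z FB FE hDZ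
    (fun n b hb => ⟨alongD_mem_vanishing hb.1,
      add_mem (h.map_vanishing n _ hb.1) (alongD_mem_vanishing hb.2)⟩)
    (fun z => ⟨fun _ hl => absurd hl (Nat.not_lt_zero _), fun _ hl => absurd hl (Nat.not_lt_zero _)⟩)
    (by
      rintro n ⟨x, y⟩ hz hn
      obtain ⟨⟨hx, hy⟩, hdx, hxy⟩ := (hZ _).1 hz
      obtain ⟨x', hx', y', hy', v1, v2, v3, v4⟩ := h.step k n x hx y hy hn.1 hn.2 hdx hxy
      exact ⟨(⟨x', hx'⟩, ⟨y', hy'⟩), ⟨v1, v2⟩, ⟨v3, v4⟩⟩)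
    (fun u hu => exists_sum_prod u (fun n => (hu n).1) fun n => (hu n).2)
    (by
      rintro ⟨x, y⟩ hz
      refine Prod.ext (linearMap_ext_word fun l => ?_) (linearMap_ext_word fun l => ?_)
      · exact (hz (l.length + 1)).1 l (Nat.lt_succ_self _)
      · exact (hz (l.length + 1)).2 l (Nat.lt_succ_self _))
    ((hZ (x, y)).2 ⟨⟨hx, hy⟩, hdx, hxy⟩)
  exact ⟨x', hx', y', hy', congrArg Prod.fst hb, (congrArg Prod.snd hb).symm⟩

theorem comp_mem_vanishing {V W U : Type*} [AddCommGroup V] [Module R V] [AddCommGroup W]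
    [Module R W] [AddCommGroup U] [Module R U] {n : ℕ} {g : TensorAlgebra R V →ₗ[R] W}
    (hg : g ∈ vanishing R V W n) (u : W →ₗ[R] U) : u ∘ₗ g ∈ vanishing R V U n := fun l hl => by
  rw [LinearMap.comp_apply, hg l hl, map_zero]

theorem vanishing_comp_mem {V W U : Type*} [AddCommGroup V] [Module R V] [AddCommGroup W]
    [Module R W] [AddCommGroup U] [Module R U] {n : ℕ} {g : TensorAlgebra R V →ₗ[R] W}
    (hg : g ∈ vanishing R V W n) {u : TensorAlgebra R U →ₗ[R] TensorAlgebra R V}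
    (hu : ∀ n, ∀ x ∈ lenLE R U n, u x ∈ lenLE R V n) : g ∘ₗ u ∈ vanishing R U W n := fun l hl =>
  apply_eq_zero_of_mem_lenLE hg (hu _ _ (word_mem_lenLE le_rfl)) hl

/-- The corestriction of a cycle is, to leading order, a chain map. -/
theorem ιInv_linD_of_cycle {k : ℤ}
    {x : TensorAlgebra R P.susp.carrier →ₗ[R] TensorAlgebra R P.susp.carrier}
    (hx : x ∈ coderAlong (Hom.id P).toFun (k - 1)) {n : ℕ}
    (hn : x ∈ vanishing R P.susp.carrier (TensorAlgebra R P.susp.carrier) n)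
    (hdx : alongD P P (k - 1) x = 0) {w : TensorAlgebra R P.susp.carrier}
    (hw : w ∈ lenLE R P.susp.carrier n) :
    TensorAlgebra.ιInv (x (linD P.susp w))
      = -((k.negOnePow : ℤ) • P.susp.d (TensorAlgebra.ιInv (x w))) := by
  have e := ιInv_alongD (j := k - 1) hx hn hw
  rw [hdx, LinearMap.zero_apply, map_zero, coe_negOnePow_sub_one, neg_smul, sub_neg_eq_add] at e
  exact eq_neg_of_add_eq_zero_left e.symm

/-- The leading-order lifting problem may be solved on corestrictions. -/
theorem exists_step_of_corestriction {f : Hom A C}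
    {Φ : (TensorAlgebra R P.susp.carrier →ₗ[R] TensorAlgebra R P.susp.carrier) →ₗ[R]
      TensorAlgebra R A.susp.carrier →ₗ[R] TensorAlgebra R C.susp.carrier}
    (hΦ : ∀ k, ∀ g ∈ coderAlong (Hom.id P).toFun k, Φ g ∈ coderAlong f.toFun k)
    {k : ℤ} {n : ℕ}
    {x : TensorAlgebra R P.susp.carrier →ₗ[R] TensorAlgebra R P.susp.carrier}
    (hx : x ∈ coderAlong (Hom.id P).toFun (k - 1))
    {y : TensorAlgebra R A.susp.carrier →ₗ[R] TensorAlgebra R C.susp.carrier}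
    (hy : y ∈ coderAlong f.toFun k)
    {ξ : TensorAlgebra R P.susp.carrier →ₗ[R] P.susp.carrier}
    {η : TensorAlgebra R A.susp.carrier →ₗ[R] C.susp.carrier}
    (gξ : MapsGr (gr P.susp) P.susp.gr k ξ) (gη : MapsGr (gr A.susp) C.susp.gr (k + 1) η)
    (vξ : ξ ∈ vanishing R P.susp.carrier _ n) (vη : η ∈ vanishing R A.susp.carrier _ n)
    (h1 : ∀ w ∈ lenLE R P.susp.carrier n, ξ (linD P.susp w)
      - (k.negOnePow : ℤ) • P.susp.d (ξ w) = TensorAlgebra.ιInv (x w))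
    (h2 : ∀ w ∈ lenLE R A.susp.carrier n,
      TensorAlgebra.ιInv (Φ ((Hom.id P).lift k ξ) w)
        + (η (linD A.susp w) + (k.negOnePow : ℤ) • C.susp.d (η w))
        = TensorAlgebra.ιInv (y w)) :
    ∃ x' ∈ coderAlong (Hom.id P).toFun k, ∃ y' ∈ coderAlong f.toFun (k + 1),
      x' ∈ vanishing R P.susp.carrier (TensorAlgebra R P.susp.carrier) n ∧
      y' ∈ vanishing R A.susp.carrier (TensorAlgebra R C.susp.carrier) n ∧
      x - alongD P P k x' ∈ vanishing R P.susp.carrier (TensorAlgebra R P.susp.carrier) (n + 1) ∧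
      y - (Φ x' + alongD A C (k + 1) y')
        ∈ vanishing R A.susp.carrier (TensorAlgebra R C.susp.carrier) (n + 1) := by
  have mx := (Hom.id P).lift_mem gξ
  have my := f.lift_mem gη
  have vx := (Hom.id P).lift_mem_vanishing gξ vξ
  have vy := f.lift_mem_vanishing gη vη
  have e' := alongD_mem f my
  rw [add_sub_cancel_right] at e'
  refine ⟨_, mx, _, my, vx, vy, ?_, ?_⟩
  · refine mem_vanishing_of_ιInv (sub_mem hx (alongD_mem _ mx)) fun l hl => ?_
    have hw : word R l ∈ lenLE R P.susp.carrier n := word_mem_lenLE (by omega)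
    rw [LinearMap.sub_apply, map_sub, ιInv_alongD mx vx hw, Hom.ιInv_lift, Hom.ιInv_lift, h1 _ hw,
      sub_self]
  · refine mem_vanishing_of_ιInv (sub_mem hy (add_mem (hΦ k _ mx) e')) fun l hl => ?_
    have hw : word R l ∈ lenLE R A.susp.carrier n := word_mem_lenLE (by omega)
    rw [LinearMap.sub_apply, LinearMap.add_apply, map_sub, map_add, ιInv_alongD my vy hw,
      Hom.ιInv_lift, Hom.ιInv_lift, coe_negOnePow_add_one, neg_smul, sub_neg_eq_add, h2 _ hw,
      sub_self]

theorem ιInv_mapsGr {f : Hom A C} {k : ℤ}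
    {g : TensorAlgebra R A.susp.carrier →ₗ[R] TensorAlgebra R C.susp.carrier}
    (hg : g ∈ coderAlong f.toFun k) :
    MapsGr (gr A.susp) C.susp.gr k (TensorAlgebra.ιInv ∘ₗ g) :=
  (mapsGr_ιInv C.susp).comp hg.1 (zero_add k).symm

/-- Composition with a weak equivalence is acyclic to leading order. -/
theorem isLeadingAcyclic_postcomp {f : Hom A C} (hf : f.IsWeakEquivalence) :
    IsLeadingAcyclic (P := A) f (LinearMap.llcomp R _ _ _ f.toFun) := by
  have hΦ : ∀ k, ∀ g ∈ coderAlong (Hom.id A).toFun k,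
      LinearMap.llcomp R _ _ _ f.toFun g ∈ coderAlong f.toFun k := fun k g hg => by
    have := hg.2.coalgHom_comp f.isCoalgHom
    exact ⟨f.mapsGr.comp hg.1 (zero_add k).symm, this⟩
  refine ⟨hΦ, fun k g => ?_, fun n g hg => comp_mem_vanishing hg f.toFun, ?_⟩
  · change f.toFun ∘ₗ alongD A A k g = alongD A C k (f.toFun ∘ₗ g)
    simp only [alongD, LinearMap.comp_sub, LinearMap.comp_smul, ← LinearMap.comp_assoc, f.map_m]
  · intro k n x hx y hy vx vy hdx hxy
    obtain ⟨g, hg, hq⟩ := hf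
    obtain ⟨s, h, t, gh, gt, hh, ht⟩ := hq.exists_inverse A.isCell.susp C.isCell.susp
    -- On short words `x w` is a single letter, so `f` acts on it through its first component.
    have hfx : ∀ (j : ℤ) (x : TensorAlgebra R A.susp.carrier →ₗ[R] TensorAlgebra R A.susp.carrier),
        x ∈ coderAlong (Hom.id A).toFun j →
        x ∈ vanishing R A.susp.carrier (TensorAlgebra R A.susp.carrier) n →
        ∀ w ∈ lenLE R A.susp.carrier n, TensorAlgebra.ιInv (f.toFun (x w))
          = g.toFun (TensorAlgebra.ιInv (x w)) := by
      intro j x hx vx w hw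
      rw [eq_ι_of_vanishing hx vx hw, ιInv_ι, hg]
      rfl
    have gx := ιInv_mapsGr hx
    have gy := ιInv_mapsGr hy
    have vx' := ιInv_comp_mem_vanishing vx
    have vy' := ιInv_comp_mem_vanishing vy
    obtain ⟨r1, r2⟩ := exists_postcomp_lift (W₀ := lenLE R A.susp.carrier n) (D := linD A.susp)
      (f := g.toFun) (g := s.toFun) (h := h) (k := t) k.negOnePow g.map_d s.map_d hh ht
      (ξ := TensorAlgebra.ιInv ∘ₗ x) (η := TensorAlgebra.ιInv ∘ₗ y)
      (fun w hw => ιInv_linD_of_cycle hx vx hdx hw)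
      (fun w hw => by
        have e := ιInv_alongD (j := k) hy vy hw
        rw [← hxy] at e
        exact (hfx _ x hx vx w hw).symm.trans e) rfl rfl rfl rfl
    -- Degree and filtration of `ξ₀`, `η₁`, `ξ'`, `η'`, in this order.
    have g0 := (s.mapsGr.comp gy (zero_add k).symm).add
      ((gt.comp gx (by ring : k = 1 + (k - 1))).zsmul (k.negOnePow : ℤ))
    have v0 := add_mem (comp_mem_vanishing vy' s.toFun)
      (zsmul_mem (comp_mem_vanishing vx' t) (k.negOnePow : ℤ))
    have g1 := gy.sub (g.mapsGr.comp g0 (zero_add k).symm)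
    have v1 := sub_mem vy' (comp_mem_vanishing v0 g.toFun)
    have g2 := g0.add (s.mapsGr.comp g1 (zero_add k).symm)
    have v2 := add_mem v0 (comp_mem_vanishing v1 s.toFun)
    have g3 := ((gh.comp g1 (add_comm k 1)).zsmul (k.negOnePow : ℤ)).neg
    have v3 := neg_mem (zsmul_mem (comp_mem_vanishing v1 h) (k.negOnePow : ℤ))
    refine exists_step_of_corestriction hΦ hx hy g2 g3 v2 v3 r1 fun w hw => ?_
    refine Eq.trans (congrArg (· + _) ?_) (r2 w hw)
    exact (hfx k _ ((Hom.id A).lift_mem g2) ((Hom.id A).lift_mem_vanishing g2 v2) w hw).trans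
      (congrArg g.toFun (Hom.ιInv_lift _ _ _ _))

/-- Precomposition with a weak equivalence is acyclic to leading order. -/
theorem isLeadingAcyclic_precomp {f : Hom A C} (hf : f.IsWeakEquivalence) :
    IsLeadingAcyclic (P := C) f (LinearMap.lcomp R _ f.toFun) := by
  have hΦ : ∀ k, ∀ g ∈ coderAlong (Hom.id C).toFun k,
      LinearMap.lcomp R _ f.toFun g ∈ coderAlong f.toFun k := fun k g hg => by
    have := hg.2.comp_coalgHom f.isCoalgHom
    rw [LinearMap.comp_assoc, sgn_comp_of_mapsGr_zero f.mapsGr] at this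
    exact ⟨hg.1.comp f.mapsGr (add_zero k).symm, this⟩
  have mf : ∀ n, ∀ x ∈ lenLE R A.susp.carrier n, f.toFun x ∈ lenLE R C.susp.carrier n :=
    fun n x hx => f.isCoalgHom.map_mem hx
  refine ⟨hΦ, fun k g => ?_, fun n g hg => vanishing_comp_mem hg mf, ?_⟩
  · change alongD C C k g ∘ₗ f.toFun = alongD A C k (g ∘ₗ f.toFun)
    simp only [alongD, LinearMap.sub_comp, LinearMap.smul_comp, LinearMap.comp_assoc, f.map_m]
  · intro k n x hx y hy vx vy hdx hxy
    obtain ⟨g, hg, hq⟩ := hf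
    obtain ⟨s, h, t, gh, gt, hh, ht⟩ := hq.exists_inverse A.isCell.susp C.isCell.susp
    have dg : g.toFun ∘ₗ A.susp.d = C.susp.d ∘ₗ g.toFun := LinearMap.ext g.map_d
    have ds : s.toFun ∘ₗ C.susp.d = A.susp.d ∘ₗ s.toFun := LinearMap.ext s.map_d
    -- Precomposition involves all tensor powers of the first component, so the homotopies must be
    -- extended to the tensor coalgebras, preserving length.
    obtain ⟨H, gH, mH, hH⟩ := exists_tensor_homotopy (e := g.toFun ∘ₗ s.toFun)
      (g.mapsGr.comp s.mapsGr (add_zero 0).symm)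
      (by rw [LinearMap.comp_assoc, ds, ← LinearMap.comp_assoc, dg, LinearMap.comp_assoc]) gh hh
    obtain ⟨K, gK, mK, hK⟩ := exists_tensor_homotopy (e := s.toFun ∘ₗ g.toFun)
      (s.mapsGr.comp g.mapsGr (add_zero 0).symm)
      (by rw [LinearMap.comp_assoc, dg, ← LinearMap.comp_assoc, ds, LinearMap.comp_assoc]) gt ht
    rw [tensorMap_comp] at hH hK
    have mF : ∀ n, ∀ x ∈ lenLE R A.susp.carrier n, tensorMap g.toFun x ∈ lenLE R C.susp.carrier n :=
      fun n x hx => (isCoalgHom_tensorMap _).map_mem hx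
    have mS : ∀ n, ∀ x ∈ lenLE R C.susp.carrier n, tensorMap s.toFun x ∈ lenLE R A.susp.carrier n :=
      fun n x hx => (isCoalgHom_tensorMap _).map_mem hx
    -- As `x` kills words shorter than `n`, it sees only the length-preserving part of `f`.
    have hfx : ∀ (x : TensorAlgebra R C.susp.carrier →ₗ[R] TensorAlgebra R C.susp.carrier),
        x ∈ vanishing R C.susp.carrier (TensorAlgebra R C.susp.carrier) n →
        ∀ w ∈ lenLE R A.susp.carrier n, TensorAlgebra.ιInv (x (f.toFun w))
          = TensorAlgebra.ιInv (x (tensorMap g.toFun w)) := by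
      intro x vx w hw
      rw [hg]
      exact f.apply_eq (ιInv_comp_mem_vanishing vx) hw
    have gx := ιInv_mapsGr hx
    have gy := ιInv_mapsGr hy
    have vx' := ιInv_comp_mem_vanishing vx
    have vy' := ιInv_comp_mem_vanishing vy
    have gF := mapsGr_tensorMap g.mapsGr
    have gS := mapsGr_tensorMap s.mapsGr
    obtain ⟨r1, r2⟩ := exists_precomp_lift (P₀ := lenLE R A.susp.carrier n)
      (Q₀ := lenLE R C.susp.carrier n) (DP := linD A.susp) (DQ := linD C.susp)
      (F := tensorMap g.toFun) (S := tensorMap s.toFun) (H := H) (K := K) (d := C.susp.d)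
      k.negOnePow (LinearMap.congr_fun (tensorMap_comp_linD g.mapsGr dg))
      (LinearMap.congr_fun (tensorMap_comp_linD s.mapsGr ds)) hH hK (mF n) (mS n) (mH n) (mK n)
      (ξ := TensorAlgebra.ιInv ∘ₗ x) (η := TensorAlgebra.ιInv ∘ₗ y)
      (fun w hw => ιInv_linD_of_cycle hx vx hdx hw)
      (fun w hw => by
        have e := ιInv_alongD (j := k) hy vy hw
        rw [← hxy] at e
        exact (hfx x vx w hw).symm.trans e) rfl rfl rfl rfl
    have g0 := (gy.comp gS (add_zero k).symm).sub (gx.comp gH (by ring : k = k - 1 + 1))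
    have v0 := sub_mem (vanishing_comp_mem vy' mS) (vanishing_comp_mem vx' mH)
    have g1 := gy.sub (g0.comp gF (add_zero k).symm)
    have v1 := sub_mem vy' (vanishing_comp_mem v0 mF)
    have g2 := g0.add (g1.comp gS (add_zero k).symm)
    have v2 := add_mem v0 (vanishing_comp_mem v1 mS)
    have g3 := (g1.comp gK (rfl : k + 1 = k + 1)).neg
    have v3 := neg_mem (vanishing_comp_mem v1 mK)
    refine exists_step_of_corestriction hΦ hx hy g2 g3 v2 v3 r1 fun w hw => ?_
    refine Eq.trans (congrArg (· + _) ?_) (r2 w hw)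
    exact (hfx _ ((Hom.id C).lift_mem_vanishing g2 v2) w hw).trans (Hom.ιInv_lift _ _ _ _)

end AInfAlgebra

end

/-! ### Assembling the degrees into complexes and quasi-isomorphisms -/

noncomputable section

open TensorCoalg

section GradedSumMap

variable {R : Type u} [CommRing R] (𝒜 : ℤ → AddSubgroup R) [GradedRing 𝒜]
  {E : Type*} [AddCommGroup E] [Module R E] (C : ℤ → AddSubgroup E) [SetLike.GradedSMul 𝒜 C]
  {E' : Type*} [AddCommGroup E'] [Module R E'] (C' : ℤ → AddSubgroup E') [SetLike.GradedSMul 𝒜 C']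

/-- The additive map of direct sums induced by a linear map that preserves the gradings. -/
def gradedSumMap (Φ : E →ₗ[R] E') (hΦ : ∀ k, ∀ g ∈ C k, Φ g ∈ C' k) :
    (⨁ k, C k) →+ ⨁ k, C' k :=
  DirectSum.map fun k => (Φ.toAddMonoidHom.comp (C k).subtype).codRestrict (C' k)
    fun g => hΦ k g.1 g.2

theorem gradedSumMap_of (Φ : E →ₗ[R] E') (hΦ : ∀ k, ∀ g ∈ C k, Φ g ∈ C' k) (k : ℤ) (g : C k) :
    gradedSumMap C C' Φ hΦ (DirectSum.of (fun k => C k) k g)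
      = DirectSum.of (fun k => C' k) k ⟨Φ g.1, hΦ k g.1 g.2⟩ :=
  DirectSum.map_of _ _ _

theorem gradedSumMap_smul (Φ : E →ₗ[R] E') (hΦ : ∀ k, ∀ g ∈ C k, Φ g ∈ C' k) (r : R)
    (x : ⨁ k, C k) :
    letI := GradedModule.isModule 𝒜 C
    letI := GradedModule.isModule 𝒜 C'
    gradedSumMap C C' Φ hΦ (r • x) = r • gradedSumMap C C' Φ hΦ x := by
  let _ := GradedModule.isModule 𝒜 C
  let _ := GradedModule.isModule 𝒜 C'
  change gradedSumMap C C' Φ hΦ (r • x) = r • gradedSumMap C C' Φ hΦ x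
  induction r using DirectSum.Decomposition.inductionOn 𝒜 with
  | zero => rw [zero_smul, zero_smul, map_zero]
  | add r r' hr hr' => rw [add_smul, map_add, hr, hr', add_smul]
  | @homogeneous i r =>
    induction x using DirectSum.induction_on with
    | zero => rw [smul_zero, map_zero, smul_zero]
    | add x y hx hy => rw [smul_add, map_add, hx, hy, map_add, smul_add]
    | of k g =>
      have h1 := gradedSum_of_smul 𝒜 C r.2 g
      have h2 := gradedSum_of_smul 𝒜 C' r.2 ⟨Φ g.1, hΦ k g.1 g.2⟩
      refine (congrArg _ h1).trans ((gradedSumMap_of C C' Φ hΦ _ _).trans ?_)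
      refine Eq.trans ?_ (h2.symm.trans (congrArg _ (gradedSumMap_of C C' Φ hΦ k g).symm))
      exact gradedSum_of_congr C' rfl (map_smul Φ (r : R) g.1)

end GradedSumMap

namespace AInfAlgebra

variable {R : Type u} [CommRing R] {𝒜 : ℤ → AddSubgroup R} [GradedRing 𝒜] [IsEvenlyGraded 𝒜]
  {A C P : AInfAlgebra.{u, v} 𝒜}

/-- The differential on the direct sum of the groups of coderivations along `f`. -/
def Hom.addD (f : Hom A C) :
    (⨁ k, coderAlong f.toFun k) →+ ⨁ k, coderAlong f.toFun k :=
  DirectSum.toAddMonoid fun k =>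
    (DirectSum.of (fun k => coderAlong f.toFun k) (k - 1)).comp (f.degD k)

theorem Hom.addD_of (f : Hom A C) (k : ℤ) (g : coderAlong f.toFun k) :
    f.addD (DirectSum.of (fun k => coderAlong f.toFun k) k g)
      = DirectSum.of (fun k => coderAlong f.toFun k) (k - 1) (f.degD k g) :=
  DirectSum.toAddMonoid_of _ _ _

theorem Hom.addD_smul (f : Hom A C) (r : R) (x : ⨁ k, coderAlong f.toFun k) :
    letI := GradedModule.isModule 𝒜 (coderAlong f.toFun)
    f.addD (r • x) = r • f.addD x := by
  refine gradedSum_map_smul 𝒜 (coderAlong f.toFun) f.addD ?_ r x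
  intro i j r g hr
  have h1 := gradedSum_of_smul 𝒜 (coderAlong f.toFun) hr g
  have h2 := gradedSum_of_smul 𝒜 (coderAlong f.toFun) hr (f.degD j g)
  refine (congrArg f.addD h1).trans ((f.addD_of _ _).trans
    (Eq.trans ?_ (h2.symm.trans (congrArg _ (f.addD_of j g).symm))))
  refine gradedSum_of_congr _ (add_sub_assoc i j 1) ?_
  change alongD A C (i + j) (r • g.1) = r • alongD A C j g.1
  rcases DGModule.even_or_eq_zero hr with h | h
  · simp only [alongD, Int.negOnePow_add, Int.negOnePow_even _ h, one_mul, LinearMap.smul_comp,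
      LinearMap.comp_smul, smul_sub]
    rw [smul_comm r]
  · simp [h, alongD]

theorem Hom.addD_addD (f : Hom A C) (x : ⨁ k, coderAlong f.toFun k) : f.addD (f.addD x) = 0 := by
  induction x using DirectSum.induction_on with
  | zero => rw [map_zero, map_zero]
  | add x y h h' => rw [map_add, map_add, h, h', add_zero]
  | of k g =>
    rw [addD_of, addD_of]
    have h : f.degD (k - 1) (f.degD k g) = 0 := Subtype.ext (alongD_alongD k g.1)
    rw [h, map_zero]

/-- The complex of coderivations along an `A∞`-morphism. -/
def Hom.complex (f : Hom A C) : DGModule.{u, max u v} 𝒜 where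
  carrier := ⨁ k, coderAlong f.toFun k
  module := GradedModule.isModule 𝒜 (coderAlong f.toFun)
  gr k := (DirectSum.of (fun k => coderAlong f.toFun k) k).range
  isInternal := isInternal_range_of _
  smul_mem := by
    rintro i j r _ hr ⟨g, rfl⟩
    exact ⟨_, (gradedSum_of_smul 𝒜 (coderAlong f.toFun) hr g).symm⟩
  d :=
    letI := GradedModule.isModule 𝒜 (coderAlong f.toFun)
    { f.addD with map_smul' := f.addD_smul }
  d_mem := by
    rintro n _ ⟨g, rfl⟩
    exact ⟨f.degD n g, (f.addD_of n g).symm⟩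
  d_d := f.addD_addD

theorem comm_eq_alongD (k : ℤ)
    (g : TensorAlgebra R P.susp.carrier →ₗ[R] TensorAlgebra R P.susp.carrier) :
    TensorCoalg.comm k (-1) g P.m = alongD P P k g := by
  rw [TensorCoalg.comm, alongD, mul_neg_one, Int.negOnePow_neg]

/-- `coder` agrees definitionally with `coderAlong` of the identity. -/
theorem IsLeadingAcyclic.map_coder {f : Hom A C}
    {Φ : (TensorAlgebra R P.susp.carrier →ₗ[R] TensorAlgebra R P.susp.carrier) →ₗ[R]
      TensorAlgebra R A.susp.carrier →ₗ[R] TensorAlgebra R C.susp.carrier}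
    (h : IsLeadingAcyclic f Φ) : ∀ k, ∀ g ∈ coder P.susp k, Φ g ∈ coderAlong f.toFun k :=
  h.map_mem

/-- The map from the Hochschild complex to a complex of coderivations along a morphism. -/
def IsLeadingAcyclic.hom {f : Hom A C}
    {Φ : (TensorAlgebra R P.susp.carrier →ₗ[R] TensorAlgebra R P.susp.carrier) →ₗ[R]
      TensorAlgebra R A.susp.carrier →ₗ[R] TensorAlgebra R C.susp.carrier}
    (h : IsLeadingAcyclic f Φ) : DGModule.Hom P.hochschild f.complex where
  toFun :=
    letI := GradedModule.isModule 𝒜 (coder P.susp)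
    letI := GradedModule.isModule 𝒜 (coderAlong f.toFun)
    { gradedSumMap (coder P.susp) (coderAlong f.toFun) Φ h.map_coder with
      map_smul' := gradedSumMap_smul 𝒜 (coder P.susp) (coderAlong f.toFun) Φ h.map_coder }
  map_gr := by
    rintro n _ ⟨g, rfl⟩
    exact ⟨_, (gradedSumMap_of _ _ Φ h.map_coder n g).symm⟩
  map_d x := by
    change gradedSumMap (coder P.susp) (coderAlong f.toFun) Φ h.map_coder (P.hochschildAddD x)
      = f.addD (gradedSumMap (coder P.susp) (coderAlong f.toFun) Φ h.map_coder x)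
    induction x using DirectSum.induction_on with
    | zero => simp only [map_zero]
    | add x y hx hy => simp only [map_add, hx, hy]
    | of k g =>
      refine (congrArg _ (P.hochschildAddD_of k g)).trans ((gradedSumMap_of _ _ Φ _ _ _).trans
        (Eq.trans (gradedSum_of_congr _ rfl ?_) ((congrArg f.addD
          (gradedSumMap_of _ _ Φ h.map_coder k g)).trans (f.addD_of _ _)).symm))
      exact (congrArg Φ (comm_eq_alongD k g.1)).trans (h.map_alongD k g.1)

/-- A homogeneous element of either direct sum is a single coderivation, so acyclicity of the cone
is exactly `IsLeadingAcyclic.exists_lift`, one degree at a time. -/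
theorem IsLeadingAcyclic.isQuasiIso_hom {f : Hom A C}
    {Φ : (TensorAlgebra R P.susp.carrier →ₗ[R] TensorAlgebra R P.susp.carrier) →ₗ[R]
      TensorAlgebra R A.susp.carrier →ₗ[R] TensorAlgebra R C.susp.carrier}
    (h : IsLeadingAcyclic f Φ) : h.hom.IsQuasiIso := by
  refine DGModule.Hom.isQuasiIso_of_exists_lift ?_
  rintro n _ _ ⟨x, rfl⟩ hdx ⟨y, rfl⟩ hxy
  have hdx' := (P.hochschildAddD_of (n - 1) x).symm.trans hdx
  have hxy' := (gradedSumMap_of _ _ Φ h.map_coder (n - 1) x).symm.trans (hxy.trans (f.addD_of n y))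
  have e1 : TensorCoalg.comm (n - 1) (-1) x.1 P.m = 0 :=
    congrArg Subtype.val (DirectSum.of_injective (β := fun k => coder P.susp k) _
      (hdx'.trans (map_zero _).symm))
  have e2 : Φ x.1 = alongD A C n y.1 :=
    congrArg Subtype.val (DirectSum.of_injective (β := fun k => coderAlong f.toFun k) _ hxy')
  rw [comm_eq_alongD] at e1
  obtain ⟨x', hx', y', hy', e3, e4⟩ := h.exists_lift x.2 y.2 e1 e2
  refine ⟨DirectSum.of (fun k => coder P.susp k) n ⟨x', hx'⟩,
    DirectSum.of (fun k => coderAlong f.toFun k) (n + 1) ⟨y', hy'⟩, ?_, ?_⟩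
  · refine (P.hochschildAddD_of n ⟨x', hx'⟩).trans (gradedSum_of_congr _ rfl ?_)
    exact (comm_eq_alongD n x').trans e3
  · have e5 := gradedSumMap_of (coder P.susp) (coderAlong f.toFun) Φ h.map_coder n ⟨x', hx'⟩
    have e6 : f.addD (DirectSum.of (fun k => coderAlong f.toFun k) (n + 1) ⟨y', hy'⟩)
        = DirectSum.of (fun k => coderAlong f.toFun k) n
          (y - ⟨Φ x', h.map_coder n x' hx'⟩) := by
      refine (f.addD_of _ _).trans (gradedSum_of_congr _ (add_sub_cancel_right n 1) ?_)
      exact eq_sub_of_add_eq' e4.symm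
    refine Eq.trans ?_ (congrArg₂ (· + ·) e5 e6).symm
    rw [map_sub]
    exact (add_sub_cancel _ _).symm

/-- Each weak equivalence gives a cospan whose apex is the complex of coderivations along it; the
chain is handled by induction. -/
theorem WeaklyEquivalent.quasiIsomorphic_hochschild (h : WeaklyEquivalent A C) :
    DGModule.QuasiIsomorphic A.hochschild C.hochschild := by
  induction h with
  | rel A C h =>
    obtain ⟨f, hf⟩ := h
    exact .trans _ _ _ (.rel _ _ ⟨_, (isLeadingAcyclic_postcomp hf).isQuasiIso_hom⟩)
      (.symm _ _ (.rel _ _ ⟨_, (isLeadingAcyclic_precomp hf).isQuasiIso_hom⟩))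
  | refl A => exact .refl _
  | symm A C _ ih => exact .symm _ _ ih
  | trans A B C _ _ ih ih' => exact .trans _ _ _ ih ih'

end AInfAlgebra

/-! ### Graded isomorphisms on homology -/

namespace DGModule

variable {R : Type u} [CommRing R] {𝒜 : ℤ → AddSubgroup R} {M N : DGModule.{u, v} 𝒜}

theorem Hom.map_homologyGr (f : Hom M N) {n : ℤ} {x : M.Homology} (hx : x ∈ M.homologyGr n) :
    f.onHomology x ∈ N.homologyGr n := by
  obtain ⟨z, hz, rfl⟩ := hx
  exact ⟨f.onCycles z, f.map_gr hz, rfl⟩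

/-- If `f z` is homologous to a cycle of degree `n`, projecting this relation to degree `n` shows
that `z` and its degree `n` component have homologous images; injectivity does the rest. So
bijectivity on total homology reflects degrees. -/
theorem Hom.IsQuasiIso.mem_homologyGr_iff {f : Hom M N} (hf : f.IsQuasiIso) {n : ℤ}
    {x : M.Homology} : x ∈ M.homologyGr n ↔ f.onHomology x ∈ N.homologyGr n := by
  refine ⟨f.map_homologyGr, fun h => ?_⟩
  obtain ⟨⟨z, hz⟩, rfl⟩ := M.boundaries.mkQ_surjective x
  obtain ⟨⟨w, hw⟩, hwn, hwz⟩ := h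
  have hz : M.d z = 0 := hz
  have hwn : w ∈ N.gr n := hwn
  have hwz : N.boundaries.mkQ ⟨w, hw⟩ = N.boundaries.mkQ (f.onCycles ⟨z, hz⟩) := hwz
  obtain ⟨y, hy⟩ := mkQ_eq_iff.1 hwz
  have hy : N.d y = w - f.toFun z := hy
  have hpz : M.d (M.proj n z) = 0 := by rw [proj_comm M.mapsGr_d, hz, map_zero]
  refine ⟨⟨M.proj n z, hpz⟩, proj_mem M n z, hf.1 ?_⟩
  change N.boundaries.mkQ (f.onCycles ⟨M.proj n z, hpz⟩) = N.boundaries.mkQ (f.onCycles ⟨z, hz⟩)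
  rw [← hwz, eq_comm, mkQ_eq_iff]
  refine ⟨N.proj (n + 1) y, ?_⟩
  change N.d _ = w - f.toFun (M.proj n z)
  rw [proj_comm N.mapsGr_d, hy, add_neg_cancel_right, map_sub, proj_of_mem hwn,
    proj_comm f.mapsGr, add_zero]

theorem QuasiIsomorphic.exists_homology_equiv (h : QuasiIsomorphic M N) :
    ∃ e : M.Homology ≃ₗ[R] N.Homology,
      ∀ (n : ℤ) (x : M.Homology), x ∈ M.homologyGr n ↔ e x ∈ N.homologyGr n := by
  induction h with
  | rel M N h =>
    obtain ⟨f, hf⟩ := h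
    exact ⟨LinearEquiv.ofBijective f.onHomology hf, fun n x => hf.mem_homologyGr_iff⟩
  | refl M => exact ⟨LinearEquiv.refl R _, fun _ _ => Iff.rfl⟩
  | symm M N _ ih =>
    obtain ⟨e, he⟩ := ih
    exact ⟨e.symm, fun n x => by rw [he n (e.symm x), e.apply_symm_apply]⟩
  | trans M N P _ _ ih ih' =>
    obtain ⟨e, he⟩ := ih
    obtain ⟨e', he'⟩ := ih'
    exact ⟨e.trans e', fun n x => (he n x).trans (he' n (e x))⟩

end DGModule

end

theorem mainTheorem10 {R : Type u} [CommRing R] (𝒜 : ℤ → AddSubgroup R) [GradedRing 𝒜]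
    [IsEvenlyGraded 𝒜] (A C : AInfAlgebra.{u, v} 𝒜) (h : AInfAlgebra.WeaklyEquivalent A C) :
    DGModule.QuasiIsomorphic A.hochschild C.hochschild ∧
      ∃ e : A.hochschild.Homology ≃ₗ[R] C.hochschild.Homology,
        ∀ (n : ℤ) (x : A.hochschild.Homology),
          x ∈ A.hochschild.homologyGr n ↔ e x ∈ C.hochschild.homologyGr n :=
  ⟨h.quasiIsomorphic_hochschild, h.quasiIsomorphic_hochschild.exists_homology_equiv⟩
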